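/- **Setting.** Let $V$ be a complex Hilbert space, $V'$ its anti-dual (bounded antilinear functionals), $\langle v,\ell\rangle=\ell(v)$ the anti-duality, and let $\sigma\ge 0$, $\alpha\ge 0$. Let $L(s):V\to V'$ and $R(s):V\to V$ be families of bounded linear operators, analytic for $\mathrm{Re}\,s>\sigma$, continuous for $\mathrm{Re}\,s\ge\sigma$, with $\|L(s)\|\le M(1+|s|)^\mu$ and $\|R(s)\|\le M(1+|s|)^\mu$ for $\mathrm{Re}\,s>\sigma$ and some real $M,\mu$, and assume $$\mathrm{Re}\,\langle v,L(s)v\rangle\ \ge\ \alpha\,\|R(s)v\|^2\qquad\text{for all }v\in V,\ \mathrm{Re}\,s>\sigma. \tag{1}$$ Consider an $m$-stage Runge–Kutta method with invertible real matrix $\mathscr A=(a_{ij})$ and real weights $b=(b_i)$, and its differentiation symbol $\Delta(\zeta)=\bigl(\mathscr A+\frac{\zeta}{1-\zeta}\mathbb 1 b^T\bigr)^{-1}$, $|\zeta|<1$. For a stepsize $\tau>0$ the convolution quadrature weights $\mathbf W_n(L):V^m\to (V')^m$ are the coefficients of the expansion $L(\Delta(\zeta)/\tau)=\sum_{n\ge0}\mathbf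 W_n(L)\zeta^n$ near $\zeta=0$, and $(L(\partial_t^\tau)\mathbf f)_n=\sum_{j=0}^n\mathbf W_{n-j}(L)\mathbf f_j$ for sequences $\mathbf f=(\mathbf f_n)_{n\ge0}$ in $V^m$; similarly for $R$. Here, for a matrix $S$ with all eigenvalues in $\mathrm{Re}\,\lambda>\sigma$, $L(S)$ is the Cauchy integral $\frac1{2\pi i}\oint (s-S)^{-1}\otimes L(s)\,ds$ over a circle in this half-plane that encloses the eigenvalues, and $L(S)=\lim_{\varepsilon\to0+}L(S+\varepsilon I)$ if there are eigenvalues on the line $\mathrm{Re}\,\lambda=\sigma$. An inner product $(\cdot,\cdot)$ on $\mathbb C^m$, with norm $|\cdot|$, induces an inner product, with norm $\|\cdot\|$, on $V^m$ and an anti-duality between $V^m$ and $(V')^m$ through $(a\otimes u,b\otimes v)=(a,b)(u,v)$ and $\langle a\otimes u,b\otimes \ell\rangle=(a,b)\langle u,\ell\rangle$. **Theorem.** (a) Suppose that for some inner product $(\cdot,\cdot)$ on $\mathbb C^m$ and some $c>0$ the method satisfies, for all sufficiently small $\delta>0$, $$\mathrm{Re}\,(w,\Delta(\zeta)w)\ \ge\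 c\,\delta\,|w|^2\qquad\text{for all }w\in\mathbb C^m,\ |\zeta|\le e^{-\delta}. \tag{2}$$ Then there is $\tau_0>0$, independent of $L$, $R$ and $\alpha$, such that for all $0<\tau\le\tau_0$, with $\widetilde\sigma=\sigma/c$, the expansions of $L(\Delta(\zeta)/\tau)$ and $R(\Delta(\zeta)/\tau)$ converge for $|\zeta|<e^{-\widetilde\sigma\tau}$, and $$\tau\sum_{n=0}^\infty e^{-2\widetilde\sigma n\tau}\,\mathrm{Re}\,\langle\mathbf f_n,(L(\partial_t^\tau)\mathbf f)_n\rangle\ \ge\ \alpha\,\tau\sum_{n=0}^\infty e^{-2\widetilde\sigma n\tau}\,\|(R(\partial_t^\tau)\mathbf f)_n\|^2 \tag{3}$$ for every sequence $\mathbf f$ in $V^m$ with finitely many non-zero entries; for $\alpha>0$ the series on the right converges (for $\alpha=0$ the right-hand side is read as $0$). (b) The two-stage Radau IIA method, $\mathscr A=\begin{pmatrix}5/12&-1/12\\3/4&1/4\end{pmatrix}$, $b^T=(3/4,1/4)$, satisfies (2) for the $b$-weighted inner product $(u,v)=\sum_i b_i\overline{u_i}v_i$ and every $0<c<1$. (c)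 If $\sigma=0$ and the method is algebraically stable (all $b_i>0$ and the symmetric matrix with entries $b_ia_{ij}+b_ja_{ji}-b_ib_j$ is positive semi-definite), then for every $\tau>0$ the expansions converge for $|\zeta|<1$ and (3) holds with $\widetilde\sigma=0$ and with respect to the $b$-weighted inner product. -/

import Mathlib

open scoped Topology ComplexOrder

/-- The coefficients `𝒜 = (a_{ij})` and `b = (b_i)` of an `m`-stage Runge-Kutta method. -/
structure RungeKutta (m : ℕ) where
  /-- the Runge-Kutta matrix -/
  A : Matrix (Fin m) (Fin m) ℝ
  /-- the weights -/
  b : Fin m → ℝ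

namespace RungeKutta

variable {m : ℕ}

/-- The matrix `𝒜 + ζ / (1 - ζ) • 𝟙 bᵀ`. -/
noncomputable def symbolInv (rk : RungeKutta m) (ζ : ℂ) : Matrix (Fin m) (Fin m) ℂ :=
  Matrix.of fun i j => (rk.A i j : ℂ) + ζ / (1 - ζ) * (rk.b j : ℂ)

/-- The Runge-Kutta differentiation symbol `Δ(ζ) = (𝒜 + ζ / (1 - ζ) • 𝟙 bᵀ)⁻¹`, `|ζ| < 1`. -/
noncomputable def symbol (rk : RungeKutta m) (ζ : ℂ) : Matrix (Fin m) (Fin m) ℂ :=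
  (rk.symbolInv ζ)⁻¹

/-- Algebraic stability: all weights are positive and the symmetric matrix with entries
`b_i a_{ij} + b_j a_{ji} - b_i b_j` is positive semi-definite. -/
def AlgebraicallyStable (rk : RungeKutta m) : Prop :=
  (∀ i, 0 < rk.b i) ∧
    (Matrix.of fun i j =>
      rk.b i * rk.A i j + rk.b j * rk.A j i - rk.b i * rk.b j).PosSemidef

/-- The Gram matrix of the `b`-weighted inner product `(u, v) = ∑ i, b_i * conj (u_i) * v_i`. -/
noncomputable def gram (rk : RungeKutta m) : Matrix (Fin m) (Fin m) ℂ :=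
  Matrix.diagonal fun i => (rk.b i : ℂ)

/-- The two-stage Radau IIA method. -/
noncomputable def radauIIA2 : RungeKutta 2 where
  A := !![5 / 12, -1 / 12; 3 / 4, 1 / 4]
  b := ![3 / 4, 1 / 4]

end RungeKutta

/-! Inner products on `ℂᵐ` (antilinear in the first argument) are represented by their Gram
matrices `H`, which are exactly the positive definite Hermitian matrices. -/

section InnerProducts

variable {m : ℕ}

/-- The inner product `(u, v) = ∑ i j, H i j * conj (u i) * v j` on `ℂᵐ`. -/
noncomputable def gramInner (H : Matrix (Fin m) (Fin m) ℂ) (u v : Fin m → ℂ) : ℂ :=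
  star u ⬝ᵥ (H.mulVec v)

/-- Coercivity of the differentiation symbol with constant `c`, with respect to the inner product
with Gram matrix `H`: for all sufficiently small `δ > 0`,
`Re (w, Δ(ζ) w) ≥ c δ |w|²` for all `w ∈ ℂᵐ` and `|ζ| ≤ e^{-δ}`. -/
def RungeKutta.SymbolCoercive (rk : RungeKutta m) (H : Matrix (Fin m) (Fin m) ℂ) (c : ℝ) : Prop :=
  ∃ δ₀ : ℝ, 0 < δ₀ ∧ ∀ δ : ℝ, 0 < δ → δ ≤ δ₀ → ∀ ζ : ℂ, ‖ζ‖ ≤ Real.exp (-δ) →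
    ∀ w : Fin m → ℂ,
      c * δ * (gramInner H w w).re ≤ (gramInner H w ((rk.symbol ζ).mulVec w)).re

variable {V : Type*} [NormedAddCommGroup V] [InnerProductSpace ℂ V]

/-- The squared norm on `V^m` induced by the inner product on `ℂᵐ` with Gram matrix `H`,
that is, from `(a ⊗ u, b ⊗ v) = (a, b) (u, v)`. -/
noncomputable def gramNormSq (H : Matrix (Fin m) (Fin m) ℂ) (x : Fin m → V) : ℝ :=
  (∑ i, ∑ j, H i j * inner ℂ (x i) (x j)).re

/-- The anti-duality between `V^m` and `(V')^m` induced by the inner product on `ℂᵐ` with Gram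
matrix `H`, that is, from `⟨a ⊗ u, b ⊗ ℓ⟩ = (a, b) ⟨u, ℓ⟩`. Here `V'` is the space of bounded
antilinear functionals on `V`, and `⟨u, ℓ⟩ = ℓ u`. -/
noncomputable def gramPairing (H : Matrix (Fin m) (Fin m) ℂ) (x : Fin m → V)
    (ℓ : Fin m → (V →L⋆[ℂ] ℂ)) : ℂ :=
  ∑ i, ∑ j, H i j * ℓ j (x i)

end InnerProducts

section MatrixFunctions

variable {m : ℕ} {E : Type*} [NormedAddCommGroup E] [NormedSpace ℂ E]

/-- `K` is analytic on `Re s > σ`, continuous on `Re s ≥ σ`, and bounded by `M (1 + |s|)^μ`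
on `Re s > σ`. -/
structure IsAnalyticFamily (σ M μ : ℝ) (K : ℂ → E) : Prop where
  analytic : DifferentiableOn ℂ K {s | σ < s.re}
  cont : ContinuousOn K {s | σ ≤ s.re}
  bound : ∀ s : ℂ, σ < s.re → ‖K s‖ ≤ M * (1 + ‖s‖) ^ μ

/-- The `(i, j)` entry of the Cauchy integral `(2πi)⁻¹ ∮ (s - S)⁻¹ ⊗ K(s) ds` over the circle with
centre `z` and radius `r`. -/
noncomputable def cauchyMatrixIntegral (K : ℂ → E) (z : ℂ) (r : ℝ)
    (S : Matrix (Fin m) (Fin m) ℂ) (i j : Fin m) : E :=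
  (2 * Real.pi * Complex.I : ℂ)⁻¹ •
    ∮ s in C(z, r), ((s • (1 : Matrix (Fin m) (Fin m) ℂ) - S)⁻¹ i j) • K s

/-- The disc with centre `p.1` and radius `p.2` has its closure in the half-plane `Re s > σ`, and
it contains all the eigenvalues of `S`. -/
def EnclosesSpectrum (σ : ℝ) (S : Matrix (Fin m) (Fin m) ℂ) (p : ℂ × ℝ) : Prop :=
  0 < p.2 ∧ Metric.closedBall p.1 p.2 ⊆ {s : ℂ | σ < s.re} ∧
    spectrum ℂ S ⊆ Metric.ball p.1 p.2

open Classical in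
/-- The operator-valued matrix function `K(S)`, as an `m × m` array of operators, for a matrix `S`
all of whose eigenvalues satisfy `Re λ > σ`: the Cauchy integral over any circle in this half-plane
that encloses the eigenvalues (the integral does not depend on the circle). -/
noncomputable def matrixFunctionOpen (σ : ℝ) (K : ℂ → E)
    (S : Matrix (Fin m) (Fin m) ℂ) (i j : Fin m) : E :=
  if h : ∃ p : ℂ × ℝ, EnclosesSpectrum σ S p then
    cauchyMatrixIntegral K h.choose.1 h.choose.2 S i j
  else 0

/-- The operator-valued matrix function `K(S) = lim_{ε → 0+} K(S + ε I)`. If all eigenvalues of `S`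
satisfy `Re λ > σ`, it is the Cauchy integral above; the limit extends it, by the continuity of `K`
on `Re s ≥ σ`, to matrices with semisimple eigenvalues on the line `Re s = σ`. -/
noncomputable def matrixFunction (σ : ℝ) (K : ℂ → E)
    (S : Matrix (Fin m) (Fin m) ℂ) (i j : Fin m) : E :=
  Filter.limUnder (𝓝[>] (0 : ℝ)) fun ε : ℝ =>
    matrixFunctionOpen σ K (S + (ε : ℂ) • (1 : Matrix (Fin m) (Fin m) ℂ)) i j

/-- The operator-valued matrix function `K(Δ(ζ) / τ)`. -/
noncomputable def cqSymbol (rk : RungeKutta m) (σ τ : ℝ) (K : ℂ → E) (ζ : ℂ)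
    (i j : Fin m) : E :=
  matrixFunction σ K ((τ : ℂ)⁻¹ • rk.symbol ζ) i j

/-- The convolution quadrature weights `W_n(K)`: the Taylor coefficients at `ζ = 0` of
`K(Δ(ζ) / τ) = ∑ n, W_n(K) ζ^n`. -/
noncomputable def cqWeight (rk : RungeKutta m) (σ τ : ℝ) (K : ℂ → E) (n : ℕ)
    (i j : Fin m) : E :=
  ((n.factorial : ℂ)⁻¹) • iteratedDeriv n (fun ζ => cqSymbol rk σ τ K ζ i j) 0

end MatrixFunctions

section ConvolutionQuadrature

variable {m : ℕ} {V F : Type*} [NormedAddCommGroup V] [NormedSpace ℂ V]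
  [NormedAddCommGroup F] [NormedSpace ℂ F]

/-- The Runge-Kutta convolution quadrature
`(K(∂_t^τ) f)_n = ∑_{k=0}^n W_{n-k}(K) f_k`, for a sequence `f` in `V^m`. -/
noncomputable def cqConv (rk : RungeKutta m) (σ τ : ℝ) (K : ℂ → V →L[ℂ] F)
    (f : ℕ → Fin m → V) (n : ℕ) : Fin m → F :=
  fun i => ∑ k ∈ Finset.range (n + 1), ∑ j, cqWeight rk σ τ K (n - k) i j (f k j)

end ConvolutionQuadrature

section Coercivity

variable {m : ℕ} {V : Type*} [NormedAddCommGroup V] [InnerProductSpace ℂ V]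

/-- Continuous coercivity: `L` and `R` are polynomially bounded analytic families on `Re s > σ`,
continuous on `Re s ≥ σ`, with
`Re ⟨v, L(s) v⟩ ≥ α ‖R(s) v‖²` for all `v ∈ V` and `Re s > σ`. -/
structure ContinuousCoercivity (σ α : ℝ) (L : ℂ → V →L[ℂ] (V →L⋆[ℂ] ℂ))
    (R : ℂ → V →L[ℂ] V) : Prop where
  families : ∃ M μ : ℝ, IsAnalyticFamily σ M μ L ∧ IsAnalyticFamily σ M μ R
  coercive : ∀ (v : V) (s : ℂ), σ < s.re → α * ‖R s v‖ ^ 2 ≤ (L s v v).re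

/-- Discrete coercivity with stepsize `τ` and exponential weight `σ'`, with respect to the inner
product on `ℂᵐ` with Gram matrix `H`. The expansions that define the convolution quadrature
converge on the disc `|ζ| < e^{-σ' τ}`, and for every finitely supported sequence `f` in `V^m` the
weighted sums satisfy the coercivity inequality, where the series on the right converges unless
`α = 0`. -/
structure DiscreteCoercivity (rk : RungeKutta m) (H : Matrix (Fin m) (Fin m) ℂ)
    (σ σ' τ α : ℝ) (L : ℂ → V →L[ℂ] (V →L⋆[ℂ] ℂ)) (R : ℂ → V →L[ℂ] V) : Prop where
  expansion_L : ∀ ζ : ℂ, ‖ζ‖ < Real.exp (-σ' * τ) → ∀ i j,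
    HasSum (fun n : ℕ => ζ ^ n • cqWeight rk σ τ L n i j) (cqSymbol rk σ τ L ζ i j)
  expansion_R : ∀ ζ : ℂ, ‖ζ‖ < Real.exp (-σ' * τ) → ∀ i j,
    HasSum (fun n : ℕ => ζ ^ n • cqWeight rk σ τ R n i j) (cqSymbol rk σ τ R ζ i j)
  summable : ∀ f : ℕ → Fin m → V, (Function.support f).Finite → α ≠ 0 →
    Summable fun n : ℕ =>
      Real.exp (-2 * σ' * n * τ) * gramNormSq H (cqConv rk σ τ R f n)
  inequality : ∀ f : ℕ → Fin m → V, (Function.support f).Finite →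
    α * (τ * ∑' n : ℕ, Real.exp (-2 * σ' * n * τ) * gramNormSq H (cqConv rk σ τ R f n)) ≤
      τ * ∑' n : ℕ, Real.exp (-2 * σ' * n * τ) *
        (gramPairing H (f n) (cqConv rk σ τ L f n)).re

end Coercivity

/-! ### Fourier coefficients as averages over the unit circle -/

section FourierAverages

open Real Complex ComplexConjugate

/-! The core is a von Neumann type inequality: the scalar estimate `Re ⟨v, L(s)v⟩ ≥ α‖R(s)v‖²` on a
half-plane is inherited by `L(S)` and `R(S)` whenever the matrix `S` is accretive with a constant
larger than `σ` (`coercive_matrixFunctionOpen`). Writing the Gram matrix as `CᴴC` reduces to the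
Euclidean inner product. A strictly accretive matrix then lies in a disc about a large real point
`z`, so it is `z + r₁T` with `T` a strict contraction, and the matrix functions become power series
in `T`.

For a contraction the estimate comes from the unit circle (`coercive_of_contraction`). Parseval
turns the pointwise estimate into one for causal convolutions (`sum_norm_sq_coeff_le`). This is
tested with the sequence `u_k = D T^(N-1-k) x`, where `DᴴD = 1 - TᴴT`. By causality the convolution
reproduces partial sums of `F(T)x`, and since the sum of `(T^l)ᴴ DᴴD T^l` telescopes to the
identity, `N → ∞` gives the estimate for `F(T)`. In effect this is a hands-on unitary dilation.

Applied to `S = Δ(ζ)/τ + εI` with `ε → 0`, this gives coercivity of the symbols for every `ζ` in the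
disc. A second use of Parseval, on circles of radius `r < e^(-σ'τ)`, carries it to the time domain
(`coercive_weightConv`).

The limit `ε → 0` must exist and be analytic in `ζ`, also when `Δ(ζ)/τ` has eigenvalues on the line
`Re λ = σ`. For an accretive matrix their eigenspaces are reducing, so they can be split off one at
a time. In the families that occur the boundary eigenvectors do not depend on `ζ`, so the split-off
part is constant (`exists_tendsto_matrixFunctionOpen`). In (a) there are none. In (c) an imaginary
eigenvalue forces `bᵀw = 0`, and then `Δ(ζ)⁻¹w = 𝒜w` for all `ζ`. Part (b) is a discriminant
condition for a quadratic form in two variables. -/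

theorem circleAverage_zpow (k : ℤ) :
    circleAverage (fun z : ℂ => z ^ k) 0 1 = if k = 0 then 1 else 0 := by
  rw [circleAverage_eq_circleIntegral one_ne_zero]
  split_ifs with hk
  · subst hk
    have : (∮ z in C((0 : ℂ), 1), (z - 0)⁻¹) = 2 * π * I :=
      circleIntegral.integral_sub_center_inv 0 one_ne_zero
    have h2 : (2 * π * I : ℂ) ≠ 0 := Complex.two_pi_I_ne_zero
    simp only [zpow_zero, smul_eq_mul, mul_one, this]
    exact inv_mul_cancel₀ h2
  · have h1 : (∮ z in C((0 : ℂ), 1), (z - 0) ^ (k - 1)) = 0 :=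
      circleIntegral.integral_sub_zpow_of_ne (by omega) 0 0 1
    have h2 : (∮ z in C((0 : ℂ), 1), (z - 0)⁻¹ • z ^ k) = ∮ z in C((0 : ℂ), 1), (z - 0) ^ (k - 1) := by
      refine circleIntegral.integral_congr zero_le_one fun z hz => ?_
      have hz0 : z ≠ 0 := by
        rintro rfl
        simp at hz
      simp only [sub_zero, smul_eq_mul]
      rw [zpow_sub_one₀ hz0, mul_comm]
    rw [h2, h1, smul_zero]

theorem norm_circleMap_zero_one (θ : ℝ) : ‖circleMap 0 1 θ‖ = 1 := by simp

theorem conj_pow_mul_pow_of_norm_one {z : ℂ} (hz : ‖z‖ = 1) (n j : ℕ) :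
    conj z ^ n * z ^ j = z ^ ((j : ℤ) - n) := by
  have hz0 : z ≠ 0 := by
    rintro rfl
    simp at hz
  have : conj z = z⁻¹ := by
    rw [Complex.inv_def, Complex.normSq_eq_norm_sq, hz]
    simp
  rw [this, zpow_sub₀ hz0, zpow_natCast, zpow_natCast, inv_pow, div_eq_mul_inv, mul_comm]

theorem continuous_tsum_circleMap_pow_smul {E : Type*} [NormedAddCommGroup E] [NormedSpace ℂ E]
    [CompleteSpace E] {c : ℕ → E} (hc : Summable fun j => ‖c j‖) :
    Continuous fun θ : ℝ => ∑' j, circleMap 0 1 θ ^ j • c j := by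
  refine continuous_tsum (u := fun j => ‖c j‖) (fun j => ?_) hc fun j θ => ?_
  · fun_prop
  · rw [norm_smul, norm_pow, norm_circleMap_zero_one, one_pow, one_mul]

theorem circleAverage_conj_pow_mul_tsum {c : ℕ → ℂ} (hc : Summable fun j => ‖c j‖) (n : ℕ) :
    circleAverage (fun z : ℂ => conj z ^ n * ∑' j, z ^ j * c j) 0 1 = c n := by
  have hterm : ∀ j, ∫ θ in (0 : ℝ)..2 * π, conj (circleMap 0 1 θ) ^ n * (circleMap 0 1 θ ^ j * c j)
      = (2 * π : ℝ) • if j = n then c j else 0 := by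
    intro j
    have h := circleAverage_zpow ((j : ℤ) - n)
    rw [circleAverage_def] at h
    have h3 : ∀ θ : ℝ, conj (circleMap 0 1 θ) ^ n * (circleMap 0 1 θ ^ j * c j) =
        circleMap 0 1 θ ^ ((j : ℤ) - n) * c j := fun θ => by
      rw [← mul_assoc, conj_pow_mul_pow_of_norm_one (norm_circleMap_zero_one θ)]
    simp_rw [h3]
    rw [intervalIntegral.integral_mul_const]
    have h4 : (∫ θ in (0 : ℝ)..2 * π, circleMap 0 1 θ ^ ((j : ℤ) - n)) =
        (2 * π : ℝ) • if ((j : ℤ) - n) = 0 then (1 : ℂ) else 0 := by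
      rw [← h, smul_smul, mul_inv_cancel₀ (by positivity), one_smul]
    rw [h4]
    by_cases hj : j = n
    · simp [hj]
    · have : (j : ℤ) - n ≠ 0 := by omega
      simp [hj, this]
  have hsum : HasSum
      (fun j => ∫ θ in (0 : ℝ)..2 * π, conj (circleMap 0 1 θ) ^ n * (circleMap 0 1 θ ^ j * c j))
      (∫ θ in (0 : ℝ)..2 * π, conj (circleMap 0 1 θ) ^ n * ∑' j, circleMap 0 1 θ ^ j * c j) := by
    refine intervalIntegral.hasSum_integral_of_dominated_convergence (fun j _ => ‖c j‖)
      (fun j => ?_) (fun j => ?_) ?_ ?_ ?_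
    · refine Continuous.aestronglyMeasurable ?_
      have := Complex.continuous_conj
      fun_prop
    · refine Filter.Eventually.of_forall fun θ _ => ?_
      simp
    · exact Filter.Eventually.of_forall fun _ _ => hc
    · exact continuous_const.intervalIntegrable _ _
    · refine Filter.Eventually.of_forall fun θ _ => ?_
      refine HasSum.mul_left _ (Summable.hasSum ?_)
      refine Summable.of_norm ?_
      simpa using hc
  simp_rw [hterm] at hsum
  have h5 : HasSum (fun j => (2 * π : ℝ) • if j = n then c j else 0) ((2 * π : ℝ) • c n) := by
    have := hasSum_single (f := fun j => (2 * π : ℝ) • if j = n then c j else 0) n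
      (fun j hj => by simp [hj])
    simpa using this
  rw [circleAverage_def, hsum.unique h5, smul_smul, inv_mul_cancel₀ (by positivity), one_smul]

theorem re_circleAverage_nonneg {f : ℂ → ℂ} (hf : Continuous fun θ : ℝ => f (circleMap 0 1 θ))
    (h : ∀ z : ℂ, ‖z‖ = 1 → 0 ≤ (f z).re) : 0 ≤ (circleAverage f 0 1).re := by
  rw [circleAverage_def, Complex.real_smul, Complex.re_ofReal_mul]
  refine mul_nonneg (by positivity) ?_
  have : ∫ θ in (0 : ℝ)..2 * π, (f (circleMap 0 1 θ)).re =
      (∫ θ in (0 : ℝ)..2 * π, f (circleMap 0 1 θ)).re :=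
    Complex.reCLM.intervalIntegral_comp_comm (hf.intervalIntegrable 0 (2 * π))
  rw [← this]
  exact intervalIntegral.integral_nonneg (by positivity) fun θ _ => h _ (norm_circleMap_zero_one θ)

end FourierAverages

/-! ### Matrices acting on arrays of vectors -/

section ArrayAction

variable {m : ℕ}

/-- The action of an `m × m` matrix on `E^m`. -/
def arrAct {E : Type*} [AddCommGroup E] [Module ℂ E] (M : Matrix (Fin m) (Fin m) ℂ)
    (x : Fin m → E) : Fin m → E :=
  fun i => ∑ j, M i j • x j

section

variable {E F : Type*} [AddCommGroup E] [Module ℂ E] [AddCommGroup F] [Module ℂ F]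

theorem arrAct_add (M : Matrix (Fin m) (Fin m) ℂ) (x y : Fin m → E) :
    arrAct M (x + y) = arrAct M x + arrAct M y := by
  ext i
  simp [arrAct, Finset.sum_add_distrib]

theorem arrAct_smul (M : Matrix (Fin m) (Fin m) ℂ) (c : ℂ) (x : Fin m → E) :
    arrAct M (c • x) = c • arrAct M x := by
  ext i
  simp [arrAct, Finset.smul_sum, smul_comm c]

theorem smul_arrAct (M : Matrix (Fin m) (Fin m) ℂ) (c : ℂ) (x : Fin m → E) :
    arrAct (c • M) x = c • arrAct M x := by
  ext i
  simp [arrAct, Finset.smul_sum, mul_smul]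

theorem sub_arrAct (M N : Matrix (Fin m) (Fin m) ℂ) (x : Fin m → E) :
    arrAct (M - N) x = arrAct M x - arrAct N x := by
  ext i
  simp [arrAct, sub_smul]

theorem one_arrAct (x : Fin m → E) : arrAct (1 : Matrix (Fin m) (Fin m) ℂ) x = x := by
  ext i
  simp [arrAct, Matrix.one_apply]

theorem mul_arrAct (M N : Matrix (Fin m) (Fin m) ℂ) (x : Fin m → E) :
    arrAct (M * N) x = arrAct M (arrAct N x) := by
  ext i
  simp only [arrAct, Matrix.mul_apply, Finset.sum_smul, Finset.smul_sum, mul_smul]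
  exact Finset.sum_comm

/-- The linear map underlying `arrAct`. -/
def arrActLin (M : Matrix (Fin m) (Fin m) ℂ) : (Fin m → E) →ₗ[ℂ] (Fin m → E) where
  toFun := arrAct M
  map_add' := arrAct_add M
  map_smul' := arrAct_smul M

theorem arrAct_sum {ι : Type*} (s : Finset ι) (M : Matrix (Fin m) (Fin m) ℂ)
    (x : ι → Fin m → E) : arrAct M (∑ k ∈ s, x k) = ∑ k ∈ s, arrAct M (x k) :=
  map_sum (arrActLin M) x s

theorem arrAct_comp (M : Matrix (Fin m) (Fin m) ℂ) (f : E →ₗ[ℂ] F) (x : Fin m → E) :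
    arrAct M (fun i => f (x i)) = fun i => f (arrAct M x i) := by
  ext i
  simp [arrAct]

end

theorem continuous_arrAct {E : Type*} [NormedAddCommGroup E] [NormedSpace ℂ E]
    (M : Matrix (Fin m) (Fin m) ℂ) : Continuous (arrAct M : (Fin m → E) → Fin m → E) := by
  unfold arrAct
  fun_prop

end ArrayAction

/-! ### The anti-duality pairing, and Parseval in the form of an inequality -/

section Pairing

open Real Complex ComplexConjugate

variable {m : ℕ} {V : Type*} [NormedAddCommGroup V] [InnerProductSpace ℂ V]

/-- The anti-duality between `V^m` and `(V')^m` for the standard inner product on `ℂᵐ`. -/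
noncomputable def pairing (x : Fin m → V) (ℓ : Fin m → (V →L⋆[ℂ] ℂ)) : ℂ :=
  ∑ i, ℓ i (x i)

/-- The linear Riesz map from `V` to its anti-dual. -/
noncomputable def rieszMap : V →L[ℂ] (V →L⋆[ℂ] ℂ) := (innerSL ℂ).flip

theorem rieszMap_apply (v w : V) : rieszMap v w = inner ℂ w v := rfl

/-- The pairing with a fixed element of `V^m`, as a continuous linear functional. -/
noncomputable def pairingCLM (x : Fin m → V) : (Fin m → (V →L⋆[ℂ] ℂ)) →L[ℂ] ℂ :=
  ∑ i, ((ContinuousLinearMap.apply' ℂ (starRingEnd ℂ) (x i)).comp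
    (ContinuousLinearMap.proj i))

theorem pairingCLM_apply (x : Fin m → V) (ℓ : Fin m → (V →L⋆[ℂ] ℂ)) :
    pairingCLM x ℓ = pairing x ℓ := by
  simp [pairingCLM, pairing]

theorem pairing_smul (c : ℂ) (x : Fin m → V) (ℓ : Fin m → (V →L⋆[ℂ] ℂ)) :
    pairing (c • x) ℓ = conj c * pairing x ℓ := by
  simp [pairing, Finset.mul_sum]

theorem pairing_smul_right (c : ℂ) (x : Fin m → V) (ℓ : Fin m → (V →L⋆[ℂ] ℂ)) :
    pairing x (c • ℓ) = c * pairing x ℓ := by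
  simp [pairing, Finset.mul_sum]

theorem pairing_sub_right (x : Fin m → V) (ℓ ℓ' : Fin m → (V →L⋆[ℂ] ℂ)) :
    pairing x (ℓ - ℓ') = pairing x ℓ - pairing x ℓ' := by
  simp [pairing]

theorem pairing_sum {ι : Type*} (s : Finset ι) (x : ι → Fin m → V) (ℓ : Fin m → (V →L⋆[ℂ] ℂ)) :
    pairing (∑ k ∈ s, x k) ℓ = ∑ k ∈ s, pairing (x k) ℓ := by
  simp only [pairing, Finset.sum_apply, map_sum]
  exact Finset.sum_comm

theorem pairing_arrAct (M N : Matrix (Fin m) (Fin m) ℂ) (x : Fin m → V)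
    (ℓ : Fin m → (V →L⋆[ℂ] ℂ)) :
    pairing (arrAct M x) (arrAct N ℓ) = pairing x (arrAct (M.conjTranspose * N) ℓ) := by
  simp only [pairing, arrAct, map_sum, _root_.sum_apply,
    _root_.smul_apply, Matrix.mul_apply, Finset.sum_smul,
    ContinuousLinearMap.map_smulₛₗ, smul_eq_mul, Matrix.conjTranspose_apply]
  rw [Finset.sum_comm]
  refine Finset.sum_congr rfl fun i _ => ?_
  rw [Finset.sum_comm]
  refine Finset.sum_congr rfl fun j _ => Finset.sum_congr rfl fun k _ => ?_
  simp only [RCLike.star_def]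
  ring

theorem gramPairing_eq_pairing (H : Matrix (Fin m) (Fin m) ℂ) (x : Fin m → V)
    (ℓ : Fin m → (V →L⋆[ℂ] ℂ)) : gramPairing H x ℓ = pairing x (arrAct H ℓ) := by
  simp [gramPairing, pairing, arrAct]

/-- Every Gram matrix has the form `CᴴC`; with the analogue for `gramNormSq` this reduces all inner
products on `ℂᵐ` to the Euclidean one. -/
theorem gramPairing_conjTranspose_mul_self (C : Matrix (Fin m) (Fin m) ℂ) (x : Fin m → V)
    (ℓ : Fin m → (V →L⋆[ℂ] ℂ)) :
    gramPairing (C.conjTranspose * C) x ℓ = pairing (arrAct C x) (arrAct C ℓ) := by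
  rw [gramPairing_eq_pairing, pairing_arrAct]

theorem pairing_rieszMap_self (x : Fin m → V) :
    pairing x (fun i => rieszMap (x i)) = ((∑ i, ‖x i‖ ^ 2 : ℝ) : ℂ) := by
  simp only [pairing, rieszMap_apply, inner_self_eq_norm_sq_to_K]
  push_cast
  rfl

theorem gramNormSq_conjTranspose_mul_self (C : Matrix (Fin m) (Fin m) ℂ) (x : Fin m → V) :
    gramNormSq (C.conjTranspose * C) x = ∑ i, ‖arrAct C x i‖ ^ 2 := by
  have h : gramNormSq (C.conjTranspose * C) x =
      (gramPairing (C.conjTranspose * C) x fun i => rieszMap (x i)).re := by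
    simp [gramNormSq, gramPairing, rieszMap_apply]
  rw [h, gramPairing_conjTranspose_mul_self]
  have := arrAct_comp C (rieszMap : V →L[ℂ] (V →L⋆[ℂ] ℂ)).toLinearMap x
  simp only [ContinuousLinearMap.coe_coe] at this
  rw [this, pairing_rieszMap_self, Complex.ofReal_re]

theorem pairing_sum_pow_smul_tsum (u : ℕ → Fin m → V) {h : ℕ → Fin m → (V →L⋆[ℂ] ℂ)}
    {z : ℂ} (hh : Summable fun n => z ^ n • h n) (N : ℕ) :
    pairing (∑ n ∈ Finset.range N, z ^ n • u n) (∑' n, z ^ n • h n) =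
      ∑ n ∈ Finset.range N, conj z ^ n * ∑' j, z ^ j * pairing (u n) (h j) := by
  rw [pairing_sum]
  refine Finset.sum_congr rfl fun n _ => ?_
  rw [pairing_smul, map_pow]
  congr 1
  rw [← pairingCLM_apply, ContinuousLinearMap.map_tsum _ hh]
  simp [pairingCLM_apply]

theorem summable_pow_smul_of_norm_one {E : Type*} [NormedAddCommGroup E] [NormedSpace ℂ E]
    [CompleteSpace E] {c : ℕ → E} (hc : Summable fun j => ‖c j‖) {z : ℂ} (hz : ‖z‖ = 1) :
    Summable fun j => z ^ j • c j := by
  refine Summable.of_norm ?_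
  simpa [norm_smul, hz] using hc

theorem summable_norm_pairing (x : Fin m → V) {h : ℕ → Fin m → (V →L⋆[ℂ] ℂ)}
    (hh : Summable fun n => ‖h n‖) : Summable fun n => ‖pairing x (h n)‖ := by
  simp_rw [← pairingCLM_apply]
  exact Summable.of_nonneg_of_le (fun _ => norm_nonneg _)
    (fun n => (pairingCLM x).le_opNorm (h n)) (hh.mul_left _)

/-- Orthogonality of the powers of `z` leaves only the products of coefficients with equal index.
Continuity is recorded because integrability is needed whenever such averages are added. -/
theorem circleAverage_pairing (u : ℕ → Fin m → V) {h : ℕ → Fin m → (V →L⋆[ℂ] ℂ)}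
    (hh : Summable fun n => ‖h n‖) (N : ℕ) :
    circleAverage (fun z : ℂ => pairing (∑ n ∈ Finset.range N, z ^ n • u n)
      (∑' n, z ^ n • h n)) 0 1 = ∑ n ∈ Finset.range N, pairing (u n) (h n) ∧
    Continuous fun θ : ℝ => pairing (∑ n ∈ Finset.range N, circleMap 0 1 θ ^ n • u n)
      (∑' n, circleMap 0 1 θ ^ n • h n) := by
  have key : ∀ z : ℂ, ‖z‖ = 1 → pairing (∑ n ∈ Finset.range N, z ^ n • u n)
      (∑' n, z ^ n • h n) =
      ∑ n ∈ Finset.range N, conj z ^ n * ∑' j, z ^ j * pairing (u n) (h j) := fun z hz =>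
    pairing_sum_pow_smul_tsum u (summable_pow_smul_of_norm_one hh hz) N
  have hcont : ∀ n, Continuous fun θ : ℝ =>
      conj (circleMap 0 1 θ) ^ n * ∑' j, circleMap 0 1 θ ^ j * pairing (u n) (h j) := by
    intro n
    have h1 := continuous_tsum_circleMap_pow_smul (summable_norm_pairing (u n) hh)
    simp only [smul_eq_mul] at h1
    have := Complex.continuous_conj
    fun_prop
  constructor
  · rw [circleAverage_congr_sphere (f₂ := fun z => ∑ n ∈ Finset.range N,
      conj z ^ n * ∑' j, z ^ j * pairing (u n) (h j)), circleAverage_fun_sum]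
    · exact Finset.sum_congr rfl fun n _ =>
        circleAverage_conj_pow_mul_tsum (summable_norm_pairing (u n) hh) n
    · exact fun n _ => (hcont n).intervalIntegrable _ _
    · intro z hz
      exact key z (by simpa using hz)
  · have : (fun θ : ℝ => pairing (∑ n ∈ Finset.range N, circleMap 0 1 θ ^ n • u n)
        (∑' n, circleMap 0 1 θ ^ n • h n)) = fun θ => ∑ n ∈ Finset.range N,
        conj (circleMap 0 1 θ) ^ n * ∑' j, circleMap 0 1 θ ^ j * pairing (u n) (h j) :=
      funext fun θ => key _ (norm_circleMap_zero_one θ)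
    rw [this]
    exact continuous_finsetSum _ fun n _ => hcont n

/-- A pointwise coercivity estimate on the unit circle passes to Fourier coefficients. -/
theorem sum_norm_sq_coeff_le [CompleteSpace V] {α : ℝ} (hα : 0 ≤ α) (u : ℕ → Fin m → V)
    {g : ℕ → Fin m → V} {h : ℕ → Fin m → (V →L⋆[ℂ] ℂ)} (hg : Summable fun n => ‖g n‖)
    (hh : Summable fun n => ‖h n‖) (N : ℕ)
    (hcoer : ∀ z : ℂ, ‖z‖ = 1 → α * ∑ i, ‖(∑' n, z ^ n • g n) i‖ ^ 2 ≤
      (pairing (∑ n ∈ Finset.range N, z ^ n • u n) (∑' n, z ^ n • h n)).re) :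
    α * ∑ n ∈ Finset.range N, ∑ i, ‖g n i‖ ^ 2 ≤
      ∑ n ∈ Finset.range N, (pairing (u n) (h n)).re := by
  let J : (Fin m → V) →L[ℂ] (Fin m → (V →L⋆[ℂ] ℂ)) :=
    ContinuousLinearMap.pi fun i => rieszMap.comp (ContinuousLinearMap.proj i)
  have hJ : ∀ x, J x = fun i => rieszMap (x i) := fun x => rfl
  let b : ℕ → Fin m → (V →L⋆[ℂ] ℂ) := fun n => J (g n)
  -- `b'` holds the coefficients of the truncation `P` of `G = ∑ zⁿ gₙ`. The bound `‖G‖² ≥ 2 Re ⟨P,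
  -- G⟩ - ‖P‖²` replaces the squared norm of a series by pairings with a polynomial on the left, and
  -- both pairings average to the same sum over `n < N`.
  let b' : ℕ → Fin m → (V →L⋆[ℂ] ℂ) := fun n => if n ∈ Finset.range N then J (g n) else 0
  have hb : Summable fun n => ‖b n‖ :=
    Summable.of_nonneg_of_le (fun _ => norm_nonneg _) (fun n => J.le_opNorm (g n))
      (hg.mul_left _)
  have hb' : Summable fun n => ‖b' n‖ := by
    refine summable_of_ne_finset_zero (s := Finset.range N) fun n hn => ?_
    simp only [b', if_neg hn, norm_zero]
  obtain ⟨a1, c1⟩ := circleAverage_pairing u hh N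
  obtain ⟨a2, c2⟩ := circleAverage_pairing g hb N
  obtain ⟨a3, c3⟩ := circleAverage_pairing g hb' N
  have e3 : ∑ n ∈ Finset.range N, pairing (g n) (b' n) =
      ∑ n ∈ Finset.range N, pairing (g n) (b n) :=
    Finset.sum_congr rfl fun n hn => by simp only [b', b, if_pos hn]
  set A : ℂ → ℂ := fun z => pairing (∑ n ∈ Finset.range N, z ^ n • u n) (∑' n, z ^ n • h n)
  set B : ℂ → ℂ := fun z => pairing (∑ n ∈ Finset.range N, z ^ n • g n) (∑' n, z ^ n • b n)
  set B' : ℂ → ℂ := fun z => pairing (∑ n ∈ Finset.range N, z ^ n • g n) (∑' n, z ^ n • b' n)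
  have c2' : Continuous fun θ : ℝ => (2 * α : ℝ) • B (circleMap 0 1 θ) :=
    c2.const_smul (2 * α : ℝ)
  have c3' : Continuous fun θ : ℝ => α • B' (circleMap 0 1 θ) :=
    c3.const_smul α
  have c23 : Continuous fun θ : ℝ => (2 * α : ℝ) • B (circleMap 0 1 θ) -
    α • B' (circleMap 0 1 θ) := c2'.sub c3'
  have hpos := re_circleAverage_nonneg (f := fun z => A z - ((2 * α : ℝ) • B z - α • B' z))
    (c1.sub (c23)) (by
      intro z hz
      have h1 := hcoer z hz
      set P := ∑ n ∈ Finset.range N, z ^ n • g n with hP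
      set G := ∑' n, z ^ n • g n with hG
      have hB : B z = pairing P (J G) := by
        simp only [B]
        rw [hG, J.map_tsum (summable_pow_smul_of_norm_one hg hz)]
        simp [b, hP]
      have hB' : B' z = pairing P (J P) := by
        simp only [B']
        have ht : ∑' n, z ^ n • b' n = ∑ n ∈ Finset.range N, z ^ n • b' n :=
          tsum_eq_sum fun n hn => by
            have h0 : b' n = 0 := if_neg hn
            rw [h0]
            exact smul_zero (A := Fin m → (V →L⋆[ℂ] ℂ)) (z ^ n)
        rw [ht, hP, map_sum]
        congr 1
        exact Finset.sum_congr rfl fun n hn => by simp only [b', if_pos hn, map_smul]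
      -- This is `‖P - G‖² ≥ 0`, summed over the components.
      have h2 : 2 * (pairing P (J G)).re - (pairing P (J P)).re ≤ ∑ i, ‖G i‖ ^ 2 := by
        simp only [pairing, hJ, Complex.re_sum, rieszMap_apply]
        rw [Finset.mul_sum, ← Finset.sum_sub_distrib]
        refine Finset.sum_le_sum fun i _ => ?_
        have h3 := norm_sub_sq (𝕜 := ℂ) (P i) (G i)
        have h4 : (inner ℂ (P i) (P i)).re = ‖P i‖ ^ 2 := by
          have := inner_self_eq_norm_sq (𝕜 := ℂ) (P i)
          simpa using this
        simp only [RCLike.re_eq_complex_re] at h3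
        nlinarith [sq_nonneg ‖P i - G i‖]
      have h5 := mul_le_mul_of_nonneg_left h2 hα
      simp only [Complex.sub_re, Complex.real_smul, Complex.re_ofReal_mul, hB, hB']
      linarith)
  have havg : circleAverage (fun z => A z - ((2 * α : ℝ) • B z - α • B' z)) 0 1 =
      ∑ n ∈ Finset.range N, pairing (u n) (h n) -
        ((2 * α : ℝ) • ∑ n ∈ Finset.range N, pairing (g n) (b n) -
          α • ∑ n ∈ Finset.range N, pairing (g n) (b n)) := by
    have i1 : CircleIntegrable A 0 1 := c1.intervalIntegrable _ _
    have i2 : CircleIntegrable (fun z => (2 * α : ℝ) • B z) 0 1 :=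
      c2'.intervalIntegrable _ _
    have i3 : CircleIntegrable (fun z => α • B' z) 0 1 := c3'.intervalIntegrable _ _
    have i4 : CircleIntegrable (fun z => (2 * α : ℝ) • B z - α • B' z) 0 1 :=
      c23.intervalIntegrable _ _
    rw [circleAverage_fun_sub i1 i4, circleAverage_fun_sub i2 i3,
      circleAverage_fun_smul, circleAverage_fun_smul, a1, a2, a3, e3]
  rw [havg] at hpos
  have e4 : (∑ n ∈ Finset.range N, pairing (g n) (b n)) =
      ((∑ n ∈ Finset.range N, ∑ i, ‖g n i‖ ^ 2 : ℝ) : ℂ) := by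
    rw [Complex.ofReal_sum]
    exact Finset.sum_congr rfl fun n _ => pairing_rieszMap_self (g n)
  rw [e4] at hpos
  simp only [Complex.sub_re, Complex.real_smul, Complex.re_ofReal_mul, Complex.ofReal_re,
    Complex.re_sum] at hpos
  linarith

end Pairing

/-! ### Power series of causal convolutions -/

section CausalConvolution

theorem hasSum_causal_convolution {E : Type*} [NormedAddCommGroup E] [NormedSpace ℂ E]
    (N : ℕ) {w : ℕ → ℕ → E} {z : ℂ} {s : ℕ → E}
    (hw : ∀ k < N, HasSum (fun n => z ^ n • w k n) (s k)) :
    HasSum (fun n => z ^ n • ∑ k ∈ Finset.range N, if k ≤ n then w k (n - k) else 0)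
      (∑ k ∈ Finset.range N, z ^ k • s k) := by
  simp_rw [Finset.smul_sum]
  refine hasSum_sum fun k hk => ?_
  have h1 := (hw k (Finset.mem_range.1 hk)).const_smul (z ^ k)
  rw [← hasSum_nat_add_iff' k]
  have h2 : ∑ i ∈ Finset.range k, z ^ i • (if k ≤ i then w k (i - k) else 0) = 0 :=
    Finset.sum_eq_zero fun i hi => by
      rw [if_neg (by have := Finset.mem_range.1 hi; omega), smul_zero]
  rw [h2, sub_zero]
  convert h1 using 2 with n
  rw [if_pos (by omega), Nat.add_sub_cancel, smul_smul, pow_add, mul_comm]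

theorem summable_norm_causal_convolution {E : Type*} [NormedAddCommGroup E]
    (N : ℕ) {w : ℕ → ℕ → E} (hw : ∀ k < N, Summable fun n => ‖w k n‖) :
    Summable fun n => ‖∑ k ∈ Finset.range N, if k ≤ n then w k (n - k) else 0‖ := by
  refine Summable.of_nonneg_of_le (fun _ => norm_nonneg _) (fun n => norm_sum_le _ _) ?_
  refine summable_sum fun k hk => ?_
  rw [← summable_nat_add_iff k]
  refine (hw k (Finset.mem_range.1 hk)).congr fun n => ?_
  rw [if_pos (by omega), Nat.add_sub_cancel]

end CausalConvolution

/-! ### Locally uniform geometric bounds for powers -/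

section PowerBounds

open Filter

open scoped Matrix.Norms.L2Operator

theorem Matrix.norm_entry_le_l2_opNorm {m : ℕ} (M : Matrix (Fin m) (Fin m) ℂ) (i j : Fin m) :
    ‖M i j‖ ≤ ‖M‖ := by
  have h := Matrix.l2_opNorm_mulVec M (EuclideanSpace.single j 1)
  have h2 := PiLp.norm_apply_le ((EuclideanSpace.equiv (Fin m) ℂ).symm
    (M.mulVec (EuclideanSpace.single j (1 : ℂ)).ofLp)) i
  refine le_trans (le_of_eq ?_) (h2.trans (h.trans (by simp)))
  simp [Matrix.mulVec_single]

/-- If `‖a ^ k‖ < r ^ k` for some `k ≥ 1`, then the powers of all elements near `a` are bounded by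
a common geometric sequence with ratio less than `r`. -/
theorem eventually_norm_pow_le_of_norm_pow_lt {A : Type*} [NormedRing A] {a : A} {r : ℝ}
    (hr : 0 < r) {k : ℕ} (hk : k ≠ 0) (ha : ‖a ^ k‖ < r ^ k) :
    ∃ q C : ℝ, 0 < q ∧ q < r ∧ ∀ᶠ b in 𝓝 a, ∀ n, ‖b ^ n‖ ≤ C * q ^ n := by
  have hcont : ContinuousAt (fun q : ℝ => q ^ k) r := by fun_prop
  have h1 : ∀ᶠ q : ℝ in 𝓝[<] r, ‖a ^ k‖ < q ^ k :=
    (hcont.eventually (lt_mem_nhds ha)).filter_mono nhdsWithin_le_nhds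
  have h2 : ∀ᶠ q : ℝ in 𝓝[<] r, 0 < q :=
    (eventually_gt_nhds hr).filter_mono nhdsWithin_le_nhds
  obtain ⟨q, ⟨hq1, hq2⟩, hq3⟩ := ((h1.and h2).and self_mem_nhdsWithin).exists
  set B : ℝ := ‖a‖ + 1 with hB
  have hBpos : 0 < B := by positivity
  -- Divide `n = k d + e` with `e < k`: the block `b^(k d)` contributes `q^(k d)`, and the remainder
  -- is absorbed in the constant. The factor `1 + ‖1‖` covers the exponent `0`, since `‖1‖ ≤ 1` is
  -- not assumed.
  refine ⟨q, (1 + ‖(1 : A)‖) * (1 + B / q) ^ k, hq2, hq3, ?_⟩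
  have e1 : ∀ᶠ b in 𝓝 a, ‖b ^ k‖ < q ^ k :=
    (show ContinuousAt (fun b : A => ‖b ^ k‖) a by fun_prop).eventually (gt_mem_nhds hq1)
  have e2 : ∀ᶠ b in 𝓝 a, ‖b‖ < B :=
    (show ContinuousAt (fun b : A => ‖b‖) a by fun_prop).eventually (gt_mem_nhds (by simp [hB]))
  filter_upwards [e1, e2] with b hb1 hb2 n
  have hpow : ∀ (c : A) (n : ℕ), ‖c ^ n‖ ≤ (1 + ‖(1 : A)‖) * ‖c‖ ^ n := by
    intro c n
    rcases Nat.eq_zero_or_pos n with rfl | hn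
    · simp
    · calc ‖c ^ n‖ ≤ ‖c‖ ^ n := norm_pow_le' c hn
        _ ≤ (1 + ‖(1 : A)‖) * ‖c‖ ^ n :=
          le_mul_of_one_le_left (by positivity) (by linarith [norm_nonneg (1 : A)])
  have hdiv := Nat.div_add_mod n k
  have hmod : n % k < k := Nat.mod_lt _ (Nat.pos_of_ne_zero hk)
  set d := n / k
  set e := n % k
  have h3 : ‖b ^ e‖ ≤ (1 + ‖(1 : A)‖) * ‖b‖ ^ e := hpow b e
  have h4 : ‖b ^ (k * d)‖ * ‖b ^ e‖ ≤ (q ^ k) ^ d * ((1 + ‖(1 : A)‖) * ‖b‖ ^ e) ∨ d = 0 := by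
    rcases Nat.eq_zero_or_pos d with hd | hd
    · exact Or.inr hd
    · left
      gcongr
      rw [pow_mul]
      exact (norm_pow_le' _ hd).trans (pow_le_pow_left₀ (norm_nonneg _) hb1.le d)
  have h5 : ‖b ^ n‖ ≤ (q ^ k) ^ d * ((1 + ‖(1 : A)‖) * ‖b‖ ^ e) := by
    rcases h4 with h4 | h4
    · rw [← hdiv, pow_add]
      exact (norm_mul_le _ _).trans h4
    · rw [h4] at hdiv ⊢
      rw [← hdiv]
      simpa using h3
  have h6 : ‖b‖ ^ e ≤ (1 + B / q) ^ k * q ^ e := by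
    calc ‖b‖ ^ e ≤ B ^ e := pow_le_pow_left₀ (norm_nonneg _) hb2.le e
      _ = (B / q) ^ e * q ^ e := by rw [← mul_pow, div_mul_cancel₀ _ hq2.ne']
      _ ≤ (1 + B / q) ^ e * q ^ e := by
        gcongr
        linarith
      _ ≤ (1 + B / q) ^ k * q ^ e := by
        gcongr
        have : 0 < B / q := by positivity
        linarith
  calc ‖b ^ n‖ ≤ (q ^ k) ^ d * ((1 + ‖(1 : A)‖) * ‖b‖ ^ e) := h5
    _ ≤ (q ^ k) ^ d * ((1 + ‖(1 : A)‖) * ((1 + B / q) ^ k * q ^ e)) := by gcongr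
    _ = (1 + ‖(1 : A)‖) * (1 + B / q) ^ k * (q ^ (k * d + e)) := by
      rw [pow_add, pow_mul]
      ring
    _ = _ := by rw [hdiv]

/-- Gelfand's formula for the spectral radius. -/
theorem exists_norm_pow_lt_of_spectrum_subset_ball {A : Type*} [NormedRing A] [NormedAlgebra ℂ A]
    [CompleteSpace A] {a : A} {r : ℝ} (hr : 0 < r) (ha : spectrum ℂ a ⊆ Metric.ball 0 r) :
    ∃ k ≠ 0, ‖a ^ k‖ < r ^ k := by
  rcases subsingleton_or_nontrivial A with hA | hA
  · refine ⟨1, one_ne_zero, ?_⟩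
    rw [Subsingleton.elim (a ^ 1) 0, norm_zero]
    positivity
  · have h1 : spectralRadius ℂ a < (r.toNNReal : ENNReal) := by
      refine spectrum.spectralRadius_lt_of_forall_lt a fun k hk => ?_
      have h2 := ha hk
      rw [mem_ball_zero_iff] at h2
      rw [← NNReal.coe_lt_coe, coe_nnnorm, Real.coe_toNNReal _ hr.le]
      exact h2
    have h2 := (spectrum.pow_norm_pow_one_div_tendsto_nhds_spectralRadius a).eventually
      (gt_mem_nhds h1)
    obtain ⟨k, hk1, hk2⟩ := (h2.and (eventually_ne_atTop 0)).exists
    refine ⟨k, hk2, ?_⟩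
    change ENNReal.ofReal _ < ENNReal.ofReal _ at hk1
    rw [ENNReal.ofReal_lt_ofReal_iff hr] at hk1
    have h3 := pow_lt_pow_left₀ hk1 (by positivity) hk2
    rwa [one_div, Real.rpow_inv_natCast_pow (norm_nonneg _) hk2] at h3

/-- The common bound for all nearby `b` is what makes power series in a matrix converge locally
uniformly in that matrix. -/
theorem exists_eventually_norm_pow_le {A : Type*} [NormedRing A] [NormedAlgebra ℂ A]
    [CompleteSpace A] {a : A} {r : ℝ} (hr : 0 < r) (ha : spectrum ℂ a ⊆ Metric.ball 0 r) :
    ∃ q C : ℝ, 0 < q ∧ q < r ∧ ∀ᶠ b in 𝓝 a, ∀ n, ‖b ^ n‖ ≤ C * q ^ n := by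
  obtain ⟨k, hk, h⟩ := exists_norm_pow_lt_of_spectrum_subset_ball hr ha
  exact eventually_norm_pow_le_of_norm_pow_lt hr hk h

/-- If `l` is in the spectrum, so is `l ^ n` for `a ^ n`, and exponential growth of `‖l‖ ^ n / q ^
n` is excluded. Hence a circle enclosing the spectrum of one matrix also encloses that of its
neighbours. -/
theorem spectrum_subset_ball_of_norm_pow_le {A : Type*} [NormedRing A] [NormedAlgebra ℂ A]
    [CompleteSpace A] {a : A} {q r C : ℝ} (hq : 0 < q) (hqr : q < r)
    (h : ∀ n, ‖a ^ n‖ ≤ C * q ^ n) : spectrum ℂ a ⊆ Metric.ball 0 r := by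
  intro l hl
  rw [mem_ball_zero_iff]
  refine lt_of_le_of_lt ?_ hqr
  by_contra! hlt
  have h1 : ∀ n, (‖l‖ / q) ^ n ≤ C * ‖(1 : A)‖ := by
    intro n
    have h2 : l ^ n ∈ spectrum ℂ (a ^ n) := spectrum.pow_mem_pow a n hl
    have h3 := spectrum.norm_le_norm_mul_of_mem h2
    rw [norm_pow] at h3
    rw [div_pow, div_le_iff₀ (by positivity)]
    calc ‖l‖ ^ n ≤ ‖a ^ n‖ * ‖(1 : A)‖ := h3
      _ ≤ C * q ^ n * ‖(1 : A)‖ := by gcongr; exact h n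
      _ = _ := by ring
  obtain ⟨n, hn⟩ := pow_unbounded_of_one_lt (C * ‖(1 : A)‖) ((one_lt_div hq).2 hlt)
  exact absurd (h1 n) (not_le.2 hn)

end PowerBounds

/-! ### The matrix Cauchy integral: power series, independence of the circle, analyticity -/

section CauchyIntegrals

open Filter Metric

open scoped Matrix.Norms.L2Operator Real

variable {m : ℕ} {E : Type*} [NormedAddCommGroup E] [NormedSpace ℂ E]

/-- The Cauchy integral of `P (s - S)⁻¹ ⊗ K(s)`. -/
noncomputable def cauchyMatrixIntegralMul (K : ℂ → E) (z : ℂ) (r : ℝ)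
    (P S : Matrix (Fin m) (Fin m) ℂ) (i j : Fin m) : E :=
  (2 * Real.pi * Complex.I : ℂ)⁻¹ •
    ∮ s in C(z, r), ((P * (s • (1 : Matrix (Fin m) (Fin m) ℂ) - S)⁻¹) i j) • K s

theorem spectrum_sub_smul_one_subset_ball {S : Matrix (Fin m) (Fin m) ℂ} {z : ℂ} {r : ℝ} :
    spectrum ℂ (S - z • 1) ⊆ ball 0 r ↔ spectrum ℂ S ⊆ ball z r := by
  have h := spectrum.sub_singleton_eq S z
  rw [Algebra.algebraMap_eq_smul_one] at h
  rw [← h]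
  constructor
  · intro hs l hl
    have := hs (Set.sub_mem_sub hl (Set.mem_singleton z))
    rwa [mem_ball_zero_iff, ← mem_ball_iff_norm] at this
  · intro hs l hl
    obtain ⟨a, ha, b, hb, rfl⟩ := Set.mem_sub.1 hl
    rw [Set.mem_singleton_iff.1 hb, mem_ball_zero_iff, ← mem_ball_iff_norm]
    exact hs ha

/-- Neumann series about the centre `z`. Bounding the powers instead of using `‖S - z‖ < ‖s - z‖`
makes it valid as soon as the spectrum lies in the disc. -/
theorem hasSum_resolvent {S : Matrix (Fin m) (Fin m) ℂ} {z s : ℂ} {q C : ℝ} (hq : 0 < q)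
    (hs : q < ‖s - z‖) (hC : ∀ n, ‖(S - z • 1) ^ n‖ ≤ C * q ^ n) :
    HasSum (fun n : ℕ => ((1 / (s - z)) ^ n * (s - z)⁻¹) • (S - z • 1) ^ n) ((s • 1 - S)⁻¹) := by
  have hsz : s - z ≠ 0 := norm_pos_iff.1 (hq.trans hs)
  have hsum : Summable fun n : ℕ => ((1 / (s - z)) • (S - z • 1)) ^ n := by
    refine Summable.of_norm_bounded (g := fun n => C * (q / ‖s - z‖) ^ n) ?_ fun n => ?_
    · exact (summable_geometric_of_lt_one (by positivity) ((div_lt_one (hq.trans hs)).2 hs)).mul_left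
        _
    · rw [smul_pow, norm_smul, norm_pow, norm_div, norm_one, div_pow, div_pow, one_pow]
      calc 1 / ‖s - z‖ ^ n * ‖(S - z • 1) ^ n‖ ≤ 1 / ‖s - z‖ ^ n * (C * q ^ n) := by
            gcongr
            exact hC n
        _ = _ := by ring
  have h1 := hsum.one_sub_mul_tsum_pow
  have h2 : (s • 1 - S)⁻¹ = (s - z)⁻¹ • ∑' n : ℕ, ((1 / (s - z)) • (S - z • 1)) ^ n := by
    refine Matrix.inv_eq_right_inv ?_
    have h3 : (s - z)⁻¹ * s = 1 + (s - z)⁻¹ * z := by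
      field_simp
      ring
    have h4 : (s - z)⁻¹ • (s • 1 - S) = 1 - (1 / (s - z)) • (S - z • 1) := by
      rw [smul_sub, smul_smul, smul_sub, smul_smul, one_div, h3, add_smul, one_smul]
      abel
    rw [Matrix.mul_smul, ← Matrix.smul_mul, h4]
    exact h1
  rw [h2]
  convert hsum.hasSum.const_smul ((s - z)⁻¹) using 2 with n
  rw [smul_pow, smul_smul, mul_comm]

/-- The Neumann series is integrated term by term over the circle, with dominating terms
proportional to `(q / r) ^ n`; each integral is a Taylor coefficient of `K`. -/
theorem hasSum_cauchyMatrixIntegralMul [CompleteSpace E] {K : ℂ → E} {z : ℂ} {r : ℝ} (hr : 0 < r)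
    (hK : ContinuousOn K (sphere z r)) (P : Matrix (Fin m) (Fin m) ℂ)
    {S : Matrix (Fin m) (Fin m) ℂ} (hS : spectrum ℂ S ⊆ ball z r) (i j : Fin m) :
    HasSum (fun n : ℕ => ((P * (S - z • 1) ^ n) i j) • (cauchyPowerSeries K z r).coeff n)
      (cauchyMatrixIntegralMul K z r P S i j) := by
  obtain ⟨q, C, hq, hqr, hev⟩ := exists_eventually_norm_pow_le hr
    (spectrum_sub_smul_one_subset_ball.2 hS)
  have hC := hev.self_of_nhds
  have hcoeff : ∀ n, (cauchyPowerSeries K z r).coeff n =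
      (2 * π * Complex.I : ℂ)⁻¹ • ∮ s in C(z, r), (1 / (s - z)) ^ n • (s - z)⁻¹ • K s := fun n =>
    cauchyPowerSeries_apply K z r n 1
  have hKint : Continuous fun θ : ℝ => K (circleMap z r θ) :=
    hK.comp_continuous (continuous_circleMap z r) fun θ => circleMap_mem_sphere z hr.le θ
  have hnz : ∀ θ : ℝ, circleMap z r θ - z ≠ 0 := fun θ =>
    sub_ne_zero.2 (circleMap_ne_center hr.ne')
  have hnorm : ∀ θ : ℝ, ‖circleMap z r θ - z‖ = r := fun θ => by
    simp [circleMap_sub_center, abs_of_pos hr]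
  have hmain : HasSum (fun n : ℕ => ∮ s in C(z, r),
      ((P * (((1 / (s - z)) ^ n * (s - z)⁻¹) • (S - z • 1) ^ n)) i j) • K s)
      (∮ s in C(z, r), ((P * (s • (1 : Matrix (Fin m) (Fin m) ℂ) - S)⁻¹) i j) • K s) := by
    refine intervalIntegral.hasSum_integral_of_dominated_convergence
      (fun n θ => ‖P‖ * C * (q / r) ^ n * ‖K (circleMap z r θ)‖) (fun n => ?_) (fun n => ?_) ?_ ?_ ?_
    · refine Continuous.aestronglyMeasurable ?_
      simp only [deriv_circleMap, Matrix.mul_smul, Matrix.smul_apply]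
      have h1 : Continuous fun θ : ℝ => (circleMap z r θ - z)⁻¹ :=
        Continuous.inv₀ (by fun_prop) hnz
      simp only [one_div]
      exact Continuous.smul (by fun_prop)
        ((((h1.pow n).mul h1).smul continuous_const).smul hKint)
    · refine Eventually.of_forall fun θ _ => ?_
      rw [norm_smul, norm_smul, deriv_circleMap, Matrix.mul_smul, Matrix.smul_apply, norm_smul,
        norm_mul, norm_mul, norm_pow, norm_inv, norm_div, hnorm]
      have h1 : ‖(P * (S - z • 1) ^ n) i j‖ ≤ ‖P‖ * (C * q ^ n) :=
        (Matrix.norm_entry_le_l2_opNorm _ i j).trans ((norm_mul_le _ _).trans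
          (mul_le_mul_of_nonneg_left (hC n) (norm_nonneg _)))
      have h2 : ‖circleMap 0 r θ‖ = r := by simp [abs_of_pos hr]
      rw [h2, Complex.norm_I, norm_one]
      calc r * 1 * ((1 / r) ^ n * r⁻¹ * ‖(P * (S - z • 1) ^ n) i j‖ * ‖K (circleMap z r θ)‖)
          ≤ r * 1 * ((1 / r) ^ n * r⁻¹ * (‖P‖ * (C * q ^ n)) * ‖K (circleMap z r θ)‖) := by gcongr
        _ = _ := by
          rw [div_pow, div_pow, one_pow]
          field_simp
    · refine Eventually.of_forall fun θ _ => ?_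
      exact ((summable_geometric_of_lt_one (by positivity) ((div_lt_one hr).2 hqr)).mul_left
        _).mul_right _
    · simp_rw [mul_assoc, tsum_mul_left, tsum_mul_right]
      exact (continuous_const.mul (continuous_const.mul
        (continuous_const.mul hKint.norm))).intervalIntegrable _ _
    · refine Eventually.of_forall fun θ _ => ?_
      refine HasSum.const_smul _ (HasSum.smul_const ?_ _)
      have h1 := (hasSum_resolvent (s := circleMap z r θ) hq (by rw [hnorm]; exact hqr) hC).mul_left P
      exact (Pi.hasSum.1 (Pi.hasSum.1 h1 i)) j
  unfold cauchyMatrixIntegralMul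
  convert hmain.const_smul ((2 * π * Complex.I : ℂ)⁻¹) using 2 with n
  rw [hcoeff, smul_comm, ← circleIntegral.integral_smul]
  congr 2
  ext s
  rw [Matrix.mul_smul, Matrix.smul_apply, smul_smul, smul_smul, smul_eq_mul]
  congr 1
  ring

theorem cauchyMatrixIntegralMul_one (K : ℂ → E) (z : ℂ) (r : ℝ) (S : Matrix (Fin m) (Fin m) ℂ)
    (i j : Fin m) : cauchyMatrixIntegralMul K z r 1 S i j = cauchyMatrixIntegral K z r S i j := by
  simp [cauchyMatrixIntegralMul, cauchyMatrixIntegral]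

theorem cauchyMatrixIntegralMul_const [CompleteSpace E] (e : E) {z : ℂ} {r : ℝ} (hr : 0 < r)
    (P : Matrix (Fin m) (Fin m) ℂ) {S : Matrix (Fin m) (Fin m) ℂ}
    (hS : spectrum ℂ S ⊆ ball z r) (i j : Fin m) :
    cauchyMatrixIntegralMul (fun _ => e) z r P S i j = P i j • e := by
  have h := hasSum_cauchyMatrixIntegralMul (K := fun _ => e) hr continuousOn_const P hS i j
  have hc : ∀ n, (cauchyPowerSeries (fun _ => e) z r).coeff n = if n = 0 then e else 0 := by
    intro n
    have h1 : (cauchyPowerSeries (fun _ => e) z r).coeff n = (2 * π * Complex.I : ℂ)⁻¹ •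
        ∮ s in C(z, r), (1 / (s - z)) ^ n • (s - z)⁻¹ • e := cauchyPowerSeries_apply _ z r n 1
    have h2 : ∀ s, (1 / (s - z)) ^ n • (s - z)⁻¹ • e = (s - z) ^ (-(n : ℤ) - 1) • e := by
      intro s
      rcases eq_or_ne (s - z) 0 with h0 | h0
      · have : (-(n : ℤ) - 1) ≠ 0 := by omega
        simp [h0, zero_zpow _ this]
      · rw [smul_smul, zpow_sub₀ h0, zpow_neg, zpow_natCast, zpow_one, one_div, inv_pow,
          div_eq_mul_inv]
    simp_rw [h2] at h1
    rw [h1, circleIntegral.integral_smul_const, smul_smul]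
    split_ifs with hn
    · subst hn
      have h3 := circleIntegral.integral_sub_center_inv z hr.ne'
      simp only [Nat.cast_zero, neg_zero, zero_sub, zpow_neg, zpow_one]
      rw [h3, inv_mul_cancel₀ Complex.two_pi_I_ne_zero, one_smul]
    · rw [circleIntegral.integral_sub_zpow_of_ne (by omega), mul_zero, zero_smul]
  simp_rw [hc] at h
  have h3 := hasSum_single (f := fun n => (P * (S - z • 1) ^ n) i j • if n = 0 then e else 0) 0
    (fun n hn => by simp [hn])
  simpa using h.unique h3

theorem isUnit_smul_one_sub {S : Matrix (Fin m) (Fin m) ℂ} {s : ℂ} (hs : s ∉ spectrum ℂ S) :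
    IsUnit (s • (1 : Matrix (Fin m) (Fin m) ℂ) - S) := by
  rw [spectrum.notMem_iff, Algebra.algebraMap_eq_smul_one] at hs
  exact hs

theorem continuousOn_resolvent_sphere {z : ℂ} {r : ℝ} (P : Matrix (Fin m) (Fin m) ℂ)
    {S : Matrix (Fin m) (Fin m) ℂ} (hS : spectrum ℂ S ⊆ ball z r) (i j : Fin m) :
    ContinuousOn (fun s : ℂ => (P * (s • (1 : Matrix (Fin m) (Fin m) ℂ) - S)⁻¹) i j)
      (sphere z r) := by
  intro s hs
  have hu : IsUnit (s • (1 : Matrix (Fin m) (Fin m) ℂ) - S) :=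
    isUnit_smul_one_sub fun h => by
      have h1 := hS h
      rw [mem_ball] at h1
      rw [mem_sphere] at hs
      exact absurd hs h1.ne
  have h1 : ContinuousAt (fun s : ℂ => Ring.inverse (s • (1 : Matrix (Fin m) (Fin m) ℂ) - S)) s := by
    obtain ⟨u, hu⟩ := hu
    refine ContinuousAt.comp (g := Ring.inverse) ?_ (by fun_prop)
    rw [← hu]
    exact NormedRing.inverse_continuousAt u
  simp_rw [← Matrix.nonsing_inv_eq_ringInverse] at h1
  have h2 : ContinuousAt (fun s : ℂ => P * (s • (1 : Matrix (Fin m) (Fin m) ℂ) - S)⁻¹) s :=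
    continuousAt_const.mul h1
  exact ((continuous_apply_apply i j).continuousAt.comp h2).continuousWithinAt

/-- Combine `K(s) = K(l) + (s - l) K[l, s]`, where `K[l, s]` is the difference quotient, with `(s -
l)(s - S)⁻¹ = 1 + (S - l)(s - S)⁻¹`. The term without resolvent integrates to zero by Cauchy's
theorem, and the term with the constant `K(l)` gives `P`. -/
theorem cauchyMatrixIntegralMul_eq_add [CompleteSpace E] {K : ℂ → E} {U : Set ℂ} (hU : IsOpen U)
    (hK : DifferentiableOn ℂ K U) {z : ℂ} {r : ℝ} (hr : 0 < r) (hz : closedBall z r ⊆ U)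
    (P : Matrix (Fin m) (Fin m) ℂ) {S : Matrix (Fin m) (Fin m) ℂ}
    (hS : spectrum ℂ S ⊆ ball z r) {l : ℂ} (hl : l ∈ spectrum ℂ S) (i j : Fin m) :
    cauchyMatrixIntegralMul K z r P S i j = P i j • K l +
      cauchyMatrixIntegralMul (dslope K l) z r (P * (S - l • 1)) S i j := by
  have hlU : U ∈ 𝓝 l := hU.mem_nhds (hz (ball_subset_closedBall (hS hl)))
  have hK1 : DifferentiableOn ℂ (dslope K l) U := (Complex.differentiableOn_dslope hlU).2 hK
  have hc1 : ContinuousOn (dslope K l) (sphere z r) :=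
    hK1.continuousOn.mono (sphere_subset_closedBall.trans hz)
  have e1 : (∮ s in C(z, r), ((P * (s • (1 : Matrix (Fin m) (Fin m) ℂ) - S)⁻¹) i j) • K s) =
      ∮ s in C(z, r), (((P * (s • (1 : Matrix (Fin m) (Fin m) ℂ) - S)⁻¹) i j) • K l +
        (P i j • dslope K l s +
        ((P * (S - l • 1) * (s • (1 : Matrix (Fin m) (Fin m) ℂ) - S)⁻¹) i j) • dslope K l s)) := by
    refine circleIntegral.integral_congr hr.le fun s hs => ?_
    have hu : IsUnit (s • (1 : Matrix (Fin m) (Fin m) ℂ) - S) :=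
      isUnit_smul_one_sub fun h => by
        have h1 := hS h
        rw [mem_ball] at h1
        rw [mem_sphere] at hs
        exact absurd hs h1.ne
    have hu' := (Matrix.isUnit_iff_isUnit_det _).1 hu
    have h1 : K s = K l + (s - l) • dslope K l s := by
      rw [sub_smul_dslope]
      abel
    have h2 : (s - l) • (P * (s • (1 : Matrix (Fin m) (Fin m) ℂ) - S)⁻¹) =
        P + P * (S - l • 1) * (s • (1 : Matrix (Fin m) (Fin m) ℂ) - S)⁻¹ := by
      have h3 : (s - l) • (1 : Matrix (Fin m) (Fin m) ℂ) = (s • 1 - S) + (S - l • 1) := by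
        rw [sub_smul]
        abel
      calc (s - l) • (P * (s • (1 : Matrix (Fin m) (Fin m) ℂ) - S)⁻¹)
          = P * ((s - l) • (1 : Matrix (Fin m) (Fin m) ℂ)) *
            (s • (1 : Matrix (Fin m) (Fin m) ℂ) - S)⁻¹ := by simp
        _ = P * ((s • 1 - S) * (s • (1 : Matrix (Fin m) (Fin m) ℂ) - S)⁻¹) +
            P * (S - l • 1) * (s • (1 : Matrix (Fin m) (Fin m) ℂ) - S)⁻¹ := by
            rw [h3, mul_add, add_mul, mul_assoc]
        _ = _ := by rw [Matrix.mul_nonsing_inv _ hu', mul_one]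
    have h3 : (s - l) * (P * (s • (1 : Matrix (Fin m) (Fin m) ℂ) - S)⁻¹) i j =
        P i j + (P * (S - l • 1) * (s • (1 : Matrix (Fin m) (Fin m) ℂ) - S)⁻¹) i j := by
      simpa using congrFun (congrFun h2 i) j
    rw [← add_smul, ← h3, h1, smul_add, smul_smul, mul_comm (s - l)]
  have i1 : CircleIntegrable
      (fun s => ((P * (s • (1 : Matrix (Fin m) (Fin m) ℂ) - S)⁻¹) i j) • K l) z r :=
    ((continuousOn_resolvent_sphere P hS i j).smul continuousOn_const).circleIntegrable hr.le
  have i2 : CircleIntegrable (fun s => P i j • dslope K l s) z r :=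
    (hc1.const_smul (P i j)).circleIntegrable hr.le
  have i3 : CircleIntegrable (fun s => ((P * (S - l • 1) *
      (s • (1 : Matrix (Fin m) (Fin m) ℂ) - S)⁻¹) i j) • dslope K l s) z r :=
    ((continuousOn_resolvent_sphere _ hS i j).smul hc1).circleIntegrable hr.le
  have i23 : CircleIntegrable (fun s => P i j • dslope K l s + ((P * (S - l • 1) *
      (s • (1 : Matrix (Fin m) (Fin m) ℂ) - S)⁻¹) i j) • dslope K l s) z r := i2.add i3
  have i4 : (∮ s in C(z, r), P i j • dslope K l s) = 0 := by
    rw [circleIntegral.integral_smul]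
    have : (∮ s in C(z, r), dslope K l s) = 0 :=
      Complex.circleIntegral_eq_zero_of_differentiable_on_off_countable hr.le Set.countable_empty
        (hK1.continuousOn.mono hz) fun s hs =>
          hK1.differentiableAt (hU.mem_nhds (hz (ball_subset_closedBall hs.1)))
    rw [this, smul_zero]
  have i5 := cauchyMatrixIntegralMul_const (K l) hr P hS i j
  rw [cauchyMatrixIntegralMul] at i5 ⊢
  rw [e1, circleIntegral.integral_add i1 i23, circleIntegral.integral_add i2 i3, i4,
    zero_add, smul_add, i5]
  rfl

/-- The Cauchy integral does not depend on the circle. -/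
theorem cauchyMatrixIntegralMul_congr [CompleteSpace E] {K : ℂ → E} {U : Set ℂ} (hU : IsOpen U)
    (hK : DifferentiableOn ℂ K U) {z z' : ℂ} {r r' : ℝ} (hr : 0 < r) (hr' : 0 < r')
    (hz : closedBall z r ⊆ U) (hz' : closedBall z' r' ⊆ U)
    (P : Matrix (Fin m) (Fin m) ℂ) {S : Matrix (Fin m) (Fin m) ℂ}
    (hS : spectrum ℂ S ⊆ ball z r) (hS' : spectrum ℂ S ⊆ ball z' r') (i j : Fin m) :
    cauchyMatrixIntegralMul K z r P S i j = cauchyMatrixIntegralMul K z' r' P S i j := by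
  -- Induction over eigenvalues with `P` and `K` both free: each step moves a factor `S - l` into
  -- `P`, replaces `K` by a difference quotient, and splits off a term that does not involve the
  -- circle.
  have key : ∀ (ls : List ℂ), (∀ l ∈ ls, l ∈ spectrum ℂ S) →
      ∀ (P : Matrix (Fin m) (Fin m) ℂ) (K : ℂ → E), DifferentiableOn ℂ K U →
      P * (ls.map fun l => S - l • 1).prod = 0 →
      cauchyMatrixIntegralMul K z r P S i j = cauchyMatrixIntegralMul K z' r' P S i j := by
    intro ls
    induction ls with
    | nil =>
      intro _ P K _ hP
      simp only [List.map_nil, List.prod_nil, mul_one] at hP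
      simp [hP, cauchyMatrixIntegralMul, circleIntegral]
    | cons l ls ih =>
      intro hls P K hK hP
      have hl : l ∈ spectrum ℂ S := hls l (by simp)
      have hlU : U ∈ 𝓝 l := hU.mem_nhds (hz (ball_subset_closedBall (hS hl)))
      rw [cauchyMatrixIntegralMul_eq_add hU hK hr hz P hS hl,
        cauchyMatrixIntegralMul_eq_add hU hK hr' hz' P hS' hl]
      congr 1
      refine ih (fun l' h => hls l' (by simp [h])) _ _
        ((Complex.differentiableOn_dslope hlU).2 hK) ?_
      rw [List.map_cons, List.prod_cons] at hP
      rw [mul_assoc, hP]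
  -- By Cayley-Hamilton the product over all roots of the characteristic polynomial vanishes, so
  -- nothing is left at the end.
  refine key S.charpoly.roots.toList (fun l hl => ?_) P K hK ?_
  · rw [Multiset.mem_toList] at hl
    exact Matrix.mem_spectrum_of_isRoot_charpoly (Polynomial.isRoot_of_mem_roots hl)
  · have h1 := Matrix.aeval_self_charpoly S
    rw [(IsAlgClosed.splits S.charpoly).eq_prod_roots_of_monic (Matrix.charpoly_monic S)] at h1
    conv at h1 => enter [1, 2, 1, 2]; rw [← Multiset.coe_toList S.charpoly.roots]
    rw [Multiset.map_coe, Multiset.prod_coe, map_list_prod, List.map_map] at h1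
    have h2 : (⇑(Polynomial.aeval S) ∘ fun a => Polynomial.X - Polynomial.C a) =
        fun l : ℂ => S - l • 1 := by
      ext1 l
      simp [Algebra.algebraMap_eq_smul_one]
    rw [h2] at h1
    rw [h1, mul_zero]

/-- The power series representation of the matrix function. -/
theorem hasSum_matrixFunctionOpen [CompleteSpace E] {σ : ℝ} {K : ℂ → E}
    (hK : DifferentiableOn ℂ K {s | σ < s.re}) {S : Matrix (Fin m) (Fin m) ℂ} {z : ℂ} {r : ℝ}
    (hS : EnclosesSpectrum σ S (z, r)) (i j : Fin m) :
    HasSum (fun n : ℕ => (((S - z • 1) ^ n) i j) • (cauchyPowerSeries K z r).coeff n)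
      (matrixFunctionOpen σ K S i j) := by
  have hU : IsOpen {s : ℂ | σ < s.re} := isOpen_lt continuous_const Complex.continuous_re
  have hex : ∃ p : ℂ × ℝ, EnclosesSpectrum σ S p := ⟨_, hS⟩
  obtain ⟨hr, hz, hs⟩ := hS
  obtain ⟨hr', hz', hs'⟩ := hex.choose_spec
  simp only at hr hz hs
  have h := hasSum_cauchyMatrixIntegralMul hr
    (hK.continuousOn.mono (sphere_subset_closedBall.trans hz)) 1 hs i j
  rw [matrixFunctionOpen, dif_pos hex, ← cauchyMatrixIntegralMul_one,
    cauchyMatrixIntegralMul_congr hU hK hr' hr hz' hz 1 hs' hs]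
  simpa using h

theorem norm_coeff_cauchyPowerSeries_le (K : ℂ → E) (z : ℂ) {r : ℝ} (hr : 0 < r) :
    ∃ M : ℝ, 0 ≤ M ∧ ∀ n, ‖(cauchyPowerSeries K z r).coeff n‖ ≤ M * (1 / r) ^ n := by
  refine ⟨(2 * π)⁻¹ * ∫ θ : ℝ in 0..2 * π, ‖K (circleMap z r θ)‖, ?_, fun n => ?_⟩
  · refine mul_nonneg (by positivity) ?_
    exact intervalIntegral.integral_nonneg (by positivity) fun _ _ => norm_nonneg _
  · rw [← FormalMultilinearSeries.norm_apply_eq_norm_coef]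
    refine (norm_cauchyPowerSeries_le K z r n).trans (le_of_eq ?_)
    rw [abs_of_pos hr, one_div r]

theorem hasSum_coeff_cauchyPowerSeries [CompleteSpace E] {K : ℂ → E} {z w : ℂ} {r : ℝ} (hr : 0 < r)
    (hK : DifferentiableOn ℂ K (closedBall z r)) (hw : ‖w‖ < r) :
    HasSum (fun n : ℕ => w ^ n • (cauchyPowerSeries K z r).coeff n) (K (z + w)) := by
  have h := DifferentiableOn.hasFPowerSeriesOnBall (R := r.toNNReal) (c := z) (f := K)
    (by rwa [Real.coe_toNNReal _ hr.le]) (by simpa using hr)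
  have h2 := h.hasSum (y := w) (by
    simp only [eball_coe, Real.coe_toNNReal _ hr.le]
    simpa using hw)
  simpa [Real.coe_toNNReal _ hr.le] using h2

/-- Discs with centre `σ + ρ` and radius slightly below `ρ` exhaust the half-plane as `ρ → ∞`. With
all points at distance at least `d` from the boundary line, radius `ρ - d/2` works once `ρ d`
exceeds the squared distances to `σ`. -/
theorem exists_enclosesSpectrum {σ : ℝ} (T : Set ℂ) (hT : T.Finite) (hσ : ∀ l ∈ T, σ < l.re) :
    ∃ p : ℂ × ℝ, 0 < p.2 ∧ closedBall p.1 p.2 ⊆ {s : ℂ | σ < s.re} ∧ T ⊆ ball p.1 p.2 := by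
  obtain ⟨d, hd, hd'⟩ : ∃ d : ℝ, 0 < d ∧ ∀ l ∈ T, σ + d ≤ l.re := by
    rcases T.eq_empty_or_nonempty with rfl | hne
    · exact ⟨1, one_pos, by simp⟩
    · obtain ⟨l, hl, hmin⟩ := Set.exists_min_image T Complex.re hT hne
      exact ⟨l.re - σ, sub_pos.2 (hσ l hl), fun l' hl' => by linarith [hmin l' hl']⟩
  obtain ⟨B, hB⟩ := hT.isBounded.exists_norm_le
  have hB0 : ∀ l ∈ T, ‖l - σ‖ ^ 2 ≤ (|B| + |σ|) ^ 2 := by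
    intro l hl
    have h1 : ‖l - σ‖ ≤ |B| + |σ| := by
      calc ‖l - σ‖ ≤ ‖l‖ + ‖(σ : ℂ)‖ := norm_sub_le _ _
        _ ≤ |B| + |σ| := add_le_add ((hB l hl).trans (le_abs_self B)) (by simp)
    exact pow_le_pow_left₀ (norm_nonneg _) h1 2
  set ρ : ℝ := ((|B| + |σ|) ^ 2 + 1) / d + d with hρ
  have hρd : d < ρ := by
    have : 0 < ((|B| + |σ|) ^ 2 + 1) / d := by positivity
    linarith
  have hρd2 : (|B| + |σ|) ^ 2 + 1 ≤ ρ * d := by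
    rw [hρ, add_mul, div_mul_cancel₀ _ hd.ne']
    nlinarith
  refine ⟨((σ + ρ : ℝ), ρ - d / 2), by simp only; linarith, ?_, ?_⟩
  · intro s hs
    simp only [mem_closedBall, dist_eq_norm] at hs
    have h1 := (Complex.abs_re_le_norm _).trans hs
    simp only [Complex.sub_re, Complex.ofReal_re] at h1
    have h2 := (abs_le.1 h1).1
    simp only [Set.mem_ofPred_eq]
    linarith
  · intro l hl
    simp only [mem_ball, dist_eq_norm]
    have h1 := hB0 l hl
    have h2 := hd' l hl
    refine lt_of_pow_lt_pow_left₀ 2 (by linarith) ?_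
    rw [← Complex.normSq_eq_norm_sq, Complex.normSq_apply] at h1 ⊢
    simp only [Complex.sub_re, Complex.sub_im, Complex.ofReal_re, Complex.ofReal_im] at h1 ⊢
    nlinarith

/-- A matrix function of an analytic family of matrices is analytic. -/
theorem differentiableAt_matrixFunctionOpen [CompleteSpace E] {σ : ℝ} {K : ℂ → E}
    (hK : DifferentiableOn ℂ K {s | σ < s.re}) {S : ℂ → Matrix (Fin m) (Fin m) ℂ} {U : Set ℂ}
    (hU : IsOpen U) (hS : DifferentiableOn ℂ S U) {ζ : ℂ} (hζ : ζ ∈ U)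
    (hsp : ∀ l ∈ spectrum ℂ (S ζ), σ < l.re) (i j : Fin m) :
    DifferentiableAt ℂ (fun ζ => matrixFunctionOpen σ K (S ζ) i j) ζ := by
  obtain ⟨⟨z, r⟩, hr, hz, hb⟩ := exists_enclosesSpectrum _ (Matrix.finite_spectrum (S ζ)) hsp
  simp only at hr hz hb
  obtain ⟨q, C, hq, hqr, hev⟩ := exists_eventually_norm_pow_le hr
    (spectrum_sub_smul_one_subset_ball.2 hb)
  have hcont : ContinuousAt (fun ζ => S ζ - z • 1) ζ :=
    ((hS.differentiableAt (hU.mem_nhds hζ)).continuousAt).sub continuousAt_const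
  have hev2 := hcont.eventually hev
  obtain ⟨W, hW1, hW2, hW3⟩ := _root_.eventually_nhds_iff.1 (hev2.and (hU.mem_nhds hζ))
  obtain ⟨M, hM0, hM⟩ := norm_coeff_cauchyPowerSeries_le K z hr
  have heq : ∀ ξ ∈ W, matrixFunctionOpen σ K (S ξ) i j =
      ∑' n : ℕ, (((S ξ - z • 1) ^ n) i j) • (cauchyPowerSeries K z r).coeff n := by
    intro ξ hξ
    refine (hasSum_matrixFunctionOpen hK ⟨hr, hz, ?_⟩ i j).tsum_eq.symm
    exact spectrum_sub_smul_one_subset_ball.1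
      (spectrum_subset_ball_of_norm_pow_le hq hqr (hW1 ξ hξ).1)
  -- Weierstrass: near `ζ` the terms are analytic and dominated by a geometric series with ratio `q
  -- / r < 1`.
  have hdiff : DifferentiableOn ℂ (fun ξ => ∑' n : ℕ,
      (((S ξ - z • 1) ^ n) i j) • (cauchyPowerSeries K z r).coeff n) W := by
    refine Complex.differentiableOn_tsum_of_summable_norm (u := fun n => C * M * (q / r) ^ n)
      ((summable_geometric_of_lt_one (by positivity) ((div_lt_one hr).2 hqr)).mul_left _)
      (fun n => ?_) hW2 fun n ξ hξ => ?_
    · intro ξ hξ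
      have h1 : DifferentiableAt ℂ (fun ξ => (S ξ - z • 1) ^ n) ξ :=
        ((hS.differentiableAt (hU.mem_nhds (hW1 ξ hξ).2)).sub_const _).pow n
      have h2 : DifferentiableAt ℂ (fun ξ => ((S ξ - z • 1) ^ n) i j) ξ :=
        ((Matrix.entryLinearMap ℂ ℂ i j).toContinuousLinearMap.differentiableAt).comp ξ h1
      exact (h2.smul_const _).differentiableWithinAt
    · rw [norm_smul]
      have h1 := (Matrix.norm_entry_le_l2_opNorm ((S ξ - z • 1) ^ n) i j).trans ((hW1 ξ hξ).1 n)
      calc _ ≤ (C * q ^ n) * (M * (1 / r) ^ n) :=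
            mul_le_mul h1 (hM n) (norm_nonneg _) ((norm_nonneg _).trans h1)
        _ = _ := by
          rw [div_pow, div_pow, one_pow]
          ring
  exact (hdiff.differentiableAt (hW2.mem_nhds hW3)).congr_of_eventuallyEq
    (eventually_of_mem (hW2.mem_nhds hW3) heq)

end CauchyIntegrals

/-! ### Accretive matrices and their boundary eigenvectors -/

section Accretive

open Matrix

variable {m : ℕ} {H : Matrix (Fin m) (Fin m) ℂ}

theorem gramInner_add_right (u v w : Fin m → ℂ) :
    gramInner H u (v + w) = gramInner H u v + gramInner H u w := by
  simp [gramInner, mulVec_add]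

theorem gramInner_smul_right (c : ℂ) (u v : Fin m → ℂ) :
    gramInner H u (c • v) = c * gramInner H u v := by
  simp [gramInner, mulVec_smul]

theorem star_gramInner (hH : H.IsHermitian) (u v : Fin m → ℂ) :
    star (gramInner H u v) = gramInner H v u := by
  rw [gramInner, gramInner, star_dotProduct, star_mulVec, hH.eq, ← dotProduct_mulVec,
    star_star]

theorem gramInner_self_im (hH : H.IsHermitian) (u : Fin m → ℂ) : (gramInner H u u).im = 0 := by
  have := congrArg Complex.im (star_gramInner hH u u)
  simp only [RCLike.star_def, Complex.conj_im] at this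
  linarith

theorem gramInner_self_pos (hH : H.PosDef) {u : Fin m → ℂ} (hu : u ≠ 0) :
    0 < (gramInner H u u).re := by
  have := hH.dotProduct_mulVec_pos hu
  exact (Complex.lt_def.1 this).1

theorem gramInner_self_nonneg (hH : H.PosDef) (u : Fin m → ℂ) : 0 ≤ (gramInner H u u).re := by
  rcases eq_or_ne u 0 with rfl | hu
  · simp [gramInner]
  · exact (gramInner_self_pos hH hu).le

/-- `Re (w, S w) ≥ σ |w|²` for all `w`, in the inner product with Gram matrix `H`. -/
def IsAccretive (H : Matrix (Fin m) (Fin m) ℂ) (σ : ℝ) (S : Matrix (Fin m) (Fin m) ℂ) : Prop :=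
  ∀ w : Fin m → ℂ, σ * (gramInner H w w).re ≤ (gramInner H w (S *ᵥ w)).re

theorem IsAccretive.add_smul_one {σ : ℝ} {S : Matrix (Fin m) (Fin m) ℂ} (hS : IsAccretive H σ S)
    (ε : ℝ) : IsAccretive H (σ + ε) (S + (ε : ℂ) • 1) := by
  intro w
  rw [add_mulVec, smul_mulVec, one_mulVec, gramInner_add_right, gramInner_smul_right,
    Complex.add_re, Complex.re_ofReal_mul]
  linarith [hS w]

theorem exists_mulVec_eq_smul_of_mem_spectrum {S : Matrix (Fin m) (Fin m) ℂ} {l : ℂ}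
    (hl : l ∈ spectrum ℂ S) : ∃ w : Fin m → ℂ, w ≠ 0 ∧ S *ᵥ w = l • w := by
  rw [spectrum.mem_iff, Algebra.algebraMap_eq_smul_one, isUnit_iff_isUnit_det,
    isUnit_iff_ne_zero, not_not] at hl
  obtain ⟨w, hw, h⟩ := exists_mulVec_eq_zero_iff.2 hl
  refine ⟨w, hw, ?_⟩
  rw [sub_mulVec, smul_mulVec, one_mulVec, sub_eq_zero] at h
  exact h.symm

theorem IsAccretive.le_re_of_mulVec_eq {σ : ℝ} {S : Matrix (Fin m) (Fin m) ℂ} (hH : H.PosDef)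
    (hS : IsAccretive H σ S) {l : ℂ} {w : Fin m → ℂ} (hw : w ≠ 0) (h : S *ᵥ w = l • w) :
    σ ≤ l.re := by
  have h1 := hS w
  rw [h, gramInner_smul_right, Complex.mul_re, gramInner_self_im hH.isHermitian, mul_zero,
    sub_zero] at h1
  exact le_of_mul_le_mul_right h1 (gramInner_self_pos hH hw)

theorem IsAccretive.le_re_of_mem_spectrum {σ : ℝ} {S : Matrix (Fin m) (Fin m) ℂ} (hH : H.PosDef)
    (hS : IsAccretive H σ S) {l : ℂ} (hl : l ∈ spectrum ℂ S) : σ ≤ l.re := by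
  obtain ⟨w, hw, h⟩ := exists_mulVec_eq_smul_of_mem_spectrum hl
  exact hS.le_re_of_mulVec_eq hH hw h

theorem IsAccretive.lt_re_of_mem_spectrum_add {σ : ℝ} {S : Matrix (Fin m) (Fin m) ℂ}
    (hH : H.PosDef) (hS : IsAccretive H σ S) {ε : ℝ} (hε : 0 < ε) {l : ℂ}
    (hl : l ∈ spectrum ℂ (S + (ε : ℂ) • 1)) : σ < l.re := by
  have := (hS.add_smul_one ε).le_re_of_mem_spectrum hH hl
  linarith

theorem gramInner_mulVec_left (S : Matrix (Fin m) (Fin m) ℂ) (u v : Fin m → ℂ) :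
    gramInner H (S *ᵥ u) v = star u ⬝ᵥ ((Sᴴ * H) *ᵥ v) := by
  rw [gramInner, star_mulVec, ← dotProduct_mulVec, mulVec_mulVec]

/-- Accretivity says that the Hermitian part of `S - σ` is nonnegative. The matrix form gives access
to the fact that a semidefinite form vanishes only on its kernel. -/
theorem IsAccretive.posSemidef {σ : ℝ} {S : Matrix (Fin m) (Fin m) ℂ} (hH : H.IsHermitian)
    (hS : IsAccretive H σ S) : (H * S + Sᴴ * H - (2 * σ : ℂ) • H).PosSemidef := by
  refine PosSemidef.of_dotProduct_mulVec_nonneg ?_ fun w => ?_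
  · rw [IsHermitian, conjTranspose_sub, conjTranspose_add, conjTranspose_mul, conjTranspose_mul,
      conjTranspose_conjTranspose, conjTranspose_smul, hH.eq]
    simp only [star_mul', RCLike.star_def, Complex.conj_ofReal, map_ofNat]
    rw [add_comm]
  · have h1 : star w ⬝ᵥ (H * S + Sᴴ * H - (2 * σ : ℂ) • H) *ᵥ w =
        gramInner H w (S *ᵥ w) + star (gramInner H w (S *ᵥ w)) - 2 * σ * gramInner H w w := by
      rw [star_gramInner hH, gramInner_mulVec_left, sub_mulVec, add_mulVec, dotProduct_sub,
        dotProduct_add, smul_mulVec, dotProduct_smul, ← mulVec_mulVec, smul_eq_mul]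
      rfl
    rw [h1, Complex.le_def]
    have h2 := hS w
    have h3 := gramInner_self_im hH w
    constructor
    · simp [Complex.mul_re, Complex.mul_im, h3]
      linarith
    · simp [Complex.mul_re, Complex.mul_im, h3]

/-- Eigenvectors to eigenvalues on the boundary line are also left eigenvectors. -/
theorem IsAccretive.gramInner_mulVec_of_eigenvector {σ : ℝ} {S : Matrix (Fin m) (Fin m) ℂ}
    (hH : H.IsHermitian) (hS : IsAccretive H σ S) {l : ℂ} (hl : l.re = σ) {y : Fin m → ℂ}
    (hy : S *ᵥ y = l • y) (w : Fin m → ℂ) :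
    gramInner H y (S *ᵥ w) = l * gramInner H y w := by
  have hG := hS.posSemidef hH
  have hstar : (2 * σ : ℂ) - l = star l := by
    apply Complex.ext <;> simp [hl]
    ring
  have hexp : ∀ v, star v ⬝ᵥ (H * S + Sᴴ * H - (2 * σ : ℂ) • H) *ᵥ y =
      gramInner H (S *ᵥ v) y - star l * gramInner H v y := by
    intro v
    rw [gramInner_mulVec_left, sub_mulVec, add_mulVec, dotProduct_sub, dotProduct_add,
      smul_mulVec, dotProduct_smul, ← mulVec_mulVec, smul_eq_mul, hy, mulVec_smul,
      dotProduct_smul, smul_eq_mul, ← hstar]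
    simp only [gramInner]
    ring
  have h0 : star y ⬝ᵥ (H * S + Sᴴ * H - (2 * σ : ℂ) • H) *ᵥ y = 0 := by
    rw [hexp, hy, ← star_gramInner hH, gramInner_smul_right, star_mul', star_gramInner hH]
    ring
  -- The form vanishes at `y` because `Re l = σ`, so `y` lies in its kernel. This says that `y` is
  -- an eigenvector of the adjoint with eigenvalue `2σ - l = conj l`.
  have h1 := (hG.dotProduct_mulVec_zero_iff y).1 h0
  have h2 := hexp w
  rw [h1, dotProduct_zero] at h2
  have h3 := congrArg star (sub_eq_zero.1 h2.symm)
  rwa [star_gramInner hH, star_mul', star_gramInner hH, star_star] at h3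

/-- The orthogonal projection onto the span of `y`. -/
noncomputable def gramProj (H : Matrix (Fin m) (Fin m) ℂ) (y : Fin m → ℂ) :
    Matrix (Fin m) (Fin m) ℂ :=
  (gramInner H y y)⁻¹ • vecMulVec y (star y ᵥ* H)

theorem gramProj_mulVec (y w : Fin m → ℂ) :
    gramProj H y *ᵥ w = ((gramInner H y y)⁻¹ * gramInner H y w) • y := by
  rw [gramProj, smul_mulVec, vecMulVec_mulVec, ← dotProduct_mulVec, gramInner, gramInner,
    mul_smul]
  simp

theorem gramProj_mulVec_self (hH : H.PosDef) {y : Fin m → ℂ} (hy : y ≠ 0) :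
    gramProj H y *ᵥ y = y := by
  have : gramInner H y y ≠ 0 := fun h => by
    have := gramInner_self_pos hH hy
    simp [h] at this
  rw [gramProj_mulVec, inv_mul_cancel₀ this, one_smul]

theorem gramProj_mul_self (hH : H.PosDef) {y : Fin m → ℂ} (hy : y ≠ 0) :
    gramProj H y * gramProj H y = gramProj H y := by
  refine ext_of_mulVec_single fun i => ?_
  rw [← mulVec_mulVec, gramProj_mulVec y (Pi.single i 1), mulVec_smul, gramProj_mulVec_self hH hy]

theorem mul_gramProj {S : Matrix (Fin m) (Fin m) ℂ} {l : ℂ} {y : Fin m → ℂ}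
    (h : S *ᵥ y = l • y) : S * gramProj H y = l • gramProj H y := by
  refine ext_of_mulVec_single fun i => ?_
  rw [← mulVec_mulVec, smul_mulVec, gramProj_mulVec, mulVec_smul, h, smul_comm]

theorem IsAccretive.gramProj_mul {σ : ℝ} {S : Matrix (Fin m) (Fin m) ℂ} (hH : H.IsHermitian)
    (hS : IsAccretive H σ S) {l : ℂ} (hl : l.re = σ) {y : Fin m → ℂ} (h : S *ᵥ y = l • y) :
    gramProj H y * S = l • gramProj H y := by
  refine ext_of_mulVec_single fun i => ?_
  rw [← mulVec_mulVec, smul_mulVec, gramProj_mulVec, gramProj_mulVec,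
    hS.gramInner_mulVec_of_eigenvector hH hl h, smul_smul]
  congr 1
  ring

theorem gramInner_gramProj_mulVec (hH : H.IsHermitian) (y w : Fin m → ℂ) :
    (gramInner H w (gramProj H y *ᵥ w)).re =
      ((gramInner H y y).re)⁻¹ * Complex.normSq (gramInner H y w) := by
  have h1 : gramInner H y y = ((gramInner H y y).re : ℂ) := by
    apply Complex.ext <;> simp [gramInner_self_im hH]
  rw [gramProj_mulVec, gramInner_smul_right, ← star_gramInner hH y w, mul_assoc, RCLike.star_def,
    Complex.mul_conj, h1, ← Complex.ofReal_inv, ← Complex.ofReal_mul, Complex.ofReal_re,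
    Complex.ofReal_re]

theorem IsAccretive.add_gramProj {σ : ℝ} {S : Matrix (Fin m) (Fin m) ℂ} (hH : H.PosDef)
    (hS : IsAccretive H σ S) (y : Fin m → ℂ) : IsAccretive H σ (S + gramProj H y) := by
  intro w
  rw [add_mulVec, gramInner_add_right, Complex.add_re, gramInner_gramProj_mulVec hH.isHermitian]
  have := mul_nonneg (inv_nonneg.2 (gramInner_self_nonneg hH y))
    (Complex.normSq_nonneg (gramInner H y w))
  linarith [hS w]

/-- Adding the projection onto an eigenvector removes boundary eigenvectors and creates none. -/
theorem IsAccretive.eigenvector_of_add_gramProj {σ : ℝ} {S : Matrix (Fin m) (Fin m) ℂ}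
    (hH : H.PosDef) (hS : IsAccretive H σ S) {y : Fin m → ℂ} (hy : y ≠ 0) {l : ℂ}
    (hl : l.re = σ) {w : Fin m → ℂ} (h : (S + gramProj H y) *ᵥ w = l • w) :
    gramInner H y w = 0 ∧ S *ᵥ w = l • w := by
  have h1 : (gramInner H w ((S + gramProj H y) *ᵥ w)).re = σ * (gramInner H w w).re := by
    rw [h, gramInner_smul_right, Complex.mul_re, gramInner_self_im hH.isHermitian, mul_zero,
      sub_zero, hl]
  rw [add_mulVec, gramInner_add_right, Complex.add_re,
    gramInner_gramProj_mulVec hH.isHermitian] at h1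
  have h2 := hS w
  have hpos : 0 < ((gramInner H y y).re)⁻¹ := inv_pos.2 (gramInner_self_pos hH hy)
  have h3 : Complex.normSq (gramInner H y w) = 0 := by
    have h4 := Complex.normSq_nonneg (gramInner H y w)
    by_contra hne
    have := mul_pos hpos (lt_of_le_of_ne h4 (Ne.symm hne))
    linarith
  have h5 : gramInner H y w = 0 := Complex.normSq_eq_zero.1 h3
  refine ⟨h5, ?_⟩
  rwa [add_mulVec, gramProj_mulVec, h5, mul_zero, zero_smul, add_zero] at h

end Accretive

/-! ### The limit of the matrix function at the boundary line -/

section BoundaryLimit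

open Matrix Filter Metric

open scoped Matrix.Norms.L2Operator

variable {m : ℕ} {E : Type*} [NormedAddCommGroup E] [NormedSpace ℂ E]

/-- `P` reduces `S`: on the range of `P` the matrix acts as the scalar `l`, and on the range of `1 -
P` it agrees with `S + P`. -/
theorem sub_smul_one_pow_eq {S P : Matrix (Fin m) (Fin m) ℂ} {l : ℂ} (hP : P * P = P)
    (h1 : S * P = l • P) (h2 : P * S = l • P) (z : ℂ) (n : ℕ) :
    (S - z • 1) ^ n = (l - z) ^ n • P + (1 - P) * (S + P - z • 1) ^ n := by
  induction n with
  | zero => simp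
  | succ n ih =>
    have h3 : (S - z • 1) * P = (l - z) • P := by
      rw [sub_mul, h1, smul_mul, one_mul, sub_smul]
    have h4 : (S - z • 1) * (1 - P) = (1 - P) * (S + P - z • 1) := by
      simp only [mul_sub, sub_mul, mul_add, one_mul, mul_one, smul_mul, Matrix.mul_smul, h1, h2, hP]
      abel
    rw [pow_succ' (S - z • 1), ih, mul_add, Matrix.mul_smul, h3, smul_smul, ← mul_assoc, h4, mul_assoc,
      ← pow_succ', ← pow_succ]

/-- Splitting off a reducing eigenspace from a matrix function. -/
theorem matrixFunctionOpen_eq_add [CompleteSpace E] {σ : ℝ} {K : ℂ → E}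
    (hK : DifferentiableOn ℂ K {s | σ < s.re}) {S P : Matrix (Fin m) (Fin m) ℂ} {l : ℂ}
    (hP : P * P = P) (h1 : S * P = l • P) (h2 : P * S = l • P) (hl : σ < l.re)
    (hS : ∀ s ∈ spectrum ℂ S, σ < s.re) (hSP : ∀ s ∈ spectrum ℂ (S + P), σ < s.re)
    (i j : Fin m) :
    matrixFunctionOpen σ K S i j = P i j • K l +
      ∑ k, (1 - P) i k • matrixFunctionOpen σ K (S + P) k j := by
  obtain ⟨⟨z, r⟩, hr, hz, hb⟩ := exists_enclosesSpectrum (σ := σ)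
    ({l} ∪ (spectrum ℂ S ∪ spectrum ℂ (S + P)))
    ((Set.finite_singleton l).union ((Matrix.finite_spectrum S).union (Matrix.finite_spectrum (S + P)))) (by
      rintro s (rfl | hs | hs)
      exacts [hl, hS s hs, hSP s hs])
  simp only at hr hz hb
  have e1 := hasSum_matrixFunctionOpen hK (S := S) (z := z) (r := r)
    ⟨hr, hz, fun s hs => hb (Or.inr (Or.inl hs))⟩ i j
  have e2 := fun k => hasSum_matrixFunctionOpen hK (S := S + P) (z := z) (r := r)
    ⟨hr, hz, fun s hs => hb (Or.inr (Or.inr hs))⟩ k j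
  have hlb : ‖l - z‖ < r := mem_ball_iff_norm.1 (hb (Or.inl rfl))
  have e3 := hasSum_coeff_cauchyPowerSeries hr (hK.mono hz) hlb
  rw [add_sub_cancel] at e3
  refine e1.unique ?_
  convert (e3.const_smul (P i j)).add
    (hasSum_sum fun k (_ : k ∈ Finset.univ) => (e2 k).const_smul ((1 - P) i k)) using 2 with n
  rw [sub_smul_one_pow_eq hP h1 h2, Matrix.add_apply, Matrix.smul_apply, smul_eq_mul, add_smul, smul_smul,
    mul_comm, Matrix.mul_apply, Finset.sum_smul]
  simp_rw [smul_smul]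

theorem tendsto_matrixFunctionOpen_add_smul_one [CompleteSpace E] {σ : ℝ} {K : ℂ → E}
    (hK : DifferentiableOn ℂ K {s | σ < s.re}) {S : Matrix (Fin m) (Fin m) ℂ}
    (hS : ∀ s ∈ spectrum ℂ S, σ < s.re) (i j : Fin m) :
    Tendsto (fun ε : ℝ => matrixFunctionOpen σ K (S + (ε : ℂ) • 1) i j) (𝓝[>] 0)
      (𝓝 (matrixFunctionOpen σ K S i j)) := by
  have h1 := (differentiableAt_matrixFunctionOpen hK (S := fun ξ => S + ξ • 1) isOpen_univ
    (by fun_prop) (Set.mem_univ 0) (by simpa using hS) i j).continuousAt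
  have h2 : Tendsto (fun ε : ℝ => (ε : ℂ)) (𝓝[>] 0) (𝓝 0) := by
    have : ContinuousAt (fun ε : ℝ => (ε : ℂ)) 0 := by fun_prop
    have h3 := this.tendsto
    rw [Complex.ofReal_zero] at h3
    exact h3.mono_left nhdsWithin_le_nhds
  have h3 := h1.tendsto.comp h2
  simpa [Function.comp_def] using h3

/-- The boundary limit of the matrix function of an analytic family of accretive matrices exists
and is analytic, if eigenvectors to boundary eigenvalues are common to the whole family. -/
theorem exists_tendsto_matrixFunctionOpen [CompleteSpace E] {σ : ℝ} {K : ℂ → E}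
    (hK : DifferentiableOn ℂ K {s | σ < s.re}) (hK' : ContinuousOn K {s | σ ≤ s.re})
    {H : Matrix (Fin m) (Fin m) ℂ} (hH : H.PosDef) {U : Set ℂ} (hU : IsOpen U) {ζ₀ : ℂ}
    (hζ₀ : ζ₀ ∈ U) {S : ℂ → Matrix (Fin m) (Fin m) ℂ} (hS : DifferentiableOn ℂ S U)
    (hacc : ∀ ζ ∈ U, IsAccretive H σ (S ζ))
    (heig : ∀ ζ ∈ U, ∀ ζ' ∈ U, ∀ (l : ℂ) (w : Fin m → ℂ), l.re = σ → S ζ *ᵥ w = l • w →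
      S ζ' *ᵥ w = l • w) :
    ∃ L : ℂ → Fin m → Fin m → E, ∀ i j, DifferentiableOn ℂ (fun ζ => L ζ i j) U ∧
      ∀ ζ ∈ U, Tendsto (fun ε : ℝ => matrixFunctionOpen σ K (S ζ + (ε : ℂ) • 1) i j) (𝓝[>] 0)
        (𝓝 (L ζ i j)) := by
  -- Induction on the dimension of the span of the boundary eigenvectors at `ζ₀`. Adding the
  -- projection onto one of them shifts its eigenvalue from `l` to `l + 1`, inside the half-plane,
  -- and keeps accretivity and the independence of `ζ`.
  suffices h : ∀ (n : ℕ) (S : ℂ → Matrix (Fin m) (Fin m) ℂ), DifferentiableOn ℂ S U →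
      (∀ ζ ∈ U, IsAccretive H σ (S ζ)) →
      (∀ ζ ∈ U, ∀ ζ' ∈ U, ∀ (l : ℂ) (w : Fin m → ℂ), l.re = σ → S ζ *ᵥ w = l • w →
        S ζ' *ᵥ w = l • w) →
      Module.finrank ℂ (Submodule.span ℂ {w : Fin m → ℂ | ∃ l : ℂ, l.re = σ ∧
        S ζ₀ *ᵥ w = l • w}) < n →
      ∃ L : ℂ → Fin m → Fin m → E, ∀ i j, DifferentiableOn ℂ (fun ζ => L ζ i j) U ∧
        ∀ ζ ∈ U, Tendsto (fun ε : ℝ => matrixFunctionOpen σ K (S ζ + (ε : ℂ) • 1) i j) (𝓝[>] 0)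
          (𝓝 (L ζ i j)) from h _ S hS hacc heig (Nat.lt_succ_self _)
  intro n
  induction n with
  | zero =>
    intro S _ _ _ hn
    omega
  | succ n ih =>
    intro S hS hacc heig hn
    by_cases hex : ∃ (y : Fin m → ℂ) (l : ℂ), y ≠ 0 ∧ l.re = σ ∧ S ζ₀ *ᵥ y = l • y
    · obtain ⟨y, l, hy, hl, hyl⟩ := hex
      have hev : ∀ ζ ∈ U, S ζ *ᵥ y = l • y := fun ζ hζ => heig ζ₀ hζ₀ ζ hζ l y hl hyl
      set P := gramProj H y with hP
      obtain ⟨L, hL⟩ := ih (fun ζ => S ζ + P) (hS.add_const P)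
        (fun ζ hζ => (hacc ζ hζ).add_gramProj hH y) (by
          intro ζ hζ ζ' hζ' μ w hμ hw
          obtain ⟨h1, h2⟩ := (hacc ζ hζ).eigenvector_of_add_gramProj hH hy hμ hw
          rw [add_mulVec, heig ζ hζ ζ' hζ' μ w hμ h2, hP, gramProj_mulVec, h1, mul_zero, zero_smul,
            add_zero]) (by
          refine lt_of_lt_of_le ?_ (Nat.lt_succ_iff.1 hn)
          -- The boundary eigenvectors that remain are orthogonal to `y`, so `y` has left the span
          -- and the dimension drops.
          have hker : ∀ w ∈ Submodule.span ℂ {w : Fin m → ℂ | ∃ l : ℂ, l.re = σ ∧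
              (S ζ₀ + P) *ᵥ w = l • w}, gramInner H y w = 0 := by
            intro w hw
            induction hw using Submodule.span_induction with
            | mem w hw =>
              obtain ⟨μ, hμ, hw⟩ := hw
              exact ((hacc ζ₀ hζ₀).eigenvector_of_add_gramProj hH hy hμ hw).1
            | zero => simp [gramInner]
            | add u v _ _ hu hv => rw [gramInner_add_right, hu, hv, add_zero]
            | smul c u _ hu => rw [gramInner_smul_right, hu, mul_zero]
          refine Submodule.finrank_lt_finrank_of_lt (lt_of_le_of_ne ?_ ?_)
          · refine Submodule.span_mono ?_
            rintro w ⟨μ, hμ, hw⟩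
            exact ⟨μ, hμ, ((hacc ζ₀ hζ₀).eigenvector_of_add_gramProj hH hy hμ hw).2⟩
          · intro heq
            have h1 : y ∈ Submodule.span ℂ {w : Fin m → ℂ | ∃ l : ℂ, l.re = σ ∧
                S ζ₀ *ᵥ w = l • w} := Submodule.subset_span ⟨l, hl, hyl⟩
            rw [← heq] at h1
            have h2 := gramInner_self_pos hH hy
            rw [hker y h1] at h2
            simp at h2)
      refine ⟨fun ζ i j => P i j • K l + ∑ k, (1 - P) i k • L ζ k j, fun i j => ⟨?_, ?_⟩⟩
      · refine DifferentiableOn.const_add _ (DifferentiableOn.fun_sum fun k _ => ?_)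
        exact ((hL k j).1).const_smul _
      · intro ζ hζ
        have hPP := gramProj_mul_self hH hy
        have hSP : S ζ * P = l • P := mul_gramProj (hev ζ hζ)
        have hPS : P * S ζ = l • P := (hacc ζ hζ).gramProj_mul hH.isHermitian hl (hev ζ hζ)
        -- For `ε > 0` all spectra lie in the open half-plane, where the splitting is available. As
        -- `ε → 0` the scalar part converges by continuity of `K` up to the boundary, the rest by
        -- the induction hypothesis.
        have heq : ∀ᶠ ε : ℝ in 𝓝[>] 0, P i j • K (l + ε) +
            ∑ k, (1 - P) i k • matrixFunctionOpen σ K (S ζ + P + (ε : ℂ) • 1) k j =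
            matrixFunctionOpen σ K (S ζ + (ε : ℂ) • 1) i j := by
          filter_upwards [self_mem_nhdsWithin] with ε hε
          have hε' : 0 < ε := hε
          have hcomm : S ζ + P + (ε : ℂ) • 1 = S ζ + (ε : ℂ) • 1 + P := by abel
          rw [hcomm]
          refine (matrixFunctionOpen_eq_add hK hPP ?_ ?_ ?_ ?_ ?_ i j).symm
          · rw [add_mul, hSP, smul_mul, one_mul, add_smul]
          · rw [mul_add, hPS, Matrix.mul_smul, mul_one, add_smul]
          · simp only [Complex.add_re, Complex.ofReal_re, hl]
            linarith
          · exact fun s hs => (hacc ζ hζ).lt_re_of_mem_spectrum_add hH hε' hs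
          · rw [← hcomm]
            exact fun s hs =>
              ((hacc ζ hζ).add_gramProj hH y).lt_re_of_mem_spectrum_add hH hε' hs
        refine Tendsto.congr' heq (Tendsto.add (Tendsto.const_smul ?_ _)
          (tendsto_finsetSum _ fun k _ => ((hL k j).2 ζ hζ).const_smul _))
        have h1 : Tendsto (fun ε : ℝ => l + (ε : ℂ)) (𝓝[>] 0) (𝓝[{s | σ ≤ s.re}] l) := by
          refine tendsto_nhdsWithin_iff.2 ⟨?_, ?_⟩
          · have : ContinuousAt (fun ε : ℝ => l + (ε : ℂ)) 0 := by fun_prop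
            have h3 := this.tendsto
            rw [Complex.ofReal_zero, add_zero] at h3
            exact h3.mono_left nhdsWithin_le_nhds
          · filter_upwards [self_mem_nhdsWithin] with ε hε
            have hε' : 0 < ε := hε
            simp only [Complex.add_re, Complex.ofReal_re, hl]
            linarith
        exact (hK' l (by simp [hl])).tendsto.comp h1
    · push Not at hex
      have hsp : ∀ ζ ∈ U, ∀ s ∈ spectrum ℂ (S ζ), σ < s.re := by
        intro ζ hζ s hs
        obtain ⟨w, hw, h⟩ := exists_mulVec_eq_smul_of_mem_spectrum hs
        refine lt_of_le_of_ne ((hacc ζ hζ).le_re_of_mulVec_eq hH hw h) fun h1 => ?_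
        exact hex w s hw h1.symm (heig ζ hζ ζ₀ hζ₀ s w h1.symm h)
      refine ⟨fun ζ i j => matrixFunctionOpen σ K (S ζ) i j, fun i j => ⟨?_, ?_⟩⟩
      · exact fun ζ hζ =>
          (differentiableAt_matrixFunctionOpen hK hU hS hζ (hsp ζ hζ) i j).differentiableWithinAt
      · exact fun ζ hζ => tendsto_matrixFunctionOpen_add_smul_one hK (hsp ζ hζ) i j

end BoundaryLimit

/-! ### Coercivity for functions of a strict contraction -/

section Dilation

open Matrix Filter

open scoped Matrix.Norms.L2Operator ComplexConjugate

variable {m : ℕ}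

theorem Matrix.PosSemidef.exists_conjTranspose_mul_self {M : Matrix (Fin m) (Fin m) ℂ}
    (hM : M.PosSemidef) : ∃ D : Matrix (Fin m) (Fin m) ℂ, Dᴴ * D = M := by
  open scoped MatrixOrder in
  obtain ⟨D, hD⟩ := CStarAlgebra.nonneg_iff_eq_star_mul_self.mp hM.nonneg
  exact ⟨D, hD.symm⟩

theorem star_dotProduct_self_eq (w : Fin m → ℂ) :
    star w ⬝ᵥ w = ((∑ i, ‖w i‖ ^ 2 : ℝ) : ℂ) := by
  simp only [dotProduct, Pi.star_apply, RCLike.star_def, Complex.conj_mul']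
  push_cast
  rfl

theorem sum_norm_sq_mulVec_le (M : Matrix (Fin m) (Fin m) ℂ) (w : Fin m → ℂ) :
    ∑ i, ‖(M *ᵥ w) i‖ ^ 2 ≤ ‖M‖ ^ 2 * ∑ i, ‖w i‖ ^ 2 := by
  have h := Matrix.l2_opNorm_mulVec M (WithLp.toLp 2 w)
  have h2 := pow_le_pow_left₀ (norm_nonneg _) h 2
  rw [mul_pow, EuclideanSpace.norm_sq_eq, EuclideanSpace.norm_sq_eq] at h2
  simpa using h2

theorem posSemidef_one_sub_conjTranspose_mul_self {T : Matrix (Fin m) (Fin m) ℂ} (hT : ‖T‖ ≤ 1) :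
    (1 - Tᴴ * T).PosSemidef := by
  refine PosSemidef.of_dotProduct_mulVec_nonneg ?_ fun w => ?_
  · rw [IsHermitian, conjTranspose_sub, conjTranspose_mul, conjTranspose_conjTranspose,
      conjTranspose_one]
  · have h1 : star w ⬝ᵥ (1 - Tᴴ * T) *ᵥ w = star w ⬝ᵥ w - star (T *ᵥ w) ⬝ᵥ (T *ᵥ w) := by
      rw [sub_mulVec, one_mulVec, dotProduct_sub, star_mulVec, ← dotProduct_mulVec, mulVec_mulVec]
    rw [h1, star_dotProduct_self_eq, star_dotProduct_self_eq, ← Complex.ofReal_sub]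
    rw [Complex.zero_le_real, sub_nonneg]
    refine (sum_norm_sq_mulVec_le T w).trans ?_
    refine mul_le_of_le_one_left (by positivity) ?_
    exact pow_le_one₀ (norm_nonneg _) hT

theorem norm_arrAct_le {E : Type*} [NormedAddCommGroup E] [NormedSpace ℂ E]
    (M : Matrix (Fin m) (Fin m) ℂ) (x : Fin m → E) : ‖arrAct M x‖ ≤ m * ‖M‖ * ‖x‖ := by
  refine (pi_norm_le_iff_of_nonneg (by positivity)).2 fun i => ?_
  refine (norm_sum_le _ _).trans ?_
  calc ∑ j, ‖M i j • x j‖ ≤ ∑ _j : Fin m, ‖M‖ * ‖x‖ := by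
        refine Finset.sum_le_sum fun j _ => ?_
        rw [norm_smul]
        exact mul_le_mul (Matrix.norm_entry_le_l2_opNorm M i j) (norm_le_pi_norm x j)
          (norm_nonneg _) (norm_nonneg _)
    _ = m * ‖M‖ * ‖x‖ := by
        rw [Finset.sum_const, Finset.card_univ, Fintype.card_fin, nsmul_eq_mul, mul_assoc]

variable {V : Type*} [NormedAddCommGroup V] [InnerProductSpace ℂ V]

theorem norm_pairing_arrAct_le (M : Matrix (Fin m) (Fin m) ℂ) (x : Fin m → V)
    (ℓ : Fin m → (V →L⋆[ℂ] ℂ)) :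
    ‖pairing (arrAct M x) (arrAct M ℓ)‖ ≤ ‖pairingCLM x‖ * m * ‖ℓ‖ * ‖M‖ ^ 2 := by
  rw [pairing_arrAct, ← pairingCLM_apply]
  calc _ ≤ ‖pairingCLM x‖ * (m * ‖Mᴴ * M‖ * ‖ℓ‖) :=
        ((pairingCLM x).le_opNorm _).trans
          (mul_le_mul_of_nonneg_left (norm_arrAct_le _ _) (norm_nonneg _))
    _ = _ := by
        rw [Matrix.l2_opNorm_conjTranspose_mul_self]
        ring

/-- Telescoping: `(T^l)ᴴ DᴴD T^l = (T^l)ᴴ T^l - (T^(l+1))ᴴ T^(l+1)`. -/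
theorem sum_pairing_defect {T D : Matrix (Fin m) (Fin m) ℂ} (hD : Dᴴ * D = 1 - Tᴴ * T)
    (x : Fin m → V) (ℓ : Fin m → (V →L⋆[ℂ] ℂ)) (n : ℕ) :
    ∑ l ∈ Finset.range n, pairing (arrAct (D * T ^ l) x) (arrAct (D * T ^ l) ℓ) =
      pairing x ℓ - pairing (arrAct (T ^ n) x) (arrAct (T ^ n) ℓ) := by
  induction n with
  | zero => simp [one_arrAct]
  | succ n ih =>
    rw [Finset.sum_range_succ, ih, mul_arrAct, mul_arrAct, pairing_arrAct D D, hD, sub_arrAct,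
      one_arrAct, pairing_sub_right, ← pairing_arrAct, ← mul_arrAct, ← mul_arrAct, ← pow_succ']
    ring

theorem norm_pow_le_mul_pow {T : Matrix (Fin m) (Fin m) ℂ} {q : ℝ} (hT : ‖T‖ ≤ q) (n : ℕ) :
    ‖T ^ n‖ ≤ (1 + ‖(1 : Matrix (Fin m) (Fin m) ℂ)‖) * q ^ n := by
  have hq : 0 ≤ q := (norm_nonneg _).trans hT
  rcases Nat.eq_zero_or_pos n with rfl | hn
  · simp
  · calc ‖T ^ n‖ ≤ ‖T‖ ^ n := norm_pow_le' T hn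
      _ ≤ q ^ n := pow_le_pow_left₀ (norm_nonneg _) hT n
      _ ≤ _ := le_mul_of_one_le_left (by positivity)
        (by linarith [norm_nonneg (1 : Matrix (Fin m) (Fin m) ℂ)])

theorem hasSum_pairing_defect {T D : Matrix (Fin m) (Fin m) ℂ} (hD : Dᴴ * D = 1 - Tᴴ * T)
    {q : ℝ} (hT : ‖T‖ ≤ q) (hq : q < 1) (x : Fin m → V) (ℓ : Fin m → (V →L⋆[ℂ] ℂ)) :
    Tendsto (fun n => ∑ l ∈ Finset.range n,
      pairing (arrAct (D * T ^ l) x) (arrAct (D * T ^ l) ℓ)) atTop (𝓝 (pairing x ℓ)) := by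
  have hq0 : 0 ≤ q := (norm_nonneg _).trans hT
  simp_rw [sum_pairing_defect hD]
  have h1 : Tendsto (fun n => pairing (arrAct (T ^ n) x) (arrAct (T ^ n) ℓ)) atTop (𝓝 0) := by
    refine squeeze_zero_norm (fun n => norm_pairing_arrAct_le (T ^ n) x ℓ) ?_
    have h2 : Tendsto (fun n => ‖T ^ n‖) atTop (𝓝 0) := by
      refine squeeze_zero (fun n => norm_nonneg _) (norm_pow_le_mul_pow hT) ?_
      simpa using (tendsto_pow_atTop_nhds_zero_of_lt_one hq0 hq).const_mul
        (1 + ‖(1 : Matrix (Fin m) (Fin m) ℂ)‖)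
    simpa using (h2.pow 2).const_mul (‖pairingCLM x‖ * m * ‖ℓ‖)
  simpa using h1.const_sub (pairing x ℓ)

/-- Dominated convergence for series: for fixed `l` the argument `y (N - l)` tends to `ℓ`, and the
terms are dominated by a multiple of `q ^ (2 l)`. -/
theorem tendsto_sum_pairing_defect {T D : Matrix (Fin m) (Fin m) ℂ} (hD : Dᴴ * D = 1 - Tᴴ * T)
    {q : ℝ} (hT : ‖T‖ ≤ q) (hq : q < 1) (x : Fin m → V) {ℓ : Fin m → (V →L⋆[ℂ] ℂ)}
    {y : ℕ → Fin m → (V →L⋆[ℂ] ℂ)} (hy : Tendsto y atTop (𝓝 ℓ)) :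
    Tendsto (fun N => ∑ l ∈ Finset.range N,
      pairing (arrAct (D * T ^ l) x) (arrAct (D * T ^ l) (y (N - l)))) atTop
      (𝓝 (pairing x ℓ)) := by
  have hq0 : 0 ≤ q := (norm_nonneg _).trans hT
  have hcont : ∀ l, Continuous fun ℓ : Fin m → (V →L⋆[ℂ] ℂ) =>
      pairing (arrAct (D * T ^ l) x) (arrAct (D * T ^ l) ℓ) := fun l => by
    simp_rw [← pairingCLM_apply]
    exact (pairingCLM _).continuous.comp (continuous_arrAct _)
  obtain ⟨B, hB⟩ := hy.norm.bddAbove_range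
  have hB' : ∀ n, ‖y n‖ ≤ B := fun n => hB ⟨n, rfl⟩
  have hB0 : 0 ≤ B := (norm_nonneg _).trans (hB' 0)
  set c : ℝ := 1 + ‖(1 : Matrix (Fin m) (Fin m) ℂ)‖ with hc
  have hpow : ∀ l, ‖D * T ^ l‖ ^ 2 ≤ (‖D‖ * c) ^ 2 * (q ^ 2) ^ l := by
    intro l
    calc ‖D * T ^ l‖ ^ 2 ≤ (‖D‖ * (c * q ^ l)) ^ 2 := by
          refine pow_le_pow_left₀ (norm_nonneg _) ?_ 2
          exact (norm_mul_le _ _).trans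
            (mul_le_mul_of_nonneg_left (norm_pow_le_mul_pow hT l) (norm_nonneg _))
      _ = _ := by
        rw [← pow_mul, mul_comm 2 l, pow_mul]
        ring
  have hsum : Summable fun l : ℕ =>
      ‖pairingCLM x‖ * m * B * ((‖D‖ * c) ^ 2 * (q ^ 2) ^ l) :=
    ((summable_geometric_of_lt_one (by positivity) (by nlinarith)).mul_left _).mul_left _
  have hle : ∀ (l : ℕ) (ℓ : Fin m → (V →L⋆[ℂ] ℂ)), ‖ℓ‖ ≤ B →
      ‖pairing (arrAct (D * T ^ l) x) (arrAct (D * T ^ l) ℓ)‖ ≤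
      ‖pairingCLM x‖ * m * B * ((‖D‖ * c) ^ 2 * (q ^ 2) ^ l) := by
    intro l ℓ hℓ
    refine (norm_pairing_arrAct_le _ x ℓ).trans ?_
    have := hpow l
    gcongr
  have hdom := tendsto_tsum_of_dominated_convergence (𝓕 := atTop)
    (f := fun N l => if l < N then
      pairing (arrAct (D * T ^ l) x) (arrAct (D * T ^ l) (y (N - l))) else 0)
    (g := fun l => pairing (arrAct (D * T ^ l) x) (arrAct (D * T ^ l) ℓ)) hsum (by
      intro l
      have h1 := ((hcont l).tendsto ℓ).comp (hy.comp (tendsto_sub_atTop_nat l))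
      refine h1.congr' ?_
      filter_upwards [eventually_gt_atTop l] with N hN
      simp [hN]) (by
      refine Eventually.of_forall fun N l => ?_
      split_ifs
      · exact hle l _ (hB' _)
      · rw [norm_zero]
        positivity)
  have hlim : ∑' l, pairing (arrAct (D * T ^ l) x) (arrAct (D * T ^ l) ℓ) = pairing x ℓ := by
    have hs : Summable fun l => pairing (arrAct (D * T ^ l) x) (arrAct (D * T ^ l) ℓ) :=
      Summable.of_norm_bounded hsum fun l =>
        hle l ℓ (le_of_tendsto hy.norm (Eventually.of_forall hB'))
    exact tendsto_nhds_unique hs.hasSum.tendsto_sum_nat (hasSum_pairing_defect hD hT hq x ℓ)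
  rw [hlim] at hdom
  refine hdom.congr fun N => ?_
  rw [tsum_eq_sum (s := Finset.range N)]
  · exact Finset.sum_congr rfl fun l hl => by rw [if_pos (Finset.mem_range.1 hl)]
  · intro l hl
    rw [if_neg (by simpa using hl)]

/-- For `k ≤ n` the test sequence factors as `D T^(N-1-n) T^(n-k) x`, so the convolution at time `n`
collects a partial sum of `∑ T^j ⊗ F_j`, applied to `x`. -/
theorem causal_sum_defect {A B : Type*} [NormedAddCommGroup A] [NormedSpace ℂ A]
    [NormedAddCommGroup B] [NormedSpace ℂ B] (F : ℕ → A →L[ℂ] B)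
    (T D : Matrix (Fin m) (Fin m) ℂ) (x : Fin m → A) {N n : ℕ} (hn : n < N) :
    (∑ k ∈ Finset.range N, if k ≤ n then
      (fun i => F (n - k) (arrAct (D * T ^ (N - 1 - k)) x i)) else 0) =
    arrAct (D * T ^ (N - 1 - n)) (∑ j ∈ Finset.range (n + 1), arrAct (T ^ j) fun i => F j (x i)) := by
  rw [← Finset.sum_filter]
  have h1 : (Finset.range N).filter (fun k => k ≤ n) = Finset.range (n + 1) := by
    ext k
    simp only [Finset.mem_filter, Finset.mem_range]
    omega
  rw [h1, ← Finset.sum_range_reflect, arrAct_sum]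
  refine Finset.sum_congr rfl fun j hj => ?_
  have hj' : j < n + 1 := Finset.mem_range.1 hj
  have h2 : n - (n + 1 - 1 - j) = j := by omega
  have h3 : N - 1 - (n + 1 - 1 - j) = N - 1 - n + j := by omega
  rw [h2, h3, ← mul_arrAct, mul_assoc, ← pow_add]
  have := arrAct_comp (D * T ^ (N - 1 - n + j)) (F j).toLinearMap x
  simp only [ContinuousLinearMap.coe_coe] at this
  exact this.symm

theorem hasSum_pow_smul_pi_apply {A B : Type*} [NormedAddCommGroup A] [NormedSpace ℂ A]
    [NormedAddCommGroup B] [NormedSpace ℂ B] [CompleteSpace B] {F : ℕ → A →L[ℂ] B}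
    (hF : Summable fun n => ‖F n‖) {z : ℂ} (hz : ‖z‖ = 1) (x : Fin m → A) :
    HasSum (fun n => z ^ n • fun i => F n (x i)) fun i => (∑' n, z ^ n • F n) (x i) := by
  rw [Pi.hasSum]
  intro i
  have h1 := (summable_pow_smul_of_norm_one hF hz).hasSum
  exact h1.mapL (ContinuousLinearMap.apply ℂ B (x i))

/-- A coercivity estimate on the unit circle passes to functions of a strict contraction. -/
theorem coercive_of_contraction [CompleteSpace V] {α : ℝ} (hα : 0 ≤ α)
    {F : ℕ → V →L[ℂ] (V →L⋆[ℂ] ℂ)} {G : ℕ → V →L[ℂ] V} (hF : Summable fun n => ‖F n‖)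
    (hG : Summable fun n => ‖G n‖)
    (hcoer : ∀ z : ℂ, ‖z‖ = 1 → ∀ v : V,
      α * ‖(∑' n, z ^ n • G n) v‖ ^ 2 ≤ ((∑' n, z ^ n • F n) v v).re)
    {T : Matrix (Fin m) (Fin m) ℂ} {q : ℝ} (hT : ‖T‖ ≤ q) (hq : q < 1) {x y : Fin m → V}
    {ℓ : Fin m → (V →L⋆[ℂ] ℂ)}
    (hℓ : HasSum (fun n => arrAct (T ^ n) fun i => F n (x i)) ℓ)
    (hy : HasSum (fun n => arrAct (T ^ n) fun i => G n (x i)) y) :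
    α * ∑ i, ‖y i‖ ^ 2 ≤ (pairing x ℓ).re := by
  obtain ⟨D, hD⟩ := (posSemidef_one_sub_conjTranspose_mul_self
    (hT.trans hq.le)).exists_conjTranspose_mul_self
  set yF : ℕ → Fin m → (V →L⋆[ℂ] ℂ) := fun M =>
    ∑ j ∈ Finset.range M, arrAct (T ^ j) fun i => F j (x i) with hyF
  set yG : ℕ → Fin m → V := fun M =>
    ∑ j ∈ Finset.range M, arrAct (T ^ j) fun i => G j (x i) with hyG
  have hmain : ∀ N, α * ∑ l ∈ Finset.range N, ∑ i, ‖arrAct (D * T ^ l) (yG (N - l)) i‖ ^ 2 ≤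
      ∑ l ∈ Finset.range N,
        (pairing (arrAct (D * T ^ l) x) (arrAct (D * T ^ l) (yF (N - l)))).re := by
    intro N
    -- The powers decrease in `k`: time runs backwards. After the reflection `l = N - 1 - n`, the
    -- convolution at time `n` uses the partial sum with `n + 1 = N - l` terms.
    set u : ℕ → Fin m → V := fun k => arrAct (D * T ^ (N - 1 - k)) x with hu
    have hsF : ∀ k < N, Summable fun n => ‖(fun i => F n (u k i) : Fin m → (V →L⋆[ℂ] ℂ))‖ := by
      intro k _
      refine Summable.of_nonneg_of_le (fun _ => norm_nonneg _) (fun n => ?_)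
        (hF.mul_right ‖u k‖)
      refine (pi_norm_le_iff_of_nonneg (by positivity)).2 fun i => ?_
      exact ((F n).le_opNorm _).trans
        (mul_le_mul_of_nonneg_left (norm_le_pi_norm (u k) i) (norm_nonneg _))
    have hsG : ∀ k < N, Summable fun n => ‖(fun i => G n (u k i) : Fin m → V)‖ := by
      intro k _
      refine Summable.of_nonneg_of_le (fun _ => norm_nonneg _) (fun n => ?_)
        (hG.mul_right ‖u k‖)
      refine (pi_norm_le_iff_of_nonneg (by positivity)).2 fun i => ?_
      exact ((G n).le_opNorm _).trans
        (mul_le_mul_of_nonneg_left (norm_le_pi_norm (u k) i) (norm_nonneg _))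
    have h := sum_norm_sq_coeff_le hα u
      (summable_norm_causal_convolution N (w := fun k n i => G n (u k i)) hsG)
      (summable_norm_causal_convolution N (w := fun k n i => F n (u k i)) hsF) N (by
        intro z hz
        rw [(hasSum_causal_convolution N fun k _ => hasSum_pow_smul_pi_apply hG hz (u k)).tsum_eq,
          (hasSum_causal_convolution N fun k _ => hasSum_pow_smul_pi_apply hF hz (u k)).tsum_eq]
        set U := ∑ k ∈ Finset.range N, z ^ k • u k with hU
        have e1 : ∀ i, (∑ k ∈ Finset.range N, z ^ k • fun i => (∑' n, z ^ n • G n) (u k i)) i =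
            (∑' n, z ^ n • G n) (U i) := by
          intro i
          simp [hU, Finset.sum_apply, map_sum]
        have e2 : (∑ k ∈ Finset.range N, z ^ k • fun i => (∑' n, z ^ n • F n) (u k i)) =
            fun i => (∑' n, z ^ n • F n) (U i) := by
          ext1 i
          simp [hU, Finset.sum_apply, map_sum]
        simp_rw [e1]
        rw [e2, pairing, Complex.re_sum, Finset.mul_sum]
        exact Finset.sum_le_sum fun i _ => hcoer z hz (U i))
    rw [← Finset.sum_range_reflect (fun l => ∑ i, ‖arrAct (D * T ^ l) (yG (N - l)) i‖ ^ 2),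
      ← Finset.sum_range_reflect (fun l =>
        (pairing (arrAct (D * T ^ l) x) (arrAct (D * T ^ l) (yF (N - l)))).re)]
    refine le_of_eq_of_le ?_ (h.trans (le_of_eq ?_))
    · congr 1
      refine Finset.sum_congr rfl fun n hn => ?_
      have hn' := Finset.mem_range.1 hn
      have e : N - (N - 1 - n) = n + 1 := by omega
      rw [causal_sum_defect G T D x hn', e]
    · refine Finset.sum_congr rfl fun n hn => ?_
      have hn' := Finset.mem_range.1 hn
      have e : N - (N - 1 - n) = n + 1 := by omega
      rw [causal_sum_defect F T D x hn', e]
  have hRHS : Tendsto (fun N => ∑ l ∈ Finset.range N,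
      (pairing (arrAct (D * T ^ l) x) (arrAct (D * T ^ l) (yF (N - l)))).re) atTop
      (𝓝 (pairing x ℓ).re) := by
    have h1 := (Complex.continuous_re.tendsto _).comp
      (tendsto_sum_pairing_defect hD hT hq x hℓ.tendsto_sum_nat)
    simpa [Function.comp_def, Complex.re_sum] using h1
  -- On the left, nonnegative terms with `l ≥ n` are dropped before `N → ∞`; afterwards `n → ∞`, and
  -- the defect sum for `y` telescopes to `‖y‖²`.
  have hpart : ∀ n, α * ∑ l ∈ Finset.range n, ∑ i, ‖arrAct (D * T ^ l) y i‖ ^ 2 ≤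
      (pairing x ℓ).re := by
    intro n
    have hlim : Tendsto (fun N => α * ∑ l ∈ Finset.range n,
        ∑ i, ‖arrAct (D * T ^ l) (yG (N - l)) i‖ ^ 2) atTop
        (𝓝 (α * ∑ l ∈ Finset.range n, ∑ i, ‖arrAct (D * T ^ l) y i‖ ^ 2)) := by
      refine Tendsto.const_mul _ (tendsto_finsetSum _ fun l _ => tendsto_finsetSum _ fun i _ => ?_)
      have h1 := ((continuous_arrAct (D * T ^ l)).tendsto y).comp
        (hy.tendsto_sum_nat.comp (tendsto_sub_atTop_nat l))
      exact ((tendsto_pi_nhds.1 h1 i).norm).pow 2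
    refine le_of_tendsto_of_tendsto hlim hRHS ?_
    filter_upwards [eventually_ge_atTop n] with N hN
    refine le_trans (mul_le_mul_of_nonneg_left ?_ hα) (hmain N)
    exact Finset.sum_le_sum_of_subset_of_nonneg (Finset.range_mono hN) fun _ _ _ => by positivity
  have hfin : Tendsto (fun n => α * ∑ l ∈ Finset.range n, ∑ i, ‖arrAct (D * T ^ l) y i‖ ^ 2) atTop
      (𝓝 (α * ∑ i, ‖y i‖ ^ 2)) := by
    refine Tendsto.const_mul _ ?_
    have h1 := (Complex.continuous_re.tendsto _).comp
      (hasSum_pairing_defect hD hT hq y fun i => rieszMap (y i))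
    rw [pairing_rieszMap_self, Complex.ofReal_re] at h1
    refine h1.congr fun n => ?_
    simp only [Function.comp_apply, Complex.re_sum]
    refine Finset.sum_congr rfl fun l _ => ?_
    have h2 := arrAct_comp (D * T ^ l) (rieszMap : V →L[ℂ] (V →L⋆[ℂ] ℂ)).toLinearMap y
    simp only [ContinuousLinearMap.coe_coe] at h2
    rw [h2, pairing_rieszMap_self, Complex.ofReal_re]
  exact le_of_tendsto hfin (Eventually.of_forall hpart)

end Dilation

/-! ### Coercivity for functions of a strictly accretive matrix -/

section PointwiseCoercivity

open Matrix Filter Metric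

open scoped Matrix.Norms.L2Operator

variable {m : ℕ}

theorem l2_opNorm_le_of_sum_norm_sq_le {M : Matrix (Fin m) (Fin m) ℂ} {R : ℝ} (hR : 0 ≤ R)
    (h : ∀ w : Fin m → ℂ, ∑ i, ‖(M *ᵥ w) i‖ ^ 2 ≤ R ^ 2 * ∑ i, ‖w i‖ ^ 2) : ‖M‖ ≤ R := by
  rw [Matrix.cstar_norm_def]
  refine ContinuousLinearMap.opNorm_le_bound _ hR fun w => ?_
  refine le_of_sq_le_sq ?_ (by positivity)
  rw [mul_pow, EuclideanSpace.norm_sq_eq, EuclideanSpace.norm_sq_eq]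
  simpa using h w.ofLp

/-- An accretive matrix is close to a large multiple of the identity. -/
theorem IsAccretive.exists_norm_sub_le {σ ε : ℝ} (hε : 0 < ε) {S : Matrix (Fin m) (Fin m) ℂ}
    (hS : IsAccretive 1 (σ + ε) S) :
    ∃ ρ : ℝ, ε ≤ ρ ∧ ‖S - ((σ + ρ : ℝ) : ℂ) • 1‖ ≤ ρ - ε / 2 := by
  set A : Matrix (Fin m) (Fin m) ℂ := S - (σ : ℂ) • 1 with hA
  -- The choice gives `‖A‖² ≤ ρ ε`, hence `|(A - ρ)w|² ≤ (ρ ε - 2 ρ ε + ρ²)|w|² ≤ (ρ - ε/2)²|w|²`.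
  refine ⟨‖A‖ ^ 2 / ε + ε, by
    have : 0 ≤ ‖A‖ ^ 2 / ε := by positivity
    linarith, ?_⟩
  set ρ : ℝ := ‖A‖ ^ 2 / ε + ε with hρ
  have hρε : ‖A‖ ^ 2 ≤ ρ * ε := by
    rw [hρ, add_mul, div_mul_cancel₀ _ hε.ne']
    nlinarith
  have hερ : ε ≤ ρ := by
    have : 0 ≤ ‖A‖ ^ 2 / ε := by positivity
    linarith
  have hSA : S - ((σ + ρ : ℝ) : ℂ) • 1 = A - (ρ : ℂ) • 1 := by
    rw [hA, Complex.ofReal_add, add_smul]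
    abel
  rw [hSA]
  refine l2_opNorm_le_of_sum_norm_sq_le (by linarith) fun w => ?_
  have h1 : ∀ i, ‖((A - (ρ : ℂ) • 1) *ᵥ w) i‖ ^ 2 = ‖(A *ᵥ w) i‖ ^ 2 -
      2 * ρ * (star (w i) * (A *ᵥ w) i).re + ρ ^ 2 * ‖w i‖ ^ 2 := by
    intro i
    rw [sub_mulVec, smul_mulVec, one_mulVec, Pi.sub_apply, Pi.smul_apply, smul_eq_mul,
      ← Complex.normSq_eq_norm_sq, ← Complex.normSq_eq_norm_sq, ← Complex.normSq_eq_norm_sq]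
    simp only [Complex.normSq_apply, Complex.sub_re, Complex.sub_im, Complex.mul_re,
      Complex.mul_im, Complex.ofReal_re, Complex.ofReal_im, RCLike.star_def, Complex.conj_re,
      Complex.conj_im]
    ring
  simp_rw [h1]
  rw [Finset.sum_add_distrib, Finset.sum_sub_distrib, ← Finset.mul_sum, ← Finset.mul_sum]
  have h2 := hS w
  have h3 : (gramInner 1 w w).re = ∑ i, ‖w i‖ ^ 2 := by
    rw [gramInner, one_mulVec, star_dotProduct_self_eq, Complex.ofReal_re]
  have h4 : ∑ i, (star (w i) * (A *ᵥ w) i).re =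
      (gramInner 1 w (S *ᵥ w)).re - σ * ∑ i, ‖w i‖ ^ 2 := by
    rw [← Complex.re_sum, ← h3]
    have : ∑ i, star (w i) * (A *ᵥ w) i = gramInner 1 w (A *ᵥ w) := by
      rw [gramInner, one_mulVec]
      rfl
    rw [this, hA, sub_mulVec, smul_mulVec, one_mulVec, sub_eq_add_neg, gramInner_add_right,
      ← neg_smul, gramInner_smul_right, ← Complex.ofReal_neg, Complex.add_re,
      Complex.re_ofReal_mul]
    ring
  have h5 := sum_norm_sq_mulVec_le A w
  rw [h3] at h2
  rw [h4]
  have h6 : 0 ≤ ∑ i, ‖w i‖ ^ 2 := by positivity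
  have h7 : ‖A‖ ^ 2 * ∑ i, ‖w i‖ ^ 2 ≤ ρ * ε * ∑ i, ‖w i‖ ^ 2 :=
    mul_le_mul_of_nonneg_right hρε h6
  have h8 : ρ * (ε * ∑ i, ‖w i‖ ^ 2) ≤
      ρ * ((gramInner 1 w (S *ᵥ w)).re - σ * ∑ i, ‖w i‖ ^ 2) :=
    mul_le_mul_of_nonneg_left (by linarith) (by linarith)
  nlinarith [mul_nonneg (sq_nonneg (ε / 2)) h6]

theorem hasSum_arrAct_apply {A B : Type*} [NormedAddCommGroup A] [NormedSpace ℂ A]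
    [NormedAddCommGroup B] [NormedSpace ℂ B] {M : ℕ → Matrix (Fin m) (Fin m) ℂ}
    {a : ℕ → A →L[ℂ] B} {K : Fin m → Fin m → A →L[ℂ] B}
    (h : ∀ i j, HasSum (fun n => M n i j • a n) (K i j)) (x : Fin m → A) :
    HasSum (fun n => arrAct (M n) fun i => a n (x i)) fun i => ∑ j, K i j (x j) := by
  rw [Pi.hasSum]
  intro i
  exact hasSum_sum fun j _ => (h i j).mapL (ContinuousLinearMap.apply ℂ B (x j))

variable {V : Type*} [NormedAddCommGroup V] [InnerProductSpace ℂ V]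

/-- The substitution `s = z + r₁ ζ` maps the unit circle into the half-plane, where the scalar
estimate holds, and turns `S`, after conjugation by `C`, into a strict contraction `T`. -/
theorem coercive_matrixFunctionOpen [CompleteSpace V] {σ α : ℝ} (hα : 0 ≤ α)
    {L : ℂ → V →L[ℂ] (V →L⋆[ℂ] ℂ)} {R : ℂ → V →L[ℂ] V}
    (hL : DifferentiableOn ℂ L {s | σ < s.re}) (hR : DifferentiableOn ℂ R {s | σ < s.re})
    (hcoer : ∀ (v : V) (s : ℂ), σ < s.re → α * ‖R s v‖ ^ 2 ≤ (L s v v).re)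
    {H : Matrix (Fin m) (Fin m) ℂ} (hH : H.PosDef) {S : Matrix (Fin m) (Fin m) ℂ} {ε : ℝ}
    (hε : 0 < ε) (hS : IsAccretive H (σ + ε) S) (x : Fin m → V) :
    α * gramNormSq H (fun i => ∑ j, matrixFunctionOpen σ R S i j (x j)) ≤
      (gramPairing H x fun i => ∑ j, matrixFunctionOpen σ L S i j (x j)).re := by
  obtain ⟨C, rfl⟩ := hH.posSemidef.exists_conjTranspose_mul_self
  have hCu : IsUnit C := isUnit_of_mul_isUnit_right hH.isUnit
  have hCdet : IsUnit C.det := (isUnit_iff_isUnit_det C).1 hCu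
  set S' := C * S * C⁻¹ with hS'
  have hCS : S' * C = C * S := by
    rw [hS', mul_assoc, nonsing_inv_mul _ hCdet, mul_one]
  have hgram : ∀ u v, gramInner (Cᴴ * C) u v = gramInner 1 (C *ᵥ u) (C *ᵥ v) := by
    intro u v
    rw [gramInner_mulVec_left, gramInner, ← mulVec_mulVec, mul_one, mulVec_mulVec]
  have hacc : IsAccretive 1 (σ + ε) S' := by
    intro w
    have hw : C *ᵥ (C⁻¹ *ᵥ w) = w := by
      rw [mulVec_mulVec, mul_nonsing_inv _ hCdet, one_mulVec]
    have h1 := hS (C⁻¹ *ᵥ w)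
    rw [hgram, hgram, mulVec_mulVec _ C S, ← hCS, ← mulVec_mulVec, hw] at h1
    exact h1
  obtain ⟨ρ, hρ, hnorm⟩ := hacc.exists_norm_sub_le hε
  set z : ℂ := ((σ + ρ : ℝ) : ℂ) with hz
  set r : ℝ := ρ - ε / 4 with hr
  set r₁ : ℝ := ρ - 3 * ε / 8 with hr₁
  have hrpos : 0 < r := by linarith
  have hr₁pos : 0 < r₁ := by linarith
  have hr₁r : r₁ < r := by linarith
  have hball : closedBall z r ⊆ {s : ℂ | σ < s.re} := by
    intro s hs
    simp only [mem_closedBall, dist_eq_norm] at hs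
    have h1 := (Complex.abs_re_le_norm _).trans hs
    simp only [hz, Complex.sub_re, Complex.ofReal_re] at h1
    have h2 := (abs_le.1 h1).1
    simp only [Set.mem_ofPred_eq]
    linarith
  have hspec : spectrum ℂ S ⊆ ball z r := by
    have h1 : spectrum ℂ S' = spectrum ℂ S := by
      obtain ⟨u, hu⟩ := hCu
      have h2 := spectrum.units_conjugate (R := ℂ) (a := S) (u := u)
      rw [← h2, hS', ← hu, coe_units_inv]
    rw [← h1]
    rcases subsingleton_or_nontrivial (Matrix (Fin m) (Fin m) ℂ) with hs | hs
    · rw [spectrum.of_subsingleton]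
      exact Set.empty_subset _
    · rw [← spectrum_sub_smul_one_subset_ball]
      intro l hl
      rw [mem_ball_zero_iff]
      have h2 := spectrum.norm_le_norm_of_mem hl
      linarith
  have henc : EnclosesSpectrum σ S (z, r) := ⟨hrpos, hball, hspec⟩
  set T : Matrix (Fin m) (Fin m) ℂ := ((r₁⁻¹ : ℝ) : ℂ) • (S' - z • 1) with hT
  have hTnorm : ‖T‖ ≤ r₁⁻¹ * (ρ - ε / 2) := by
    rw [hT, norm_smul, Complex.norm_real, Real.norm_of_nonneg (by positivity)]
    exact mul_le_mul_of_nonneg_left hnorm (by positivity)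
  have hq : r₁⁻¹ * (ρ - ε / 2) < 1 := by
    rw [inv_mul_lt_iff₀ hr₁pos]
    linarith
  have hconj : ∀ n, (S' - z • 1) ^ n * C = C * (S - z • 1) ^ n := by
    intro n
    have h1 : SemiconjBy C (S - z • 1) (S' - z • 1) := by
      rw [SemiconjBy, mul_sub, sub_mul, hCS, Matrix.mul_smul, smul_mul, mul_one, one_mul]
    exact (h1.pow_right n).eq.symm
  have hr₁C : ((r₁ : ℝ) : ℂ) ≠ 0 := by exact_mod_cast hr₁pos.ne'
  -- `r₁ ^ n` cancels the scaling in `T ^ n`, and `C` intertwines the powers of `S - z` and `S' -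
  -- z`.
  have hterm : ∀ {B : Type _} [NormedAddCommGroup B] [NormedSpace ℂ B] (a : ℕ → V →L[ℂ] B) (n : ℕ),
      arrAct (T ^ n) (fun i => (((r₁ : ℝ) : ℂ) ^ n • a n) (arrAct C x i)) =
      arrAct C (arrAct ((S - z • 1) ^ n) fun i => a n (x i)) := by
    intro B _ _ a n
    have h1 := arrAct_comp C (a n).toLinearMap x
    simp only [ContinuousLinearMap.coe_coe] at h1
    have h2 : (fun i => (((r₁ : ℝ) : ℂ) ^ n • a n) (arrAct C x i)) =
        ((r₁ : ℝ) : ℂ) ^ n • arrAct C (fun i => a n (x i)) := by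
      rw [h1]
      rfl
    rw [h2, arrAct_smul, hT, smul_pow, smul_arrAct, smul_smul, ← mul_pow, Complex.ofReal_inv,
      mul_inv_cancel₀ hr₁C, one_pow, one_smul, ← mul_arrAct, ← mul_arrAct, hconj]
  have hsummable : ∀ {B : Type _} [NormedAddCommGroup B] [NormedSpace ℂ B] (K : ℂ → V →L[ℂ] B),
      Summable fun n => ‖((r₁ : ℝ) : ℂ) ^ n • (cauchyPowerSeries K z r).coeff n‖ := by
    intro B _ _ K
    obtain ⟨M, hM0, hM⟩ := norm_coeff_cauchyPowerSeries_le K z hrpos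
    refine Summable.of_nonneg_of_le (fun _ => norm_nonneg _) (fun n => ?_)
      ((summable_geometric_of_lt_one (by positivity) ((div_lt_one hrpos).2 hr₁r)).mul_left M)
    rw [norm_smul, norm_pow, Complex.norm_real, Real.norm_of_nonneg hr₁pos.le]
    calc r₁ ^ n * ‖(cauchyPowerSeries K z r).coeff n‖ ≤ r₁ ^ n * (M * (1 / r) ^ n) := by
          gcongr
          exact hM n
      _ = M * (r₁ / r) ^ n := by
        rw [div_pow, div_pow, one_pow]
        ring
  have hval : ∀ {B : Type _} [NormedAddCommGroup B] [NormedSpace ℂ B] [CompleteSpace B]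
      {K : ℂ → V →L[ℂ] B}, DifferentiableOn ℂ K {s | σ < s.re} → ∀ ζ : ℂ, ‖ζ‖ = 1 →
      ∑' n, ζ ^ n • ((r₁ : ℝ) : ℂ) ^ n • (cauchyPowerSeries K z r).coeff n = K (z + ζ * r₁) := by
    intro B _ _ _ K hK ζ hζ
    have h1 : ‖ζ * r₁‖ < r := by
      rw [norm_mul, hζ, one_mul, Complex.norm_real, Real.norm_of_nonneg hr₁pos.le]
      exact hr₁r
    have h2 := hasSum_coeff_cauchyPowerSeries hrpos (hK.mono hball) h1
    rw [← h2.tsum_eq]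
    exact tsum_congr fun n => by rw [mul_pow, smul_smul]
  have hre : ∀ ζ : ℂ, ‖ζ‖ = 1 → σ < (z + ζ * r₁).re := by
    intro ζ hζ
    refine hball (a := z + ζ * r₁) ?_
    rw [mem_closedBall, dist_eq_norm, add_sub_cancel_left, norm_mul, hζ, one_mul,
      Complex.norm_real, Real.norm_of_nonneg hr₁pos.le]
    exact hr₁r.le
  have hsum : ∀ {B : Type _} [NormedAddCommGroup B] [NormedSpace ℂ B] [CompleteSpace B]
      {K : ℂ → V →L[ℂ] B}, DifferentiableOn ℂ K {s | σ < s.re} →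
      HasSum (fun n => arrAct (T ^ n) fun i =>
        (((r₁ : ℝ) : ℂ) ^ n • (cauchyPowerSeries K z r).coeff n) (arrAct C x i))
        (arrAct C fun i => ∑ j, matrixFunctionOpen σ K S i j (x j)) := by
    intro B _ _ _ K hK
    have h1 := hasSum_arrAct_apply (fun i j => hasSum_matrixFunctionOpen hK henc i j) x
    have h2 := h1.map (arrActLin C).toAddMonoidHom (continuous_arrAct C)
    exact h2.congr_fun fun n => hterm _ n
  have hfinal := coercive_of_contraction hα (hsummable L) (hsummable R) (by
    intro ζ hζ v
    rw [hval hL ζ hζ, hval hR ζ hζ]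
    exact hcoer v _ (hre ζ hζ)) hTnorm hq (hsum hL) (hsum hR)
  rw [gramNormSq_conjTranspose_mul_self, gramPairing_conjTranspose_mul_self]
  exact hfinal

end PointwiseCoercivity

/-! ### From symbols on a disc to weighted sums in the time domain -/

section TimeDomain

open Matrix Filter

variable {m : ℕ} {V : Type*} [NormedAddCommGroup V] [InnerProductSpace ℂ V]

/-- Abel's lemma: terms that are bounded at `r'` decay geometrically at any smaller radius. -/
theorem summable_pow_mul_norm_of_summable {E : Type*} [NormedAddCommGroup E] [NormedSpace ℂ E]
    {v : ℕ → E} {r r' : ℝ} (hr : 0 ≤ r) (hrr' : r < r')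
    (h : Summable fun n => ((r' : ℝ) : ℂ) ^ n • v n) : Summable fun n => r ^ n * ‖v n‖ := by
  have hr' : 0 < r' := hr.trans_lt hrr'
  obtain ⟨B, hB⟩ := h.tendsto_atTop_zero.norm.bddAbove_range
  refine Summable.of_nonneg_of_le (fun n => by positivity) (fun n => ?_)
    ((summable_geometric_of_lt_one (by positivity) ((div_lt_one hr').2 hrr')).mul_left B)
  have h1 : ‖((r' : ℝ) : ℂ) ^ n • v n‖ ≤ B := hB ⟨n, rfl⟩
  rw [norm_smul, norm_pow, Complex.norm_real, Real.norm_of_nonneg hr'.le] at h1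
  calc r ^ n * ‖v n‖ = (r / r') ^ n * (r' ^ n * ‖v n‖) := by
        rw [← mul_assoc, ← mul_pow, div_mul_cancel₀ _ hr'.ne']
    _ ≤ (r / r') ^ n * B := by gcongr
    _ = _ := mul_comm _ _

/-- The discrete convolution with operator-valued weights. -/
def weightConv {A B : Type*} [NormedAddCommGroup A] [NormedSpace ℂ A]
    [NormedAddCommGroup B] [NormedSpace ℂ B] (W : ℕ → Fin m → Fin m → A →L[ℂ] B)
    (f : ℕ → Fin m → A) (n : ℕ) : Fin m → B :=
  fun i => ∑ k ∈ Finset.range (n + 1), ∑ j, W (n - k) i j (f k j)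

section Weights

variable {A B : Type*} [NormedAddCommGroup A] [NormedSpace ℂ A]
  [NormedAddCommGroup B] [NormedSpace ℂ B] {W : ℕ → Fin m → Fin m → A →L[ℂ] B}
  {𝒦 : ℂ → Fin m → Fin m → A →L[ℂ] B} {ρ : ℝ}

theorem pow_smul_arrAct_weightConv (C : Matrix (Fin m) (Fin m) ℂ) (f : ℕ → Fin m → A) (r : ℂ)
    {n N : ℕ} (hn : n < N) :
    (∑ k ∈ Finset.range N, if k ≤ n then
      r ^ (n - k) • (r ^ k • arrAct C fun i => ∑ j, W (n - k) i j (f k j)) else 0) =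
    r ^ n • arrAct C (weightConv W f n) := by
  rw [← Finset.sum_filter]
  have h1 : (Finset.range N).filter (fun k => k ≤ n) = Finset.range (n + 1) := by
    ext k
    simp only [Finset.mem_filter, Finset.mem_range]
    omega
  have h2 : weightConv W f n = ∑ k ∈ Finset.range (n + 1), fun i => ∑ j, W (n - k) i j (f k j) := by
    ext i
    simp [weightConv, Finset.sum_apply]
  rw [h1, h2, arrAct_sum, Finset.smul_sum]
  refine Finset.sum_congr rfl fun k hk => ?_
  rw [smul_smul, ← pow_add]
  congr 2
  have := Finset.mem_range.1 hk
  omega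

theorem hasSum_weights
    (hW : ∀ ζ : ℂ, ‖ζ‖ < ρ → ∀ i j, HasSum (fun n => ζ ^ n • W n i j) (𝒦 ζ i j))
    (C : Matrix (Fin m) (Fin m) ℂ) {ζ : ℂ} (hζ : ‖ζ‖ < ρ) (x : Fin m → A) :
    HasSum (fun n => ζ ^ n • arrAct C fun i => ∑ j, W n i j (x j))
      (arrAct C fun i => ∑ j, 𝒦 ζ i j (x j)) := by
  have h1 : HasSum (fun n => ζ ^ n • fun i => ∑ j, W n i j (x j))
      (fun i => ∑ j, 𝒦 ζ i j (x j)) := by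
    rw [Pi.hasSum]
    intro i
    have h2 := hasSum_sum fun j (_ : j ∈ Finset.univ) =>
      (hW ζ hζ i j).mapL (ContinuousLinearMap.apply ℂ B (x j))
    convert h2 using 2 with n
    · simp [Finset.smul_sum]
    · rfl
  have h3 := h1.map (arrActLin C).toAddMonoidHom (continuous_arrAct C)
  exact h3.congr_fun fun n => (arrAct_smul C _ _).symm

theorem hasSum_scaled_weights
    (hW : ∀ ζ : ℂ, ‖ζ‖ < ρ → ∀ i j, HasSum (fun n => ζ ^ n • W n i j) (𝒦 ζ i j))
    (C : Matrix (Fin m) (Fin m) ℂ) {r : ℝ} (hr : 0 < r) (hrρ : r < ρ) {z : ℂ} (hz : ‖z‖ = 1)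
    (f : ℕ → Fin m → A) (N : ℕ) :
    HasSum (fun n => z ^ n • ∑ k ∈ Finset.range N, if k ≤ n then
      (r : ℂ) ^ (n - k) • ((r : ℂ) ^ k • arrAct C fun i => ∑ j, W (n - k) i j (f k j)) else 0)
      (arrAct C fun i => ∑ j, 𝒦 (z * r) i j
        ((∑ k ∈ Finset.range N, (z * r) ^ k • f k) j)) := by
  have hζ : ‖z * r‖ < ρ := by
    rwa [norm_mul, hz, one_mul, Complex.norm_real, Real.norm_of_nonneg hr.le]
  have h1 := hasSum_causal_convolution N (z := z)
    (w := fun k n => (r : ℂ) ^ n • ((r : ℂ) ^ k • arrAct C fun i => ∑ j, W n i j (f k j)))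
    (s := fun k => (r : ℂ) ^ k • arrAct C fun i => ∑ j, 𝒦 (z * r) i j (f k j)) (by
      intro k _
      have h2 := (hasSum_weights hW C hζ (f k)).const_smul ((r : ℂ) ^ k)
      refine h2.congr_fun fun n => ?_
      rw [smul_smul, smul_smul, smul_smul, mul_pow]
      congr 1
      ring)
  have h3 : (fun i => ∑ j, 𝒦 (z * r) i j ((∑ k ∈ Finset.range N, (z * r) ^ k • f k) j)) =
      ∑ k ∈ Finset.range N, (z * r) ^ k • fun i => ∑ j, 𝒦 (z * r) i j (f k j) := by
    ext i
    simp only [Finset.sum_apply, Pi.smul_apply, map_sum, map_smul, Finset.smul_sum]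
    exact Finset.sum_comm
  have h4 : ∑ k ∈ Finset.range N, arrAct C ((z * r) ^ k • fun i => ∑ j, 𝒦 (z * r) i j (f k j)) =
      ∑ k ∈ Finset.range N, z ^ k • (r : ℂ) ^ k • arrAct C fun i => ∑ j, 𝒦 (z * r) i j (f k j) :=
    Finset.sum_congr rfl fun k _ => by rw [arrAct_smul, smul_smul, mul_pow]
  rw [h3, arrAct_sum, h4]
  exact h1

theorem summable_scaled_weights
    (hW : ∀ ζ : ℂ, ‖ζ‖ < ρ → ∀ i j, HasSum (fun n => ζ ^ n • W n i j) (𝒦 ζ i j))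
    (C : Matrix (Fin m) (Fin m) ℂ) {r : ℝ} (hr : 0 < r) (hrρ : r < ρ)
    (f : ℕ → Fin m → A) (N : ℕ) :
    Summable fun n => ‖∑ k ∈ Finset.range N, if k ≤ n then
      (r : ℂ) ^ (n - k) • ((r : ℂ) ^ k • arrAct C fun i => ∑ j, W (n - k) i j (f k j)) else 0‖ := by
  refine summable_norm_causal_convolution N
    (w := fun k n => (r : ℂ) ^ n • ((r : ℂ) ^ k • arrAct C fun i => ∑ j, W n i j (f k j))) ?_
  intro k _
  obtain ⟨r', hr', hr'ρ⟩ := exists_between hrρ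
  have h1 : ‖((r' : ℝ) : ℂ)‖ < ρ := by
    rwa [Complex.norm_real, Real.norm_of_nonneg (hr.trans hr').le]
  have h2 := summable_pow_mul_norm_of_summable hr.le hr' (hasSum_weights hW C h1 (f k)).summable
  refine (h2.mul_left (r ^ k)).congr fun n => ?_
  rw [norm_smul, norm_smul, norm_pow, norm_pow, Complex.norm_real, Real.norm_of_nonneg hr.le]
  ring

end Weights

/-- Coercivity of the symbols on a disc passes to the truncated weighted sums in the time
domain. -/
theorem coercive_weightConv [CompleteSpace V] {α ρ : ℝ} (hα : 0 ≤ α) (hρ : 0 < ρ)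
    {H : Matrix (Fin m) (Fin m) ℂ} (hH : H.PosDef)
    {WL : ℕ → Fin m → Fin m → V →L[ℂ] (V →L⋆[ℂ] ℂ)} {WR : ℕ → Fin m → Fin m → V →L[ℂ] V}
    {𝓛 : ℂ → Fin m → Fin m → V →L[ℂ] (V →L⋆[ℂ] ℂ)} {𝓡 : ℂ → Fin m → Fin m → V →L[ℂ] V}
    (hL : ∀ ζ : ℂ, ‖ζ‖ < ρ → ∀ i j, HasSum (fun n => ζ ^ n • WL n i j) (𝓛 ζ i j))
    (hR : ∀ ζ : ℂ, ‖ζ‖ < ρ → ∀ i j, HasSum (fun n => ζ ^ n • WR n i j) (𝓡 ζ i j))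
    (hcoer : ∀ ζ : ℂ, ‖ζ‖ < ρ → ∀ x : Fin m → V,
      α * gramNormSq H (fun i => ∑ j, 𝓡 ζ i j (x j)) ≤
        (gramPairing H x fun i => ∑ j, 𝓛 ζ i j (x j)).re)
    (f : ℕ → Fin m → V) (N : ℕ) :
    α * ∑ n ∈ Finset.range N, ρ ^ (2 * n) * gramNormSq H (weightConv WR f n) ≤
      ∑ n ∈ Finset.range N, ρ ^ (2 * n) * (gramPairing H (f n) (weightConv WL f n)).re := by
  obtain ⟨C, rfl⟩ := hH.posSemidef.exists_conjTranspose_mul_self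
  -- On a circle of radius `r < ρ` the series converge absolutely, and the scaled data `r ^ n • f n`
  -- put it on the unit circle. Truncating `f` at `N` is harmless, since by causality the first `N`
  -- outputs depend only on the first `N` inputs.
  have key : ∀ r : ℝ, 0 < r → r < ρ →
      α * ∑ n ∈ Finset.range N, r ^ (2 * n) * gramNormSq (Cᴴ * C) (weightConv WR f n) ≤
      ∑ n ∈ Finset.range N, r ^ (2 * n) * (gramPairing (Cᴴ * C) (f n) (weightConv WL f n)).re := by
    intro r hr hrρ
    have h := sum_norm_sq_coeff_le hα (fun n => (r : ℂ) ^ n • arrAct C (f n))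
      (summable_scaled_weights hR C hr hrρ f N) (summable_scaled_weights hL C hr hrρ f N) N (by
        intro z hz
        have hζ : ‖z * r‖ < ρ := by
          rwa [norm_mul, hz, one_mul, Complex.norm_real, Real.norm_of_nonneg hr.le]
        rw [(hasSum_scaled_weights hR C hr hrρ hz f N).tsum_eq,
          (hasSum_scaled_weights hL C hr hrρ hz f N).tsum_eq]
        set x := ∑ k ∈ Finset.range N, (z * r) ^ k • f k with hx
        have h1 : ∑ n ∈ Finset.range N, z ^ n • (r : ℂ) ^ n • arrAct C (f n) = arrAct C x := by
          rw [hx, arrAct_sum]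
          exact Finset.sum_congr rfl fun k _ => by rw [arrAct_smul, smul_smul, mul_pow]
        rw [h1, ← gramPairing_conjTranspose_mul_self, ← gramNormSq_conjTranspose_mul_self]
        exact hcoer _ hζ x)
    convert h using 1
    · congr 1
      refine Finset.sum_congr rfl fun n hn => ?_
      rw [pow_smul_arrAct_weightConv C f r (Finset.mem_range.1 hn),
        gramNormSq_conjTranspose_mul_self, Finset.mul_sum]
      refine Finset.sum_congr rfl fun i _ => ?_
      rw [Pi.smul_apply, norm_smul, norm_pow, Complex.norm_real, Real.norm_of_nonneg hr.le,
        mul_pow, ← pow_mul, mul_comm n 2]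
    · refine Finset.sum_congr rfl fun n hn => ?_
      rw [pow_smul_arrAct_weightConv C f r (Finset.mem_range.1 hn),
        gramPairing_conjTranspose_mul_self, pairing_smul, pairing_smul_right, ← mul_assoc,
        map_pow, Complex.conj_ofReal, ← pow_add, ← Complex.ofReal_pow, Complex.re_ofReal_mul,
        two_mul]
  -- Both sides are finite sums, hence continuous in `r`, and the limit `r → ρ` is elementary.
  have hcl : Tendsto (fun r : ℝ =>
      α * ∑ n ∈ Finset.range N, r ^ (2 * n) * gramNormSq (Cᴴ * C) (weightConv WR f n)) (𝓝[<] ρ)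
      (𝓝 (α * ∑ n ∈ Finset.range N, ρ ^ (2 * n) * gramNormSq (Cᴴ * C) (weightConv WR f n))) :=
    ((by fun_prop : Continuous fun r : ℝ => α * ∑ n ∈ Finset.range N,
      r ^ (2 * n) * gramNormSq (Cᴴ * C) (weightConv WR f n)).tendsto ρ).mono_left
      nhdsWithin_le_nhds
  have hcr : Tendsto (fun r : ℝ => ∑ n ∈ Finset.range N,
      r ^ (2 * n) * (gramPairing (Cᴴ * C) (f n) (weightConv WL f n)).re) (𝓝[<] ρ)
      (𝓝 (∑ n ∈ Finset.range N,
        ρ ^ (2 * n) * (gramPairing (Cᴴ * C) (f n) (weightConv WL f n)).re)) :=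
    ((by fun_prop : Continuous fun r : ℝ => ∑ n ∈ Finset.range N,
      r ^ (2 * n) * (gramPairing (Cᴴ * C) (f n) (weightConv WL f n)).re).tendsto ρ).mono_left
      nhdsWithin_le_nhds
  refine le_of_tendsto_of_tendsto hcl hcr ?_
  filter_upwards [self_mem_nhdsWithin,
    (eventually_gt_nhds hρ).filter_mono nhdsWithin_le_nhds] with r hr1 hr2
  exact key r hr2 hr1

end TimeDomain

/-! ### Discrete coercivity for accretive differentiation symbols -/

section DiscreteCoercivity

open Matrix Filter

variable {m : ℕ} {V : Type*} [NormedAddCommGroup V] [InnerProductSpace ℂ V]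

-- The symbol is analytic on the whole disc, so its Taylor series at `0`, whose coefficients are the
-- weights, converges there. The limits justify the use of `limUnder` in `matrixFunction`.
open scoped Matrix.Norms.L2Operator in
theorem RungeKutta.exists_tendsto_cqSymbol {E : Type*} [NormedAddCommGroup E] [NormedSpace ℂ E]
    [CompleteSpace E] (rk : RungeKutta m) {H : Matrix (Fin m) (Fin m) ℂ} (hH : H.PosDef)
    {σ τ ρ M μ : ℝ} (hρ : 0 < ρ)
    (hdiff : DifferentiableOn ℂ (fun ζ => rk.symbol ζ) (Metric.ball 0 ρ))
    (hacc : ∀ ζ ∈ Metric.ball (0 : ℂ) ρ, IsAccretive H σ ((τ : ℂ)⁻¹ • rk.symbol ζ))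
    (heig : ∀ ζ ∈ Metric.ball (0 : ℂ) ρ, ∀ ζ' ∈ Metric.ball (0 : ℂ) ρ, ∀ (l : ℂ) (w : Fin m → ℂ),
      l.re = σ → ((τ : ℂ)⁻¹ • rk.symbol ζ) *ᵥ w = l • w →
      ((τ : ℂ)⁻¹ • rk.symbol ζ') *ᵥ w = l • w)
    {K : ℂ → E} (hK : IsAnalyticFamily σ M μ K) :
    (∀ ζ : ℂ, ‖ζ‖ < ρ → ∀ i j,
      HasSum (fun n : ℕ => ζ ^ n • cqWeight rk σ τ K n i j) (cqSymbol rk σ τ K ζ i j)) ∧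
    ∀ ζ : ℂ, ‖ζ‖ < ρ → ∀ i j, Tendsto (fun ε : ℝ =>
      matrixFunctionOpen σ K ((τ : ℂ)⁻¹ • rk.symbol ζ + (ε : ℂ) • 1) i j) (𝓝[>] 0)
      (𝓝 (cqSymbol rk σ τ K ζ i j)) := by
  obtain ⟨L, hL⟩ := exists_tendsto_matrixFunctionOpen hK.analytic hK.cont hH Metric.isOpen_ball
    (Metric.mem_ball_self hρ) (hdiff.const_smul ((τ : ℂ)⁻¹)) hacc heig
  have heq : ∀ i j, ∀ ζ ∈ Metric.ball (0 : ℂ) ρ, cqSymbol rk σ τ K ζ i j = L ζ i j :=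
    fun i j ζ hζ => ((hL i j).2 ζ hζ).limUnder_eq
  refine ⟨fun ζ hζ i j => ?_, fun ζ hζ i j => ?_⟩
  · have hd : DifferentiableOn ℂ (fun ζ => cqSymbol rk σ τ K ζ i j) (Metric.ball 0 ρ) :=
      (hL i j).1.congr (heq i j)
    have h := Complex.hasSum_taylorSeries_on_ball hd (z := ζ) (by simpa using hζ)
    refine h.congr_fun fun n => ?_
    rw [cqWeight, sub_zero, smul_comm]
  · have hζ' : ζ ∈ Metric.ball (0 : ℂ) ρ := by simpa using hζ
    rw [heq i j ζ hζ']
    exact (hL i j).2 ζ hζ'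

theorem gramNormSq_nonneg {H : Matrix (Fin m) (Fin m) ℂ} (hH : H.PosDef) (x : Fin m → V) :
    0 ≤ gramNormSq H x := by
  obtain ⟨C, rfl⟩ := hH.posSemidef.exists_conjTranspose_mul_self
  rw [gramNormSq_conjTranspose_mul_self]
  positivity

theorem continuous_gramNormSq (H : Matrix (Fin m) (Fin m) ℂ) :
    Continuous (gramNormSq H : (Fin m → V) → ℝ) := by
  unfold gramNormSq
  fun_prop

theorem continuous_gramPairing (H : Matrix (Fin m) (Fin m) ℂ) (x : Fin m → V) :
    Continuous (gramPairing H x) := by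
  have : (gramPairing H x) = fun ℓ => pairingCLM x (arrAct H ℓ) := by
    ext1 ℓ
    rw [gramPairing_eq_pairing, pairingCLM_apply]
  rw [this]
  exact (pairingCLM x).continuous.comp (continuous_arrAct H)

open scoped Matrix.Norms.L2Operator in
/-- Discrete coercivity for accretive differentiation symbols. -/
theorem RungeKutta.discreteCoercivity [CompleteSpace V] (rk : RungeKutta m)
    {H : Matrix (Fin m) (Fin m) ℂ} (hH : H.PosDef) {σ σ' τ : ℝ} (hτ : 0 < τ)
    (hdiff : DifferentiableOn ℂ (fun ζ => rk.symbol ζ) (Metric.ball 0 (Real.exp (-σ' * τ))))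
    (hacc : ∀ ζ ∈ Metric.ball (0 : ℂ) (Real.exp (-σ' * τ)),
      IsAccretive H σ ((τ : ℂ)⁻¹ • rk.symbol ζ))
    (heig : ∀ ζ ∈ Metric.ball (0 : ℂ) (Real.exp (-σ' * τ)),
      ∀ ζ' ∈ Metric.ball (0 : ℂ) (Real.exp (-σ' * τ)), ∀ (l : ℂ) (w : Fin m → ℂ),
      l.re = σ → ((τ : ℂ)⁻¹ • rk.symbol ζ) *ᵥ w = l • w →
      ((τ : ℂ)⁻¹ • rk.symbol ζ') *ᵥ w = l • w)
    {α : ℝ} (hα : 0 ≤ α) {L : ℂ → V →L[ℂ] (V →L⋆[ℂ] ℂ)} {R : ℂ → V →L[ℂ] V}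
    (hLR : ContinuousCoercivity σ α L R) : DiscreteCoercivity rk H σ σ' τ α L R := by
  obtain ⟨M, μ, hL, hR⟩ := hLR.families
  have hρ : 0 < Real.exp (-σ' * τ) := Real.exp_pos _
  obtain ⟨sL, tL⟩ := rk.exists_tendsto_cqSymbol hH hρ hdiff hacc heig hL
  obtain ⟨sR, tR⟩ := rk.exists_tendsto_cqSymbol hH hρ hdiff hacc heig hR
  have hcoer : ∀ ζ : ℂ, ‖ζ‖ < Real.exp (-σ' * τ) → ∀ x : Fin m → V,
      α * gramNormSq H (fun i => ∑ j, cqSymbol rk σ τ R ζ i j (x j)) ≤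
        (gramPairing H x fun i => ∑ j, cqSymbol rk σ τ L ζ i j (x j)).re := by
    intro ζ hζ x
    have h1 : ∀ {B : Type _} [NormedAddCommGroup B] [NormedSpace ℂ B] {K : ℂ → V →L[ℂ] B},
        (∀ i j, Tendsto (fun ε : ℝ =>
          matrixFunctionOpen σ K ((τ : ℂ)⁻¹ • rk.symbol ζ + (ε : ℂ) • 1) i j) (𝓝[>] 0)
          (𝓝 (cqSymbol rk σ τ K ζ i j))) →
        Tendsto (fun (ε : ℝ) i => ∑ j,
          matrixFunctionOpen σ K ((τ : ℂ)⁻¹ • rk.symbol ζ + (ε : ℂ) • 1) i j (x j)) (𝓝[>] 0)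
          (𝓝 fun i => ∑ j, cqSymbol rk σ τ K ζ i j (x j)) := by
      intro B _ _ K hK
      refine tendsto_pi_nhds.2 fun i => tendsto_finsetSum _ fun j _ => ?_
      exact ((ContinuousLinearMap.apply ℂ B (x j)).continuous.tendsto _).comp (hK i j)
    refine le_of_tendsto_of_tendsto
      ((((continuous_gramNormSq H).tendsto _).comp (h1 (tR ζ hζ))).const_mul α)
      ((Complex.continuous_re.tendsto _).comp
        (((continuous_gramPairing H x).tendsto _).comp (h1 (tL ζ hζ)))) ?_
    -- Adding `ε I` makes accretivity strict, so the matrix inequality applies before the limit `ε →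
    -- 0` is taken.
    filter_upwards [self_mem_nhdsWithin] with ε hε
    exact coercive_matrixFunctionOpen hα hL.analytic hR.analytic hLR.coercive hH hε
      ((hacc ζ (by simpa using hζ)).add_smul_one ε) x
  have hexp : ∀ n : ℕ, Real.exp (-2 * σ' * n * τ) = Real.exp (-σ' * τ) ^ (2 * n) := by
    intro n
    rw [← Real.exp_nat_mul]
    congr 1
    push_cast
    ring
  have hmain : ∀ (f : ℕ → Fin m → V) (N : ℕ), α * ∑ n ∈ Finset.range N,
      Real.exp (-2 * σ' * n * τ) * gramNormSq H (cqConv rk σ τ R f n) ≤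
      ∑ n ∈ Finset.range N, Real.exp (-2 * σ' * n * τ) *
        (gramPairing H (f n) (cqConv rk σ τ L f n)).re := by
    intro f N
    have h := coercive_weightConv hα hρ hH sL sR hcoer f N
    simp_rw [hexp]
    exact h
  have hzero : ∀ (f : ℕ → Fin m → V), (Function.support f).Finite →
      ∃ N₀ : ℕ, ∀ n : ℕ, N₀ ≤ n → Real.exp (-2 * σ' * n * τ) *
        (gramPairing H (f n) (cqConv rk σ τ L f n)).re = 0 := by
    intro f hf
    obtain ⟨B, hB⟩ := hf.bddAbove
    refine ⟨B + 1, fun n hn => ?_⟩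
    have hfn : f n = 0 := by
      by_contra hne
      have := hB (Function.mem_support.2 hne)
      omega
    simp [hfn, gramPairing]
  have hbound : ∀ (f : ℕ → Fin m → V), (Function.support f).Finite → ∀ N, α *
      ∑ n ∈ Finset.range N, Real.exp (-2 * σ' * n * τ) * gramNormSq H (cqConv rk σ τ R f n) ≤
      ∑' n : ℕ, Real.exp (-2 * σ' * n * τ) *
        (gramPairing H (f n) (cqConv rk σ τ L f n)).re := by
    -- The terms with `f n = 0` vanish on the right, so the right-hand side is a finite sum that
    -- bounds every partial sum on the left.
    intro f hf N
    obtain ⟨N₀, hN₀⟩ := hzero f hf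
    have h1 : ∑' n : ℕ, Real.exp (-2 * σ' * n * τ) *
        (gramPairing H (f n) (cqConv rk σ τ L f n)).re =
        ∑ n ∈ Finset.range (max N N₀), Real.exp (-2 * σ' * n * τ) *
          (gramPairing H (f n) (cqConv rk σ τ L f n)).re := by
      refine tsum_eq_sum fun n hn => hN₀ n ?_
      have := Finset.mem_range.not.1 hn
      omega
    rw [h1]
    refine le_trans (mul_le_mul_of_nonneg_left ?_ hα) (hmain f _)
    exact Finset.sum_le_sum_of_subset_of_nonneg (Finset.range_mono (le_max_left _ _))
      fun n _ _ => mul_nonneg (Real.exp_pos _).le (gramNormSq_nonneg hH _)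
  have hsummable : ∀ f : ℕ → Fin m → V, (Function.support f).Finite → α ≠ 0 →
      Summable fun n : ℕ =>
        Real.exp (-2 * σ' * n * τ) * gramNormSq H (cqConv rk σ τ R f n) := by
    intro f hf hα0
    have hαpos : 0 < α := lt_of_le_of_ne hα (Ne.symm hα0)
    refine summable_of_sum_range_le (c := α⁻¹ * ∑' n : ℕ, Real.exp (-2 * σ' * n * τ) *
      (gramPairing H (f n) (cqConv rk σ τ L f n)).re)
      (fun n => mul_nonneg (Real.exp_pos _).le (gramNormSq_nonneg hH _)) fun N => ?_
    rw [le_inv_mul_iff₀ hαpos]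
    exact hbound f hf N
  refine ⟨sL, sR, hsummable, fun f hf => ?_⟩
  rw [mul_left_comm]
  refine mul_le_mul_of_nonneg_left ?_ hτ.le
  -- For `α = 0` the bound with the empty partial sum already says that the right-hand side is
  -- nonnegative.
  rcases eq_or_ne α 0 with hα0 | hα0
  · have := hbound f hf 0
    simpa [hα0] using this
  · exact le_of_tendsto ((hsummable f hf hα0).hasSum.tendsto_sum_nat.const_mul α)
      (Eventually.of_forall (hbound f hf))

end DiscreteCoercivity

/-! ### Coercive differentiation symbols and small stepsizes -/

section Symbol

open Matrix

variable {m : ℕ}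

open scoped Matrix.Norms.L2Operator in
theorem RungeKutta.differentiableOn_symbol (rk : RungeKutta m) {ρ : ℝ} (hρ : ρ ≤ 1)
    (hu : ∀ ζ ∈ Metric.ball (0 : ℂ) ρ, IsUnit (rk.symbolInv ζ)) :
    DifferentiableOn ℂ (fun ζ => rk.symbol ζ) (Metric.ball 0 ρ) := by
  intro ζ hζ
  have hζ1 : (1 : ℂ) - ζ ≠ 0 := by
    intro h
    have h1 : ζ = 1 := (sub_eq_zero.1 h).symm
    rw [mem_ball_zero_iff, h1, norm_one] at hζ
    linarith
  have h1 : DifferentiableAt ℂ (fun ζ => rk.symbolInv ζ) ζ := by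
    have h2 : (fun ζ => rk.symbolInv ζ) = fun ζ => rk.A.map (fun a => (a : ℂ)) +
        (ζ / (1 - ζ)) • Matrix.of fun _ j => (rk.b j : ℂ) := by
      ext ζ i j
      simp [RungeKutta.symbolInv]
    rw [h2]
    refine DifferentiableAt.const_add _ (DifferentiableAt.smul_const ?_ _)
    exact differentiableAt_id.div (by fun_prop) hζ1
  refine DifferentiableAt.differentiableWithinAt ?_
  simp_rw [RungeKutta.symbol, Matrix.nonsing_inv_eq_ringInverse]
  exact (differentiableAt_inverse (hu ζ hζ)).comp ζ h1

theorem RungeKutta.symbolInv_mulVec (rk : RungeKutta m) (ζ : ℂ) (w : Fin m → ℂ) :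
    rk.symbolInv ζ *ᵥ w = (rk.A.map (fun a => (a : ℂ))) *ᵥ w +
      fun _ => ζ / (1 - ζ) * ∑ j, (rk.b j : ℂ) * w j := by
  ext i
  simp only [RungeKutta.symbolInv, mulVec, dotProduct, of_apply, Pi.add_apply, map_apply,
    add_mul, Finset.sum_add_distrib, Finset.mul_sum, mul_assoc]

/-- The inverse of a singular matrix is by convention `0`, and the zero matrix is not coercive on
the nonzero kernel vector of `rk.symbolInv ζ`. -/
theorem RungeKutta.SymbolCoercive.isUnit {rk : RungeKutta m} {H : Matrix (Fin m) (Fin m) ℂ}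
    (hH : H.PosDef) {ζ : ℂ} {c : ℝ} (hc : 0 < c)
    (h : ∀ w : Fin m → ℂ, c * (gramInner H w w).re ≤ (gramInner H w (rk.symbol ζ *ᵥ w)).re) :
    IsUnit (rk.symbolInv ζ) := by
  by_contra hu
  have h0 : rk.symbol ζ = 0 := by
    rw [RungeKutta.symbol, nonsing_inv_eq_ringInverse, Ring.inverse_non_unit _ hu]
  obtain ⟨w, hw, -⟩ := exists_mulVec_eq_zero_iff.2
    (show (rk.symbolInv ζ).det = 0 by
      rwa [isUnit_iff_isUnit_det, isUnit_iff_ne_zero, not_not] at hu)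
  have h1 := h w
  rw [h0, zero_mulVec] at h1
  have h2 := gramInner_self_pos hH hw
  simp only [gramInner, mulVec_zero, dotProduct_zero, Complex.zero_re] at h1 h2
  nlinarith

theorem exists_le_exp_neg_of_lt {x s δ₀ : ℝ} (hδ₀ : s < δ₀) (hx : x < Real.exp (-s)) :
    ∃ δ, s < δ ∧ δ ≤ δ₀ ∧ x ≤ Real.exp (-δ) := by
  have hcont : ContinuousAt (fun δ : ℝ => Real.exp (-δ)) s := by fun_prop
  have h1 : ∀ᶠ δ : ℝ in 𝓝[>] s, x < Real.exp (-δ) :=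
    (hcont.eventually (lt_mem_nhds hx)).filter_mono nhdsWithin_le_nhds
  have h2 : ∀ᶠ δ : ℝ in 𝓝[>] s, δ < δ₀ :=
    (eventually_lt_nhds hδ₀).filter_mono nhdsWithin_le_nhds
  obtain ⟨δ, ⟨ha, hb⟩, hc⟩ := ((h1.and h2).and self_mem_nhdsWithin).exists
  exact ⟨δ, hc, hb.le, ha.le⟩

/-- Coercivity of the differentiation symbol implies discrete coercivity for small stepsizes. -/
theorem RungeKutta.SymbolCoercive.exists_discreteCoercivity {V : Type*} [NormedAddCommGroup V]
    [InnerProductSpace ℂ V] [CompleteSpace V] {rk : RungeKutta m}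
    {H : Matrix (Fin m) (Fin m) ℂ} (hH : H.PosDef) {c : ℝ} (hc : 0 < c)
    (h : rk.SymbolCoercive H c) {σ : ℝ} (hσ : 0 ≤ σ) :
    ∃ τ₀ : ℝ, 0 < τ₀ ∧ ∀ (α : ℝ) (L : ℂ → V →L[ℂ] (V →L⋆[ℂ] ℂ)) (R : ℂ → V →L[ℂ] V), 0 ≤ α →
      ContinuousCoercivity σ α L R →
      ∀ τ : ℝ, 0 < τ → τ ≤ τ₀ → DiscreteCoercivity rk H σ (σ / c) τ α L R := by
  obtain ⟨δ₀, hδ₀, hcoer⟩ := h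
  have hσc : 0 ≤ σ / c := by positivity
  -- The summand `1` makes `(σ / c) τ < δ₀` strict and avoids division by zero for `σ = 0`.
  refine ⟨δ₀ / (σ / c + 1), by positivity, fun α L R hα hLR τ hτ hττ₀ => ?_⟩
  have hs : σ / c * τ < δ₀ := by
    rw [le_div_iff₀ (by positivity)] at hττ₀
    nlinarith
  -- In the open disc there is room for some `δ > σ τ / c` with `‖ζ‖ ≤ e^(-δ)`. Hence `Δ(ζ)/τ` is
  -- accretive with constant `c δ / τ > σ`, and no eigenvalue lies on the boundary line.
  have hstrict : ∀ ζ ∈ Metric.ball (0 : ℂ) (Real.exp (-(σ / c) * τ)), ∃ δ > 0, σ * τ < c * δ ∧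
      ∀ w : Fin m → ℂ, c * δ * (gramInner H w w).re ≤
        (gramInner H w (rk.symbol ζ *ᵥ w)).re := by
    intro ζ hζ
    rw [mem_ball_zero_iff, neg_mul] at hζ
    obtain ⟨δ, h1, h2, h3⟩ := exists_le_exp_neg_of_lt hs hζ
    have hδ : 0 < δ := lt_of_le_of_lt (by positivity) h1
    refine ⟨δ, hδ, ?_, hcoer δ hδ h2 ζ h3⟩
    rw [div_mul_eq_mul_div, div_lt_iff₀ hc] at h1
    linarith
  have hacc : ∀ ζ ∈ Metric.ball (0 : ℂ) (Real.exp (-(σ / c) * τ)), ∃ ε > 0,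
      IsAccretive H (σ + ε) ((τ : ℂ)⁻¹ • rk.symbol ζ) := by
    intro ζ hζ
    obtain ⟨δ, hδ, h1, h2⟩ := hstrict ζ hζ
    refine ⟨τ⁻¹ * (c * δ) - σ, ?_, fun w => ?_⟩
    · rw [gt_iff_lt, sub_pos, lt_inv_mul_iff₀ hτ]
      linarith
    · rw [smul_mulVec, gramInner_smul_right, ← Complex.ofReal_inv, Complex.re_ofReal_mul,
        add_sub_cancel, mul_assoc]
      exact mul_le_mul_of_nonneg_left (h2 w) (by positivity)
  have hρ1 : Real.exp (-(σ / c) * τ) ≤ 1 := by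
    rw [Real.exp_le_one_iff]
    nlinarith
  refine rk.discreteCoercivity hH hτ (rk.differentiableOn_symbol hρ1 ?_) ?_ ?_ hα hLR
  · intro ζ hζ
    obtain ⟨δ, hδ, -, h2⟩ := hstrict ζ hζ
    exact RungeKutta.SymbolCoercive.isUnit hH (mul_pos hc hδ) h2
  · intro ζ hζ w
    obtain ⟨ε, hε, h2⟩ := hacc ζ hζ
    have := mul_nonneg hε.le (gramInner_self_nonneg hH w)
    linarith [h2 w]
  · intro ζ hζ ζ' _ l w hl hw
    obtain ⟨ε, hε, h2⟩ := hacc ζ hζ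
    rcases eq_or_ne w 0 with rfl | hw0
    · simp
    · have := h2.le_re_of_mulVec_eq hH hw0 hw
      linarith

theorem gramInner_gram (rk : RungeKutta m) (u v : Fin m → ℂ) :
    gramInner rk.gram u v = ∑ i, (rk.b i : ℂ) * (star (u i) * v i) := by
  simp only [gramInner, RungeKutta.gram, dotProduct, mulVec_diagonal, Pi.star_apply]
  exact Finset.sum_congr rfl fun i _ => by ring

theorem RungeKutta.AlgebraicallyStable.posDef_gram {rk : RungeKutta m}
    (h : rk.AlgebraicallyStable) : rk.gram.PosDef := by
  rw [RungeKutta.gram, posDef_diagonal_iff]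
  intro i
  exact_mod_cast h.1 i

end Symbol

/-! ### Algebraically stable methods -/

section AlgebraicStability

open Matrix

variable {m : ℕ}

/-- The quantity equals `(1 - |ζ|²) / |1 - ζ|²`. -/
theorem one_add_two_mul_re_div_one_sub_pos {ζ : ℂ} (hζ : ‖ζ‖ < 1) :
    0 < 1 + 2 * (ζ / (1 - ζ)).re := by
  have h1 : (1 : ℂ) - ζ ≠ 0 := by
    intro h
    rw [← sub_eq_zero.1 h, norm_one] at hζ
    exact lt_irrefl _ hζ
  have h2 := Complex.normSq_pos.2 h1
  have h3 : Complex.normSq ζ < 1 := by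
    rw [Complex.normSq_eq_norm_sq]
    nlinarith [norm_nonneg ζ]
  have h4 : 1 + 2 * (ζ / (1 - ζ)).re = (1 - Complex.normSq ζ) / Complex.normSq (1 - ζ) := by
    rw [Complex.div_re]
    field_simp
    simp only [Complex.normSq_apply, Complex.sub_re, Complex.sub_im, Complex.one_re,
      Complex.one_im]
    ring
  rw [h4]
  exact div_pos (by linarith) h2

theorem gramInner_gram_mulVec_re (rk : RungeKutta m) (y : Fin m → ℂ) :
    2 * (gramInner rk.gram y (rk.A.map (fun a => (a : ℂ)) *ᵥ y)).re -
        ‖∑ j, (rk.b j : ℂ) * y j‖ ^ 2 =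
      ∑ i, ∑ j, (rk.b i * rk.A i j + rk.b j * rk.A j i - rk.b i * rk.b j) *
        ((y i).re * (y j).re + (y i).im * (y j).im) := by
  have h1 : (gramInner rk.gram y (rk.A.map (fun a => (a : ℂ)) *ᵥ y)).re =
      ∑ i, ∑ j, rk.b i * rk.A i j * ((y i).re * (y j).re + (y i).im * (y j).im) := by
    simp only [gramInner_gram, mulVec, dotProduct, map_apply, Complex.re_sum, Finset.mul_sum]
    refine Finset.sum_congr rfl fun i _ => Finset.sum_congr rfl fun j _ => ?_
    simp [Complex.mul_re, Complex.mul_im]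
    ring
  have h2 : (gramInner rk.gram y (rk.A.map (fun a => (a : ℂ)) *ᵥ y)).re =
      ∑ i, ∑ j, rk.b j * rk.A j i * ((y i).re * (y j).re + (y i).im * (y j).im) := by
    rw [h1, Finset.sum_comm]
    exact Finset.sum_congr rfl fun i _ => Finset.sum_congr rfl fun j _ => by ring
  have h3 : ‖∑ j, (rk.b j : ℂ) * y j‖ ^ 2 =
      ∑ i, ∑ j, rk.b i * rk.b j * ((y i).re * (y j).re + (y i).im * (y j).im) := by
    rw [← Complex.normSq_eq_norm_sq, Complex.normSq_apply]
    simp only [Complex.re_sum, Complex.im_sum, Complex.re_ofReal_mul, Complex.im_ofReal_mul,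
      Finset.sum_mul_sum, ← Finset.sum_add_distrib]
    exact Finset.sum_congr rfl fun i _ => Finset.sum_congr rfl fun j _ => by ring
  rw [two_mul]
  nth_rw 1 [h1]
  rw [h2, h3]
  simp only [← Finset.sum_add_distrib, ← Finset.sum_sub_distrib]
  exact Finset.sum_congr rfl fun i _ => Finset.sum_congr rfl fun j _ => by ring

/-- The difference of the two sides is the form of the algebraic stability matrix, evaluated at the
real and at the imaginary part of `y`. -/
theorem RungeKutta.AlgebraicallyStable.le_gramInner_mulVec {rk : RungeKutta m}
    (h : rk.AlgebraicallyStable) (y : Fin m → ℂ) :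
    ‖∑ j, (rk.b j : ℂ) * y j‖ ^ 2 ≤
      2 * (gramInner rk.gram y (rk.A.map (fun a => (a : ℂ)) *ᵥ y)).re := by
  rw [← sub_nonneg, gramInner_gram_mulVec_re]
  have h1 := h.2.dotProduct_mulVec_nonneg fun i => (y i).re
  have h2 := h.2.dotProduct_mulVec_nonneg fun i => (y i).im
  refine (add_nonneg h1 h2).trans_eq ?_
  simp only [dotProduct, mulVec, of_apply, Pi.star_apply, star_trivial, Finset.mul_sum,
    ← Finset.sum_add_distrib]
  exact Finset.sum_congr rfl fun i _ => Finset.sum_congr rfl fun j _ => by ring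

theorem RungeKutta.AlgebraicallyStable.le_gramInner_symbolInv {rk : RungeKutta m}
    (h : rk.AlgebraicallyStable) (ζ : ℂ) (y : Fin m → ℂ) :
    (1 + 2 * (ζ / (1 - ζ)).re) * ‖∑ j, (rk.b j : ℂ) * y j‖ ^ 2 ≤
      2 * (gramInner rk.gram y (rk.symbolInv ζ *ᵥ y)).re := by
  have h1 : gramInner rk.gram y (fun _ => ζ / (1 - ζ) * ∑ j, (rk.b j : ℂ) * y j) =
      ((‖∑ j, (rk.b j : ℂ) * y j‖ ^ 2 : ℝ) : ℂ) * (ζ / (1 - ζ)) := by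
    have h2 : star (∑ j, (rk.b j : ℂ) * y j) = ∑ j, (rk.b j : ℂ) * star (y j) := by
      simp
    rw [gramInner_gram, ← Complex.normSq_eq_norm_sq, Complex.normSq_eq_conj_mul_self,
      starRingEnd_apply, h2]
    simp only [Finset.sum_mul]
    exact Finset.sum_congr rfl fun i _ => by ring
  have h3 := h.le_gramInner_mulVec y
  rw [rk.symbolInv_mulVec, gramInner_add_right, Complex.add_re, h1, Complex.re_ofReal_mul]
  nlinarith

/-- In the disc the coefficient of `|bᵀy|²` in the lower bound is strictly positive. Vectors with
`bᵀy = 0` do not feel the `ζ`-dependent part of `rk.symbolInv ζ`; this gives both invertibility and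
boundary eigenvectors independent of `ζ`. -/
theorem RungeKutta.AlgebraicallyStable.sum_eq_zero {rk : RungeKutta m}
    (h : rk.AlgebraicallyStable) {ζ : ℂ} (hζ : ‖ζ‖ < 1) {y : Fin m → ℂ}
    (hy : (gramInner rk.gram y (rk.symbolInv ζ *ᵥ y)).re = 0) :
    ∑ j, (rk.b j : ℂ) * y j = 0 := by
  have h1 := h.le_gramInner_symbolInv ζ y
  rw [hy, mul_zero] at h1
  have h2 := nonpos_of_mul_nonpos_right h1 (one_add_two_mul_re_div_one_sub_pos hζ)
  simpa using le_antisymm h2 (by positivity)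

theorem RungeKutta.symbolInv_mulVec_of_sum_eq_zero (rk : RungeKutta m) (ζ : ℂ) {w : Fin m → ℂ}
    (hw : ∑ j, (rk.b j : ℂ) * w j = 0) :
    rk.symbolInv ζ *ᵥ w = (rk.A.map (fun a => (a : ℂ))) *ᵥ w := by
  rw [rk.symbolInv_mulVec, hw, mul_zero]
  exact add_zero _

theorem RungeKutta.AlgebraicallyStable.isUnit_symbolInv {rk : RungeKutta m}
    (h : rk.AlgebraicallyStable) (hA : IsUnit rk.A.det) {ζ : ℂ} (hζ : ‖ζ‖ < 1) :
    IsUnit (rk.symbolInv ζ) := by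
  by_contra hu
  obtain ⟨y, hy, hy0⟩ := exists_mulVec_eq_zero_iff.2
    (show (rk.symbolInv ζ).det = 0 by
      rwa [isUnit_iff_isUnit_det, isUnit_iff_ne_zero, not_not] at hu)
  rw [rk.symbolInv_mulVec_of_sum_eq_zero ζ
    (h.sum_eq_zero hζ (by simp [hy0, gramInner]))] at hy0
  have hdet : (rk.A.map (fun a => (a : ℂ))).det = 0 :=
    exists_mulVec_eq_zero_iff.1 ⟨y, hy, hy0⟩
  have hmap : (rk.A.map (fun a => (a : ℂ))).det = (rk.A.det : ℂ) :=
    (Complex.ofRealHom.map_det rk.A).symm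
  rw [hmap, Complex.ofReal_eq_zero] at hdet
  exact hA.ne_zero hdet

/-- Algebraically stable methods inherit coercivity on the right half-plane for all stepsizes. -/
theorem RungeKutta.AlgebraicallyStable.discreteCoercivity {V : Type*} [NormedAddCommGroup V]
    [InnerProductSpace ℂ V] [CompleteSpace V] {rk : RungeKutta m}
    (h : rk.AlgebraicallyStable) (hA : IsUnit rk.A.det) {α : ℝ} (hα : 0 ≤ α)
    {L : ℂ → V →L[ℂ] (V →L⋆[ℂ] ℂ)} {R : ℂ → V →L[ℂ] V} (hLR : ContinuousCoercivity 0 α L R)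
    {τ : ℝ} (hτ : 0 < τ) : DiscreteCoercivity rk rk.gram 0 0 τ α L R := by
  have hexp : Real.exp (-0 * τ) = 1 := by simp
  have hunit : ∀ ζ ∈ Metric.ball (0 : ℂ) (Real.exp (-0 * τ)), IsUnit (rk.symbolInv ζ).det := by
    intro ζ hζ
    rw [hexp, mem_ball_zero_iff] at hζ
    exact (isUnit_iff_isUnit_det _).1 (h.isUnit_symbolInv hA hζ)
  have hτ0 : (τ : ℂ) ≠ 0 := by exact_mod_cast hτ.ne'
  refine rk.discreteCoercivity h.posDef_gram hτ (rk.differentiableOn_symbol hexp.le fun ζ hζ =>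
    (isUnit_iff_isUnit_det _).2 (hunit ζ hζ)) ?_ ?_ hα hLR
  -- With `y = Δ(ζ)w` the real part of `(w, Δ(ζ)w)` is that of `(y, Δ(ζ)⁻¹y)`, which is nonnegative.
  · intro ζ hζ w
    have h1 : rk.symbolInv ζ *ᵥ (rk.symbol ζ *ᵥ w) = w := by
      rw [mulVec_mulVec, RungeKutta.symbol, mul_nonsing_inv _ (hunit ζ hζ), one_mulVec]
    have h2 := h.le_gramInner_symbolInv ζ (rk.symbol ζ *ᵥ w)
    rw [h1, ← star_gramInner h.posDef_gram.isHermitian, RCLike.star_def, Complex.conj_re] at h2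
    rw [hexp, mem_ball_zero_iff] at hζ
    have h3 := (one_add_two_mul_re_div_one_sub_pos hζ).le
    rw [zero_mul, smul_mulVec, gramInner_smul_right, ← Complex.ofReal_inv, Complex.re_ofReal_mul]
    have h4 : 0 ≤ (gramInner rk.gram w (rk.symbol ζ *ᵥ w)).re := by
      have : 0 ≤ (1 + 2 * (ζ / (1 - ζ)).re) *
        ‖∑ j, (rk.b j : ℂ) * (rk.symbol ζ *ᵥ w) j‖ ^ 2 := by positivity
      linarith
    positivity
  · intro ζ hζ ζ' hζ' l w hl hw
    have hmul : rk.symbol ζ *ᵥ w = ((τ : ℂ) * l) • w := by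
      rw [mul_smul, ← hw, smul_mulVec, smul_inv_smul₀ hτ0]
    have h1 : ((τ : ℂ) * l) • (rk.symbolInv ζ *ᵥ w) = w := by
      rw [← mulVec_smul, ← hmul, mulVec_mulVec, RungeKutta.symbol,
        mul_nonsing_inv _ (hunit ζ hζ), one_mulVec]
    -- Invertibility of the symbol forces `w = 0` when `l = 0`.
    rcases eq_or_ne l 0 with rfl | hl0
    · rw [mul_zero, zero_smul] at h1
      simp [← h1]
    have hτl : (τ : ℂ) * l ≠ 0 := mul_ne_zero hτ0 hl0
    have h2 : rk.symbolInv ζ *ᵥ w = ((τ : ℂ) * l)⁻¹ • w := by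
      rw [eq_inv_smul_iff₀ hτl, h1]
    -- The eigenvalue of `rk.symbolInv ζ` is again imaginary, so `(w, Δ(ζ)⁻¹w)` has zero real part.
    have h3 : ∑ j, (rk.b j : ℂ) * w j = 0 := by
      refine h.sum_eq_zero (by rwa [hexp, mem_ball_zero_iff] at hζ) ?_
      rw [h2, gramInner_smul_right, Complex.mul_re,
        gramInner_self_im h.posDef_gram.isHermitian, Complex.inv_re, Complex.re_ofReal_mul, hl]
      simp
    rw [rk.symbolInv_mulVec_of_sum_eq_zero ζ h3] at h1
    rw [smul_mulVec]
    have h4 : rk.symbol ζ' *ᵥ w = ((τ : ℂ) * l) • w := by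
      conv_lhs => rw [← h1]
      rw [← rk.symbolInv_mulVec_of_sum_eq_zero ζ' h3, mulVec_smul, mulVec_mulVec,
        RungeKutta.symbol, nonsing_inv_mul _ (hunit ζ' hζ'), one_mulVec]
    rw [h4, mul_smul, inv_smul_smul₀ hτ0]

end AlgebraicStability

/-! ### The two-stage Radau IIA method -/

section RadauIIA

open Matrix

theorem RungeKutta.symbol_radauIIA2 {ζ : ℂ} (hζ : ζ ≠ 1) :
    RungeKutta.radauIIA2.symbol ζ =
      !![3 / 2, 1 / 2 - 2 * ζ; -9 / 2, 5 / 2 + 2 * ζ] := by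
  have h : (1 : ℂ) - ζ ≠ 0 := sub_ne_zero.2 hζ.symm
  refine inv_eq_right_inv ?_
  ext i j
  fin_cases i <;> fin_cases j <;>
    simp [RungeKutta.symbolInv, RungeKutta.radauIIA2, mul_apply, Fin.sum_univ_two] <;>
    field_simp <;> ring

theorem add_sub_mul_nonneg_of_sq_le {a b x y k : ℝ} (ha : 0 < a) (hab : k ^ 2 ≤ 4 * a * b) :
    0 ≤ a * x ^ 2 + b * y ^ 2 - k * x * y := by
  have h : 0 ≤ 4 * a * (a * x ^ 2 + b * y ^ 2 - k * x * y) := by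
    nlinarith [sq_nonneg (2 * a * x - k * y), mul_nonneg (sub_nonneg.2 hab) (sq_nonneg y)]
  exact nonneg_of_mul_nonneg_right h (by positivity)

/-- The two-stage Radau IIA method has a coercive differentiation symbol for every `c < 1`. -/
theorem RungeKutta.symbolCoercive_radauIIA2 {c : ℝ} (hc : 0 < c) (hc1 : c < 1) :
    RungeKutta.radauIIA2.SymbolCoercive RungeKutta.radauIIA2.gram c := by
  -- This bound on `δ` is what `e^(-2δ) ≤ 1 - 2cδ` needs, given `e^(-δ) ≤ 1/(1 + δ)`.
  refine ⟨(1 - c) / 2, by linarith, fun δ hδ hδ₀ ζ hζ w => ?_⟩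
  have hnorm1 : ‖ζ‖ < 1 := hζ.trans_lt (by simpa using hδ)
  have hne : ζ ≠ 1 := by
    rintro rfl
    simp at hnorm1
  have hε : 0 < c * δ := mul_pos hc hδ
  have hε1 : c * δ ≤ 1 / 8 := by nlinarith [sq_nonneg (2 * c - 1)]
  have hsq : ‖ζ‖ ^ 2 ≤ 1 - 2 * (c * δ) := by
    have h1 : ‖ζ‖ * (1 + δ) ≤ 1 := by
      calc ‖ζ‖ * (1 + δ) ≤ Real.exp (-δ) * Real.exp δ := by
            gcongr
            linarith [Real.add_one_le_exp δ]
        _ = 1 := by rw [← Real.exp_add]; simp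
    have h2 : ‖ζ‖ ^ 2 * (1 + δ) ^ 2 ≤ 1 := by
      rw [← mul_pow]
      exact pow_le_one₀ (by positivity) h1
    have h3 : 1 ≤ (1 - 2 * (c * δ)) * (1 + δ) ^ 2 := by
      have h4 : 0 ≤ δ * (1 - c - 2 * δ) := mul_nonneg hδ.le (by linarith)
      have h5 : 0 ≤ δ ^ 2 * (1 - c) := mul_nonneg (sq_nonneg δ) (by linarith)
      have h6 : 0 ≤ δ ^ 2 * (1 - 2 * (c * δ)) := mul_nonneg (sq_nonneg δ) (by linarith)
      nlinarith
    exact le_of_mul_le_mul_right (h2.trans h3) (by positivity)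
  have hre : ζ.re ≤ 1 := (Complex.re_le_norm ζ).trans hnorm1.le
  have hform : (gramInner RungeKutta.radauIIA2.gram w
        (RungeKutta.radauIIA2.symbol ζ *ᵥ w)).re -
        c * δ * (gramInner RungeKutta.radauIIA2.gram w w).re =
      (9 / 8 - 3 / 4 * (c * δ)) * ‖w 0‖ ^ 2 + (5 / 8 + ζ.re / 2 - c * δ / 4) * ‖w 1‖ ^ 2 -
        (star (w 0) * w 1 * (3 / 4 + 3 / 2 * ζ)).re := by
    rw [RungeKutta.symbol_radauIIA2 hne, gramInner_gram, gramInner_gram,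
      ← Complex.normSq_eq_norm_sq, ← Complex.normSq_eq_norm_sq]
    simp [RungeKutta.radauIIA2, Fin.sum_univ_two, mulVec, dotProduct, neg_div]
    rw [Complex.normSq_apply, Complex.normSq_apply]
    ring
  have hk : ‖(3 / 4 + 3 / 2 * ζ : ℂ)‖ ^ 2 = 9 / 16 + 9 / 4 * ζ.re + 9 / 4 * ‖ζ‖ ^ 2 := by
    have h1 : (3 / 4 + 3 / 2 * ζ : ℂ) = ((3 / 4 : ℝ) : ℂ) + ((3 / 2 : ℝ) : ℂ) * ζ := by norm_num
    rw [h1, ← Complex.normSq_eq_norm_sq, ← Complex.normSq_eq_norm_sq]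
    simp only [Complex.normSq_apply, Complex.add_re, Complex.add_im, Complex.re_ofReal_mul,
      Complex.im_ofReal_mul, Complex.ofReal_re, Complex.ofReal_im]
    ring
  have hcross : (star (w 0) * w 1 * (3 / 4 + 3 / 2 * ζ)).re ≤
      ‖(3 / 4 + 3 / 2 * ζ : ℂ)‖ * ‖w 0‖ * ‖w 1‖ := by
    refine (Complex.re_le_norm _).trans_eq ?_
    rw [norm_mul, norm_mul, norm_star]
    ring
  -- For `|ζ| = 1` and `c δ = 0` the discriminant vanishes on the whole circle. With `e = c δ` and
  -- `|ζ|² ≤ 1 - 2e`, the slack `4ab - k²` is at least `(3/2) e (1 - Re ζ) + (3/4) e²`.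
  have hquad := add_sub_mul_nonneg_of_sq_le (a := 9 / 8 - 3 / 4 * (c * δ))
    (b := 5 / 8 + ζ.re / 2 - c * δ / 4) (x := ‖w 0‖) (y := ‖w 1‖)
    (k := ‖(3 / 4 + 3 / 2 * ζ : ℂ)‖) (by linarith) (by
      rw [hk]
      nlinarith [mul_nonneg hε.le (sub_nonneg.2 hre), sq_nonneg (c * δ)])
  linarith

end RadauIIA

theorem mainTheorem1 {V : Type*} [NormedAddCommGroup V] [InnerProductSpace ℂ V]
    [CompleteSpace V] :
    (∀ (m : ℕ) (rk : RungeKutta m), IsUnit rk.A.det →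
      ∀ H : Matrix (Fin m) (Fin m) ℂ, H.PosDef →
      ∀ c : ℝ, 0 < c → rk.SymbolCoercive H c →
      ∀ σ : ℝ, 0 ≤ σ → ∃ τ₀ : ℝ, 0 < τ₀ ∧
        ∀ (α : ℝ) (L : ℂ → V →L[ℂ] (V →L⋆[ℂ] ℂ)) (R : ℂ → V →L[ℂ] V), 0 ≤ α →
          ContinuousCoercivity σ α L R →
          ∀ τ : ℝ, 0 < τ → τ ≤ τ₀ → DiscreteCoercivity rk H σ (σ / c) τ α L R) ∧
    (∀ c : ℝ, 0 < c → c < 1 →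
      RungeKutta.radauIIA2.SymbolCoercive RungeKutta.radauIIA2.gram c) ∧
    (∀ (m : ℕ) (rk : RungeKutta m), IsUnit rk.A.det → rk.AlgebraicallyStable →
      ∀ (α : ℝ) (L : ℂ → V →L[ℂ] (V →L⋆[ℂ] ℂ)) (R : ℂ → V →L[ℂ] V), 0 ≤ α →
        ContinuousCoercivity 0 α L R →
        ∀ τ : ℝ, 0 < τ → DiscreteCoercivity rk rk.gram 0 0 τ α L R) := by
  refine ⟨fun m rk _ H hH c hc h σ hσ => h.exists_discreteCoercivity hH hc hσ,
    fun c hc hc1 => RungeKutta.symbolCoercive_radauIIA2 hc hc1,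
    fun m rk hA h α L R hα hLR τ hτ => h.discreteCoercivity hA hα hLR hτ⟩
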